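/- A formal manifold is a paracompact Hausdorff locally ringed space $(M,\mathcal O)$ over $\mathrm{Spec}\,\mathbb C$ which is locally isomorphic, over $\mathbb C$, to the spaces $(\mathbb R^n)^{(k)}$, i.e. $\mathbb R^n$ with the sheaf $W\mapsto C^\infty(W)[[y_1,\dots,y_k]]$ ($n,k\ge 0$ may vary). Let $M$ be a formal manifold, $\mathcal F$ a sheaf of $\mathcal O$-modules, and $E$ a quasi-complete Hausdorff locally convex topological vector space over $\mathbb C$ (LCS). Write $\underline{\mathcal O}$ for the structure sheaf of the reduction of $M$ (the sheaf of complex functions locally given by values $a\mapsto f(a)\in\mathcal O_a/\mathfrak m_a=\mathbb C$ of formal functions) and $\underline{\mathcal D}$ for the sheaf of smooth densities on the reduction. For sheaves of $\mathcal O$-modules $\mathcal F_1,\mathcal F_2$ on an open set $U\subseteq M$, a differential operator $\mathcal F_1|_U\to\mathcal F_2|_U$ is a homomorphism of sheaves of complex vector spaces which is locally of finite order, where order $\le r$ means that all $(r+1)$-fold commutators with sections of $\mathcal O$ vanish. $\mathrm{Diff}_{\mathrm{fin}}$, $\mathrm{Diff}_c$ and $\mathrm{Diff}_{K,r}$ denote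 those of finite order, those of compact support, and those of order $\le r$ supported in the compact set $K\subseteq U$, respectively. For a sheaf of $\mathcal O$-modules $\mathcal F$, the smooth topology on $\mathcal F(U)$ is given by the seminorms $|u|_D=\sup_{a\in U}|(Du)(a)|$, $D\in\mathrm{Diff}_c(\mathcal F|_U,\underline{\mathcal O}|_U)$. All inductive limits and direct sums of topological vector spaces are those of locally convex spaces. Consider the following spaces. (1) $\mathrm D_c^\infty(U;\mathcal F)$ is the space of the functionals $u\mapsto\int_U D(u)$ on $\mathcal F(U)$ with $D\in\mathrm{Diff}_c(\mathcal F|_U,\underline{\mathcal D}|_U)$. It is the inductive limit of its subspaces $\mathrm D^\infty_{K,r}(U;\mathcal F)$, the images of $\mathrm{Diff}_{K,r}(\mathcal F|_U,\underline{\mathcal D}|_U)$ with the quotient topology, where $\mathrm{Diff}_{K,r}$ carries the subspace topology of $\mathrm{Diff}_{\mathrm{fin}}(\mathcal F|_U,\underline{\mathcal D}|_U)$, topologized by the seminorms $D\mapsto\sup_{a\in U}|(X(D(u)))(a)|$ ($X\in\mathrm{Diff}_c(\underline{\mathcal D}|_U,\underline{\mathcal O}|_U)$, $u\in\mathcal F(U)$).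 The extension map $\mathrm{ext}_{M,U}:\mathrm D_c^\infty(U;\mathcal F)\to\mathrm D_c^\infty(M;\mathcal F)$ is $\eta\mapsto(u\mapsto\eta(u|_U))$. (2) $\mathcal F_c(U)$ is the space of compactly supported sections of $\mathcal F$ over $U$, the inductive limit over compact $K\subseteq U$ of the spaces $\mathcal F_K(U)$ of sections supported in $K$, with the subspace topology of the smooth topology. $\mathrm{ext}_{M,U}:\mathcal F_c(U)\to\mathcal F_c(M)$ is extension by zero. (3) Let $\mathrm D^{-\infty}(U;\mathcal F;E)$ be the space of continuous linear maps $\mathcal F_c(U)\to E$ with the topology of uniform convergence on bounded sets. $\mathrm D_c^{-\infty}(U;\mathcal F;E)$ is the subspace of the elements with compact support, as the inductive limit over compact $K\subseteq U$ of the subspaces of elements supported in $K$ (with the subspace topology). $\mathrm{ext}_{M,U}:\mathrm D_c^{-\infty}(U;\mathcal F;E)\to\mathrm D_c^{-\infty}(M;\mathcal F;E)$ is extension by zero: $\mathrm{ext}_{M,U}(\eta)$ is the unique element which restricts to $\eta$ on $U$ and is supported in the support of $\eta$. Let $\{U_\alpha\}_{\alpha\in\Gamma}$ be an open cover of $M$.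 A partition of unity subordinate to it is a family $f_\alpha\in\mathcal O(M)$ with $\mathrm{supp}\,f_\alpha\subseteq U_\alpha$, locally finite supports, $\sum_\alpha f_\alpha=1$, and values $f_\alpha(a)\in[0,1]$ for all $a\in M$. Then such partitions of unity exist, and for each of the three assignments $\mathcal C=\mathrm D_c^\infty(\,\cdot\,;\mathcal F)$, $\mathcal F_c$, $\mathrm D_c^{-\infty}(\,\cdot\,;\mathcal F;E)$ the extension maps $\mathrm{ext}_{M,U_\alpha}$ are well defined, and the linear map $$\bigoplus_{\alpha\in\Gamma}\mathcal C(U_\alpha)\to\mathcal C(M),\qquad \{c_\alpha\}_\alpha\mapsto\sum_\alpha\mathrm{ext}_{M,U_\alpha}(c_\alpha)$$ is continuous, open and surjective. Moreover, for every partition of unity $\{f_\alpha\}$ subordinate to $\{U_\alpha\}$ this map has a continuous linear right inverse, given by $$\eta\mapsto\{(\eta\circ f_\alpha)|_{U_\alpha}\}_\alpha,\qquad u\mapsto\{(f_\alpha u)|_{U_\alpha}\}_\alpha,\qquad \eta\mapsto\{(\eta\circ f_\alpha)|_{U_\alpha}\}_\alpha$$ in the three cases, respectively. In the first and third case $(\eta\circ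 f_\alpha)|_{U_\alpha}$ is the functional $s\mapsto\eta(f_\alpha s)$, where $f_\alpha s$ is extended by zero to $M$. -/

import Mathlib

open CategoryTheory TopologicalSpace Opposite AlgebraicGeometry MeasureTheory
open scoped ContDiff DirectSum Topology

universe u v w x

noncomputable section

/-! ### Locally ringed spaces over `Spec ℂ` -/

/-- A locally ringed space over `Spec ℂ`. -/
structure ComplexLRS where
  /-- the underlying locally ringed space -/
  toLRS : LocallyRingedSpace.{u}
  /-- the structure morphism to `Spec ℂ` -/
  structureMap : toLRS ⟶ Spec.locallyRingedSpaceObj (CommRingCat.of (ULift.{u} ℂ))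

namespace ComplexLRS

/-- The underlying topological space. -/
abbrev pt (M : ComplexLRS.{u}) : TopCat.{u} := M.toLRS.toTopCat

/-- Sections of the structure sheaf over `U`, i.e. formal functions on `U`. -/
def Fun (M : ComplexLRS.{u}) (U : Opens M.pt) : Type u := M.toLRS.presheaf.obj (op U)

instance (M : ComplexLRS.{u}) (U : Opens M.pt) : CommRing (M.Fun U) :=
  inferInstanceAs (CommRing (M.toLRS.presheaf.obj (op U)))

/-- The ring homomorphism `ℂ → 𝒪(M)` induced by the structure morphism to `Spec ℂ`. -/
def const (M : ComplexLRS.{u}) : ℂ →+* M.Fun ⊤ :=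
  ((M.structureMap.c.app (op ⊤)).hom.comp
    (StructureSheaf.globalSectionsIso (CommRingCat.of (ULift.{u} ℂ))).hom.hom).comp
    (ULift.ringEquiv (R := ℂ)).symm.toRingHom

/-- Restriction of formal functions, as a ring homomorphism. -/
def resRing (M : ComplexLRS.{u}) {U V : Opens M.pt} (h : V ≤ U) : M.Fun U →+* M.Fun V :=
  (M.toLRS.presheaf.map (homOfLE h).op).hom

lemma resRing_resRing (M : ComplexLRS.{u}) {U V W : Opens M.pt} (h : V ≤ U) (h' : W ≤ V)
    (f : M.Fun U) : M.resRing h' (M.resRing h f) = M.resRing (h'.trans h) f := by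
  have := M.toLRS.presheaf.map_comp (homOfLE h).op (homOfLE h').op
  exact (congrArg (fun g => g.hom f) this).symm

instance (M : ComplexLRS.{u}) (U : Opens M.pt) : Algebra ℂ (M.Fun U) :=
  ((M.resRing le_top).comp M.const).toAlgebra

/-- Restriction of formal functions. -/
def res (M : ComplexLRS.{u}) {U V : Opens M.pt} (h : V ≤ U) : M.Fun U →ₐ[ℂ] M.Fun V :=
  { M.resRing h with commutes' := fun z => M.resRing_resRing le_top h (M.const z) }

lemma res_res (M : ComplexLRS.{u}) {U V W : Opens M.pt} (h : V ≤ U) (h' : W ≤ V)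
    (f : M.Fun U) : M.res h' (M.res h f) = M.res (h'.trans h) f :=
  M.resRing_resRing h h' f

/-- The germ of a formal function at a point. -/
def germ (M : ComplexLRS.{u}) {U : Opens M.pt} (a : M.pt) (ha : a ∈ U) :
    M.Fun U →+* M.toLRS.presheaf.stalk a :=
  (M.toLRS.presheaf.germ U a ha).hom

lemma germ_res (M : ComplexLRS.{u}) {U V : Opens M.pt} (h : V ≤ U) (a : M.pt) (ha : a ∈ V)
    (f : M.Fun U) : M.germ a ha (M.res h f) = M.germ a (h ha) f :=
  M.toLRS.presheaf.germ_res_apply (homOfLE h) a ha f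

/-- The support of a formal function on `U`, as a subset of `M`. -/
def supp (M : ComplexLRS.{u}) {U : Opens M.pt} (f : M.Fun U) : Set M.pt :=
  {a | a ∈ U ∧ ∀ (V : Opens M.pt) (h : V ≤ U), a ∈ V → M.res h f ≠ 0}

/-- The structure sheaf as a sheaf of (not necessarily commutative) rings. -/
abbrev ringSheaf (M : ComplexLRS.{u}) : TopCat.Sheaf RingCat.{u} M.pt :=
  (sheafCompose _ (forget₂ CommRingCat RingCat.{u})).obj M.toLRS.sheaf

end ComplexLRS

/-! ### Formal manifolds -/

lemma extend_val_apply {α : Type*} {W : Set α} (k : W → ℂ) {x : α} (hx : x ∈ W) :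
    Function.extend Subtype.val k (fun _ => 0) x = k ⟨x, hx⟩ :=
  Subtype.val_injective.extend_apply k _ ⟨x, hx⟩

/-- The `ℂ`-algebra of complex valued smooth functions on a subset `W` of `ℝⁿ`
(only used for open `W`). -/
def SmoothFn {n : ℕ} (W : Set (EuclideanSpace ℝ (Fin n))) : Subalgebra ℂ (W → ℂ) where
  carrier := {f | ContDiffOn ℝ ∞ (Function.extend Subtype.val f (fun _ => 0)) W}
  mul_mem' {f g} hf hg := (hf.mul hg).congr fun x hx => by simp [extend_val_apply _ hx]
  add_mem' {f g} hf hg := (hf.add hg).congr fun x hx => by simp [extend_val_apply _ hx]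
  algebraMap_mem' z := (contDiffOn_const (c := z)).congr fun x hx => by
    rw [extend_val_apply _ hx]; rfl

/-- Restriction of smooth functions. -/
def SmoothFn.restrict {n : ℕ} {W W' : Set (EuclideanSpace ℝ (Fin n))} (h : W' ⊆ W) :
    SmoothFn W →+* SmoothFn W' where
  toFun f := ⟨fun x => f.1 ⟨x.1, h x.2⟩, (f.2.mono h).congr fun x hx => by
    rw [extend_val_apply _ hx, extend_val_apply _ (h hx)]⟩
  map_one' := rfl
  map_mul' _ _ := rfl
  map_zero' := rfl
  map_add' _ _ := rfl

/-- A chart of dimension `n`: an isomorphism, as ringed spaces over `ℂ`, of an open subspace of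
`M` onto `(ℝⁿ)^(k)`, that is, `ℝⁿ` with the sheaf `W ↦ C^∞(W)[[y₁, …, y_k]]`.
(Such an isomorphism is automatically one of locally ringed spaces.) -/
structure ComplexLRS.Chart (M : ComplexLRS.{u}) (n : ℕ) where
  /-- the degree -/
  k : ℕ
  /-- the homeomorphism of an open subset of `M` onto `ℝⁿ` -/
  toHomeo : OpenPartialHomeomorph M.pt (EuclideanSpace ℝ (Fin n))
  target_eq : toHomeo.target = Set.univ
  /-- the isomorphisms on sections, over the open subsets `V` of the source -/
  iso : ∀ V : Opens M.pt, (V : Set M.pt) ⊆ toHomeo.source →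
    M.Fun V ≃ₐ[ℂ] MvPowerSeries (Fin k) (SmoothFn (toHomeo.symm ⁻¹' (V : Set M.pt)))
  iso_res : ∀ (V W : Opens M.pt) (hV : (V : Set M.pt) ⊆ toHomeo.source) (h : W ≤ V)
    (f : M.Fun V),
    iso W (subset_trans h hV) (M.res h f) =
      MvPowerSeries.map (SmoothFn.restrict (Set.preimage_mono h)) (iso V hV f)

/-- A formal manifold: a paracompact Hausdorff locally ringed space over `Spec ℂ` which is locally
isomorphic to the spaces `(ℝⁿ)^(k)`. -/
class IsFormalManifold (M : ComplexLRS.{u}) : Prop where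
  t2 : T2Space M.pt
  paracompact : ParacompactSpace M.pt
  exists_chart : ∀ a : M.pt, ∃ (n : ℕ) (c : M.Chart n), a ∈ c.toHomeo.source

attribute [instance] IsFormalManifold.t2 IsFormalManifold.paracompact

namespace ComplexLRS

/-- `f` takes the value `z` at `a`: the germ of `f - z` lies in the maximal ideal of `𝒪_a`. -/
def HasValue (M : ComplexLRS.{u}) {U : Opens M.pt} (f : M.Fun U) (a : M.pt) (z : ℂ) : Prop :=
  ∃ ha : a ∈ U, M.germ a ha (f - algebraMap ℂ _ z) ∈
    IsLocalRing.maximalIdeal (M.toLRS.presheaf.stalk a)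

open Classical in
/-- The value of a formal function at a point of `U`, with the value zero outside `U`. -/
def value (M : ComplexLRS.{u}) {U : Opens M.pt} (f : M.Fun U) (a : M.pt) : ℂ :=
  if h : ∃ z, M.HasValue f a z then h.choose else 0

variable {M : ComplexLRS.{u}}

lemma HasValue.unique {U : Opens M.pt} {f : M.Fun U} {a : M.pt} {z z' : ℂ}
    (h : M.HasValue f a z) (h' : M.HasValue f a z') : z = z' := by
  obtain ⟨ha, h⟩ := h
  obtain ⟨_, h'⟩ := h'
  by_contra hne
  have h1 := Ideal.sub_mem _ h' h
  rw [← map_sub, sub_sub_sub_cancel_left, ← map_sub] at h1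
  refine (IsLocalRing.maximalIdeal.isMaximal _).ne_top (Ideal.eq_top_of_isUnit_mem _ h1 ?_)
  exact ((IsUnit.mk0 (z - z') (sub_ne_zero.2 hne)).map (algebraMap ℂ (M.Fun U))).map (M.germ a ha)

lemma HasValue.value_eq {U : Opens M.pt} {f : M.Fun U} {a : M.pt} {z : ℂ}
    (h : M.HasValue f a z) : M.value f a = z := by
  have h' : ∃ z, M.HasValue f a z := ⟨z, h⟩
  rw [value, dif_pos h']
  exact h'.choose_spec.unique h

lemma HasValue.res {U V : Opens M.pt} (h : V ≤ U) {f : M.Fun U} {a : M.pt} {z : ℂ} (ha : a ∈ V)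
    (hf : M.HasValue f a z) : M.HasValue (M.res h f) a z := by
  refine ⟨ha, ?_⟩
  obtain ⟨ha', hf⟩ := hf
  rw [← (M.res h).commutes z, ← map_sub, germ_res]
  exact hf

lemma HasValue.add {U : Opens M.pt} {f g : M.Fun U} {a : M.pt} {z w : ℂ}
    (hf : M.HasValue f a z) (hg : M.HasValue g a w) : M.HasValue (f + g) a (z + w) := by
  obtain ⟨ha, hf⟩ := hf
  obtain ⟨_, hg⟩ := hg
  refine ⟨ha, ?_⟩
  rw [map_add, add_sub_add_comm, map_add]
  exact Ideal.add_mem _ hf hg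

lemma HasValue.mul {U : Opens M.pt} {f g : M.Fun U} {a : M.pt} {z w : ℂ}
    (hf : M.HasValue f a z) (hg : M.HasValue g a w) : M.HasValue (f * g) a (z * w) := by
  obtain ⟨ha, hf⟩ := hf
  obtain ⟨_, hg⟩ := hg
  refine ⟨ha, ?_⟩
  have : f * g - algebraMap ℂ _ (z * w) =
      f * (g - algebraMap ℂ _ w) + algebraMap ℂ _ w * (f - algebraMap ℂ _ z) := by
    rw [map_mul]; ring
  rw [this, map_add, map_mul, map_mul]
  exact Ideal.add_mem _ (Ideal.mul_mem_left _ _ hg) (Ideal.mul_mem_left _ _ hf)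

lemma hasValue_const (U : Opens M.pt) {a : M.pt} (ha : a ∈ U) (z : ℂ) :
    M.HasValue (algebraMap ℂ (M.Fun U) z) a z :=
  ⟨ha, by rw [sub_self, map_zero]; exact Ideal.zero_mem _⟩

/-- The open set on which a chart is defined. -/
def Chart.opens {n : ℕ} (c : M.Chart n) : Opens M.pt := ⟨c.toHomeo.source, c.toHomeo.open_source⟩

lemma Chart.symm_mem {n : ℕ} (c : M.Chart n) (x : EuclideanSpace ℝ (Fin n)) :
    c.toHomeo.symm x ∈ c.toHomeo.source :=
  c.toHomeo.map_target (by rw [c.target_eq]; trivial)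

lemma Chart.apply_symm {n : ℕ} (c : M.Chart n) (x : EuclideanSpace ℝ (Fin n)) :
    c.toHomeo (c.toHomeo.symm x) = x :=
  c.toHomeo.right_inv (by rw [c.target_eq]; trivial)

lemma Chart.continuous_symm {n : ℕ} (c : M.Chart n) : Continuous c.toHomeo.symm := by
  have := c.toHomeo.continuousOn_symm
  rwa [c.target_eq, continuousOn_univ] at this

/-- In a chart, the value of a formal function is given by the constant coefficient of its
power series expansion. -/
lemma Chart.hasValue {n : ℕ} (c : M.Chart n) {V : Opens M.pt} (hV : (V : Set M.pt) ⊆ c.toHomeo.source)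
    (f : M.Fun V) (x : EuclideanSpace ℝ (Fin n)) (hx : c.toHomeo.symm x ∈ V) :
    M.HasValue f (c.toHomeo.symm x) ((MvPowerSeries.constantCoeff (c.iso V hV f)).1 ⟨x, hx⟩) := by
  refine ⟨hx, ?_⟩
  rw [IsLocalRing.mem_maximalIdeal, mem_nonunits_iff]
  intro hu
  obtain ⟨(W : Opens M.pt), i, hW, hu⟩ := M.toLRS.toRingedSpace.isUnit_res_of_isUnit_germ V _ _ hx hu
  have h : W ≤ V := i.le
  replace hu : IsUnit (M.res h (f - algebraMap ℂ _
    ((MvPowerSeries.constantCoeff (c.iso V hV f)).1 ⟨x, hx⟩))) := hu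
  have hu2 := ((hu.map (c.iso W (subset_trans h hV))).map MvPowerSeries.constantCoeff).map
    (SmoothFn (c.toHomeo.symm ⁻¹' (W : Set M.pt))).val
  have hu3 := hu2.map (Pi.evalRingHom (fun _ => ℂ) ⟨x, hW⟩)
  rw [c.iso_res V W hV h, map_sub, AlgEquiv.commutes] at hu3
  simp [SmoothFn.restrict, MvPowerSeries.algebraMap_apply] at hu3

lemma exists_hasValue [IsFormalManifold M] {U : Opens M.pt} (f : M.Fun U) {a : M.pt} (ha : a ∈ U) :
    ∃ z, M.HasValue f a z := by
  obtain ⟨n, c, hc⟩ := IsFormalManifold.exists_chart a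
  obtain ⟨x, rfl⟩ : ∃ x, c.toHomeo.symm x = a := ⟨_, c.toHomeo.left_inv hc⟩
  have h := c.hasValue (V := U ⊓ c.opens) (fun y hy => hy.2) (M.res inf_le_left f) x ⟨ha, hc⟩
  obtain ⟨_, h⟩ := h
  rw [← (M.res (inf_le_left : U ⊓ c.opens ≤ U)).commutes, ← map_sub, germ_res] at h
  exact ⟨_, ha, h⟩

lemma hasValue_value [IsFormalManifold M] {U : Opens M.pt} (f : M.Fun U) {a : M.pt} (ha : a ∈ U) :
    M.HasValue f a (M.value f a) := by
  obtain ⟨z, hz⟩ := exists_hasValue f ha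
  rwa [hz.value_eq]

lemma value_of_notMem {U : Opens M.pt} (f : M.Fun U) {a : M.pt} (ha : a ∉ U) :
    M.value f a = 0 :=
  dif_neg fun ⟨_, h, _⟩ => ha h

lemma value_const {U : Opens M.pt} (z : ℂ) {a : M.pt} (ha : a ∈ U) :
    M.value (algebraMap ℂ (M.Fun U) z) a = z :=
  (hasValue_const U ha z).value_eq

section
variable [IsFormalManifold M] {U : Opens M.pt}

lemma value_res {V : Opens M.pt} (h : V ≤ U) (f : M.Fun U) {a : M.pt} (ha : a ∈ V) :
    M.value (M.res h f) a = M.value f a :=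
  ((hasValue_value f (h ha)).res h ha).value_eq

lemma value_add (f g : M.Fun U) (a : M.pt) : M.value (f + g) a = M.value f a + M.value g a := by
  by_cases ha : a ∈ U
  · exact ((hasValue_value f ha).add (hasValue_value g ha)).value_eq
  · simp [value_of_notMem _ ha]

lemma value_mul (f g : M.Fun U) (a : M.pt) : M.value (f * g) a = M.value f a * M.value g a := by
  by_cases ha : a ∈ U
  · exact ((hasValue_value f ha).mul (hasValue_value g ha)).value_eq
  · simp [value_of_notMem _ ha]

lemma contDiffOn_value (f : M.Fun U) {n : ℕ} (c : M.Chart n) :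
    ContDiffOn ℝ ∞ (fun x => M.value f (c.toHomeo.symm x)) (c.toHomeo.symm ⁻¹' (U : Set M.pt)) := by
  have hV : ((U ⊓ c.opens : Opens M.pt) : Set M.pt) ⊆ c.toHomeo.source := fun y hy => hy.2
  have h := (MvPowerSeries.constantCoeff (c.iso (U ⊓ c.opens) hV (M.res inf_le_left f))).2
  refine (h.mono fun x hx => ⟨hx, c.symm_mem x⟩).congr fun x hx => ?_
  have hx' : c.toHomeo.symm x ∈ U ⊓ c.opens := ⟨hx, c.symm_mem x⟩
  rw [← value_res inf_le_left f hx', (c.hasValue hV _ x hx').value_eq]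
  exact (extend_val_apply (W := c.toHomeo.symm ⁻¹' ((U ⊓ c.opens : Opens M.pt) : Set M.pt))
    _ (x := x) hx').symm

end

end ComplexLRS

/-! ### Sheaves of modules and differential operators -/

/-- A presheaf of `𝒪`-modules on `M`, in terms of its sections and restriction maps. -/
structure OMod (M : ComplexLRS.{u}) where
  /-- the sections over an open set -/
  sec : Opens M.pt → Type v
  [addCommGroup : ∀ U, AddCommGroup (sec U)]
  [moduleComplex : ∀ U, Module ℂ (sec U)]
  [moduleFun : ∀ U, Module (M.Fun U) (sec U)]
  [tower : ∀ U, IsScalarTower ℂ (M.Fun U) (sec U)]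
  /-- the restriction maps -/
  res : ∀ {U V : Opens M.pt}, V ≤ U → sec U →ₗ[ℂ] sec V
  res_smul : ∀ {U V : Opens M.pt} (h : V ≤ U) (f : M.Fun U) (s : sec U),
    res h (f • s) = M.res h f • res h s
  res_self : ∀ {U : Opens M.pt} (s : sec U), res le_rfl s = s
  res_res : ∀ {U V W : Opens M.pt} (h : V ≤ U) (h' : W ≤ V) (s : sec U),
    res h' (res h s) = res (h'.trans h) s

attribute [instance] OMod.addCommGroup OMod.moduleComplex OMod.moduleFun OMod.tower

namespace OMod

variable {M : ComplexLRS.{u}}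

/-- The sections of a sheaf of `𝒪`-modules. -/
def ofSheafSec (F : SheafOfModules.{v} M.ringSheaf) (U : Opens M.pt) : Type v :=
  F.val.obj (op U)

instance (F : SheafOfModules.{v} M.ringSheaf) (U : Opens M.pt) : AddCommGroup (ofSheafSec F U) :=
  inferInstanceAs (AddCommGroup (F.val.obj (op U)))

instance (F : SheafOfModules.{v} M.ringSheaf) (U : Opens M.pt) :
    Module (M.Fun U) (ofSheafSec F U) :=
  inferInstanceAs (Module (M.ringSheaf.obj.obj (op U)) (F.val.obj (op U)))

instance (F : SheafOfModules.{v} M.ringSheaf) (U : Opens M.pt) : Module ℂ (ofSheafSec F U) :=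
  Module.compHom _ (algebraMap ℂ (M.Fun U))

instance (F : SheafOfModules.{v} M.ringSheaf) (U : Opens M.pt) :
    IsScalarTower ℂ (M.Fun U) (ofSheafSec F U) :=
  ⟨fun z f s => by
    rw [Algebra.smul_def, mul_smul]; rfl⟩

/-- The restriction maps of a sheaf of `𝒪`-modules, as additive maps. -/
def ofSheafRes (F : SheafOfModules.{v} M.ringSheaf) {U V : Opens M.pt} (h : V ≤ U) :
    ofSheafSec F U →+ ofSheafSec F V :=
  (F.val.presheaf.map (homOfLE h).op).hom

lemma ofSheafRes_smul (F : SheafOfModules.{v} M.ringSheaf) {U V : Opens M.pt} (h : V ≤ U)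
    (f : M.Fun U) (s : ofSheafSec F U) :
    ofSheafRes F h (f • s) = M.res h f • ofSheafRes F h s :=
  F.val.map_smul (homOfLE h).op f s

/-- The sections and restriction maps of a sheaf of `𝒪`-modules. -/
def ofSheaf (F : SheafOfModules.{v} M.ringSheaf) : OMod.{u, v} M where
  sec := ofSheafSec F
  res {U V} h :=
    { toFun := ofSheafRes F h
      map_add' := map_add _
      map_smul' := fun z s => by
        refine (ofSheafRes_smul F h (algebraMap ℂ (M.Fun U) z) s).trans ?_
        rw [AlgHom.commutes]; rfl }
  res_smul h f s := ofSheafRes_smul F h f s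
  res_self {U} s := congrArg (fun g => g.hom s) (F.val.presheaf.map_id (op U))
  res_res h h' s :=
    (congrArg (fun g => g.hom s) (F.val.presheaf.map_comp (homOfLE h).op (homOfLE h').op)).symm

end OMod

namespace OMod

variable {M : ComplexLRS.{u}}

/-- The support of a section over `U`, as a subset of `M`. -/
def supp (P : OMod.{u, v} M) {U : Opens M.pt} (s : P.sec U) : Set M.pt :=
  {a | a ∈ U ∧ ∀ (V : Opens M.pt) (h : V ≤ U), a ∈ V → P.res h s ≠ 0}

/-- The sections over `U` supported in `K`. -/
def secSupp (P : OMod.{u, v} M) (U : Opens M.pt) (K : Set M.pt) : Submodule ℂ (P.sec U) where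
  carrier := {s | P.supp s ⊆ K}
  zero_mem' := fun a ha => (ha.2 U le_rfl ha.1 (map_zero _)).elim
  add_mem' {s t} hs ht := by
    intro a ha
    by_contra hK
    have hs' : a ∉ P.supp s := fun h => hK (hs h)
    have ht' : a ∉ P.supp t := fun h => hK (ht h)
    simp only [supp, Set.mem_ofPred_eq, not_and, not_forall, not_not] at hs' ht'
    obtain ⟨V, hV, haV, hsV⟩ := hs' ha.1
    obtain ⟨W, hW, haW, htW⟩ := ht' ha.1
    refine ha.2 (V ⊓ W) (inf_le_left.trans hV) ⟨haV, haW⟩ ?_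
    rw [map_add, ← P.res_res hV inf_le_left s, ← P.res_res hW inf_le_right t, hsV, htW]
    simp
  smul_mem' z s hs := by
    intro a ha
    refine hs ⟨ha.1, fun V hV haV h => ha.2 V hV haV ?_⟩
    rw [map_smul, h, smul_zero]

lemma secSupp_mono (P : OMod.{u, v} M) (U : Opens M.pt) {K L : Set M.pt} (h : K ⊆ L) :
    P.secSupp U K ≤ P.secSupp U L :=
  fun _ hs => subset_trans hs h

/-- The compact subsets of (the underlying set of) an open set `U`. -/
abbrev CompactIn (U : Opens M.pt) : Type u := {K : Set M.pt // IsCompact K ∧ K ⊆ U}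

/-- The compactly supported sections over `U`. -/
def secC (P : OMod.{u, v} M) (U : Opens M.pt) : Submodule ℂ (P.sec U) where
  carrier := {s | ∃ K : CompactIn U, s ∈ P.secSupp U K}
  zero_mem' := ⟨⟨∅, isCompact_empty, Set.empty_subset _⟩, Submodule.zero_mem _⟩
  add_mem' := by
    rintro s t ⟨K, hs⟩ ⟨L, ht⟩
    exact ⟨⟨K ∪ L, K.2.1.union L.2.1, Set.union_subset K.2.2 L.2.2⟩, Submodule.add_mem _
      (P.secSupp_mono U Set.subset_union_left hs) (P.secSupp_mono U Set.subset_union_right ht)⟩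
  smul_mem' := by
    rintro z s ⟨K, hs⟩
    exact ⟨K, Submodule.smul_mem _ z hs⟩

lemma secSupp_le_secC (P : OMod.{u, v} M) {U : Opens M.pt} (K : CompactIn U) :
    P.secSupp U K ≤ P.secC U :=
  fun _ hs => ⟨K, hs⟩

end OMod

/-- The commutator `D ↦ f ∘ D - D ∘ f` on the linear maps between two modules. -/
def commutatorMap {A : Type*} [CommRing A] [Algebra ℂ A] {P Q : Type*} [AddCommGroup P]
    [AddCommGroup Q] [Module ℂ P] [Module ℂ Q] [Module A P] [Module A Q] [IsScalarTower ℂ A P]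
    [IsScalarTower ℂ A Q] (f : A) : (P →ₗ[ℂ] Q) →ₗ[ℂ] (P →ₗ[ℂ] Q) :=
  LinearMap.llcomp ℂ P Q Q (Algebra.lsmul ℂ ℂ Q f) -
    LinearMap.lcomp ℂ Q (Algebra.lsmul ℂ ℂ P f)

@[simp]
lemma commutatorMap_apply {A : Type*} [CommRing A] [Algebra ℂ A] {P Q : Type*} [AddCommGroup P]
    [AddCommGroup Q] [Module ℂ P] [Module ℂ Q] [Module A P] [Module A Q] [IsScalarTower ℂ A P]
    [IsScalarTower ℂ A Q] (f : A) (D : P →ₗ[ℂ] Q) (s : P) :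
    commutatorMap f D s = f • D s - D (f • s) :=
  rfl

/-- The linear differential operators of order at most `r` between two `A`-modules. -/
def orderLE (A : Type*) [CommRing A] [Algebra ℂ A] (P Q : Type*) [AddCommGroup P]
    [AddCommGroup Q] [Module ℂ P] [Module ℂ Q] [Module A P] [Module A Q] [IsScalarTower ℂ A P]
    [IsScalarTower ℂ A Q] : ℕ → Submodule ℂ (P →ₗ[ℂ] Q)
  | 0 => ⨅ f : A, LinearMap.ker (commutatorMap f)
  | r + 1 => ⨅ f : A, (orderLE A P Q r).comap (commutatorMap f)

lemma orderLE_mono (A : Type*) [CommRing A] [Algebra ℂ A] (P Q : Type*) [AddCommGroup P]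
    [AddCommGroup Q] [Module ℂ P] [Module ℂ Q] [Module A P] [Module A Q] [IsScalarTower ℂ A P]
    [IsScalarTower ℂ A Q] : Monotone (orderLE A P Q) := by
  refine monotone_nat_of_le_succ fun r => ?_
  induction r with
  | zero =>
    refine le_iInf fun f => (iInf_le _ f).trans fun D hD => ?_
    rw [Submodule.mem_comap, LinearMap.mem_ker.1 hD]
    exact Submodule.zero_mem _
  | succ r ih => exact iInf_mono fun f => Submodule.comap_mono ih

namespace OMod

variable {M : ComplexLRS.{u}} (P : OMod.{u, v} M) (Q : OMod.{u, w} M) (U : Opens M.pt)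

/-- The homomorphisms `P|_U → Q|_U` of sheaves of complex vector spaces. -/
def sheafHom : Submodule ℂ (∀ V : {V : Opens M.pt // V ≤ U}, P.sec V →ₗ[ℂ] Q.sec V) where
  carrier := {D | ∀ (V W : {V : Opens M.pt // V ≤ U}) (h : W.1 ≤ V.1) (s : P.sec V),
    Q.res h (D V s) = D W (P.res h s)}
  zero_mem' V W h s := by simp
  add_mem' hD hE V W h s := by simp [hD V W h s, hE V W h s]
  smul_mem' z D hD V W h s := by simp [hD V W h s]

/-- The operators `P|_U → Q|_U` which have order at most `r` on an open subset `W` of `U`. -/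
def diffOn (W : Opens M.pt) (r : ℕ) : Submodule ℂ (P.sheafHom Q U) where
  carrier := {D | ∀ V : {V : Opens M.pt // V ≤ U}, V.1 ≤ W →
    D.1 V ∈ orderLE (M.Fun V) (P.sec V) (Q.sec V) r}
  zero_mem' _ _ := Submodule.zero_mem _
  add_mem' hD hE V hV := Submodule.add_mem _ (hD V hV) (hE V hV)
  smul_mem' z _ hD V hV := Submodule.smul_mem _ z (hD V hV)

/-- The differential operators `P|_U → Q|_U` of order at most `r`. -/
def diffLE (r : ℕ) : Submodule ℂ (P.sheafHom Q U) := P.diffOn Q U U r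

lemma diffOn_mono {W W' : Opens M.pt} (h : W' ≤ W) {r r' : ℕ} (hr : r ≤ r') :
    P.diffOn Q U W r ≤ P.diffOn Q U W' r' :=
  fun _ hD V hV => orderLE_mono _ _ _ hr (hD V (hV.trans h))

/-- The differential operators of finite order. -/
def diffFin : Submodule ℂ (P.sheafHom Q U) where
  carrier := {D | ∃ r, D ∈ P.diffLE Q U r}
  zero_mem' := ⟨0, Submodule.zero_mem _⟩
  add_mem' := by
    rintro D E ⟨r, hD⟩ ⟨r', hE⟩
    exact ⟨max r r', Submodule.add_mem _ (P.diffOn_mono Q U le_rfl (le_max_left _ _) hD)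
      (P.diffOn_mono Q U le_rfl (le_max_right _ _) hE)⟩
  smul_mem' := by
    rintro z D ⟨r, hD⟩
    exact ⟨r, Submodule.smul_mem _ z hD⟩

/-- The differential operators, i.e. the homomorphisms which are locally of finite order. -/
def diff : Submodule ℂ (P.sheafHom Q U) where
  carrier := {D | ∀ a ∈ U, ∃ (W : Opens M.pt) (r : ℕ), a ∈ W ∧ D ∈ P.diffOn Q U W r}
  zero_mem' _ ha := ⟨U, 0, ha, Submodule.zero_mem _⟩
  add_mem' hD hE a ha := by
    obtain ⟨W, r, haW, hD⟩ := hD a ha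
    obtain ⟨W', r', haW', hE⟩ := hE a ha
    exact ⟨W ⊓ W', max r r', ⟨haW, haW'⟩, Submodule.add_mem _
      (P.diffOn_mono Q U inf_le_left (le_max_left _ _) hD)
      (P.diffOn_mono Q U inf_le_right (le_max_right _ _) hE)⟩
  smul_mem' z _ hD a ha := by
    obtain ⟨W, r, haW, hD⟩ := hD a ha
    exact ⟨W, r, haW, Submodule.smul_mem _ z hD⟩

variable {P Q U} in
/-- The support of a homomorphism `P|_U → Q|_U`, as a subset of `M`. -/
def suppHom (D : P.sheafHom Q U) : Set M.pt :=
  {a | a ∈ U ∧ ∀ V : {V : Opens M.pt // V ≤ U}, a ∈ V.1 →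
    ∃ W : {V : Opens M.pt // V ≤ U}, W.1 ≤ V.1 ∧ D.1 W ≠ 0}

/-- The homomorphisms `P|_U → Q|_U` supported in `K`. -/
def homSupp (K : Set M.pt) : Submodule ℂ (P.sheafHom Q U) where
  carrier := {D | suppHom D ⊆ K}
  zero_mem' a ha := by
    obtain ⟨_, _, h⟩ := ha.2 ⟨U, le_rfl⟩ ha.1
    exact (h rfl).elim
  add_mem' {D E} hD hE := by
    intro a ha
    by_contra hK
    have hD' : a ∉ suppHom D := fun h => hK (hD h)
    have hE' : a ∉ suppHom E := fun h => hK (hE h)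
    simp only [suppHom, Set.mem_ofPred_eq, not_and, not_forall, not_exists, not_not] at hD' hE'
    obtain ⟨V, haV, hV⟩ := hD' ha.1
    obtain ⟨V', haV', hV'⟩ := hE' ha.1
    obtain ⟨W, hW, hne⟩ := ha.2 ⟨V.1 ⊓ V'.1, inf_le_left.trans V.2⟩ ⟨haV, haV'⟩
    refine hne ?_
    have h1 := hV W (hW.trans inf_le_left)
    have h2 := hV' W (hW.trans inf_le_right)
    change D.1 W + E.1 W = 0
    rw [h1, h2, add_zero]
  smul_mem' z D hD := by
    intro a ha
    refine hD ⟨ha.1, fun V haV => ?_⟩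
    obtain ⟨W, hW, hne⟩ := ha.2 V haV
    refine ⟨W, hW, fun h => hne ?_⟩
    change z • D.1 W = 0
    rw [h, smul_zero]

/-- The differential operators `P|_U → Q|_U` with compact support. -/
def diffC : Submodule ℂ (P.sheafHom Q U) where
  carrier := {D | D ∈ P.diff Q U ∧ ∃ K : CompactIn U, D ∈ P.homSupp Q U K}
  zero_mem' := ⟨Submodule.zero_mem _, ⟨∅, isCompact_empty, Set.empty_subset _⟩,
    Submodule.zero_mem _⟩
  add_mem' := by
    rintro D E ⟨hD, K, hK⟩ ⟨hE, L, hL⟩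
    exact ⟨Submodule.add_mem _ hD hE,
      ⟨K ∪ L, K.2.1.union L.2.1, Set.union_subset K.2.2 L.2.2⟩, Submodule.add_mem _
      (fun _ h => Set.mem_union_left _ (hK h)) (fun _ h => Set.mem_union_right _ (hL h))⟩
  smul_mem' := by
    rintro z D ⟨hD, K, hK⟩
    exact ⟨Submodule.smul_mem _ z hD, K, Submodule.smul_mem _ z hK⟩

/-- The differential operators `P|_U → Q|_U` of order at most `r` supported in `K`. -/
def diffKr (K : CompactIn U) (r : ℕ) : Submodule ℂ (P.sheafHom Q U) :=
  P.homSupp Q U K ⊓ P.diffLE Q U r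

lemma diffKr_le_diffFin (K : CompactIn U) (r : ℕ) : P.diffKr Q U K r ≤ P.diffFin Q U :=
  fun _ hD => ⟨r, hD.2⟩

lemma diffKr_le_diffC (K : CompactIn U) (r : ℕ) : P.diffKr Q U K r ≤ P.diffC Q U :=
  fun _ hD => ⟨fun _ ha => ⟨U, r, ha, hD.2⟩, K, hD.1⟩

variable {P Q U} in
/-- The action of a homomorphism `P|_U → Q|_U` on the sections over `U`. -/
def homTop : P.sheafHom Q U →ₗ[ℂ] (P.sec U →ₗ[ℂ] Q.sec U) :=
  (LinearMap.proj (⟨U, le_rfl⟩ : {V : Opens M.pt // V ≤ U})).comp (Submodule.subtype _)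

variable {P Q U} in
lemma supp_homTop (D : P.sheafHom Q U) (s : P.sec U) : Q.supp (homTop D s) ⊆ suppHom D := by
  intro a ha
  refine ⟨ha.1, fun V haV => ⟨V, le_rfl, fun h => ha.2 V.1 V.2 haV ?_⟩⟩
  have := D.2 ⟨U, le_rfl⟩ V V.2 s
  rw [h] at this
  exact this

end OMod

/-! ### The reduction, smooth densities and their integrals -/

namespace ComplexLRS

set_option linter.unusedSectionVars false

variable (M : ComplexLRS.{u}) [IsFormalManifold M]

/-- The sections over `U` of the structure sheaf `𝒪/𝔪` of the reduction of `M`: the complex valued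
functions on `U` which are locally given by the values of formal functions. They are extended by
zero outside `U`. -/
def redFun (U : Opens M.pt) : Submodule ℂ (M.pt → ℂ) where
  carrier := {h | (∀ a, a ∉ U → h a = 0) ∧ ∀ a ∈ U, ∃ (V : Opens M.pt) (f : M.Fun V), V ≤ U ∧
    a ∈ V ∧ ∀ b ∈ V, h b = M.value f b}
  zero_mem' := ⟨fun _ _ => rfl, fun a ha => ⟨U, 0, le_rfl, ha, fun b hb => by
    simpa using (value_const (M := M) (0 : ℂ) hb).symm⟩⟩
  add_mem' := by
    rintro h k ⟨hh, hh'⟩ ⟨hk, hk'⟩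
    refine ⟨fun a ha => by simp [hh a ha, hk a ha], fun a ha => ?_⟩
    obtain ⟨V, f, hV, haV, hf⟩ := hh' a ha
    obtain ⟨W, g, hW, haW, hg⟩ := hk' a ha
    refine ⟨V ⊓ W, M.res inf_le_left f + M.res inf_le_right g, inf_le_left.trans hV, ⟨haV, haW⟩,
      fun b hb => ?_⟩
    rw [value_add, value_res _ _ hb, value_res _ _ hb, Pi.add_apply, hf b hb.1, hg b hb.2]
  smul_mem' := by
    rintro z h ⟨hh, hh'⟩
    refine ⟨fun a ha => by simp [hh a ha], fun a ha => ?_⟩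
    obtain ⟨V, f, hV, haV, hf⟩ := hh' a ha
    refine ⟨V, algebraMap ℂ _ z * f, hV, haV, fun b hb => ?_⟩
    rw [value_mul, value_const z hb, Pi.smul_apply, hf b hb, smul_eq_mul]

/-- A smooth density on the open subset `U` of the reduction of `M`: for every chart `c`, of
dimension `n` say, a coefficient function `τ n c` on `U ∩ source c` (extended by zero), smooth in
the coordinates of `c`, such that `τ n c |dx| = τ n c' |dx'|` on overlaps, that is,
`τ n c = |det (∂x'/∂x)| τ n c'`. -/
def densFun (U : Opens M.pt) : Submodule ℂ (∀ n : ℕ, M.Chart n → M.pt → ℂ) where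
  carrier := {τ | (∀ n (c : M.Chart n) a, ¬ (a ∈ U ∧ a ∈ c.opens) → τ n c a = 0) ∧
    (∀ n (c : M.Chart n), ContDiffOn ℝ ∞ (fun x => τ n c (c.toHomeo.symm x))
      (c.toHomeo.symm ⁻¹' (U : Set M.pt))) ∧
    ∀ n (c c' : M.Chart n) a, a ∈ U → a ∈ c.opens → a ∈ c'.opens →
      τ n c a =
        (|(fderiv ℝ (c'.toHomeo ∘ c.toHomeo.symm) (c.toHomeo a)).det| : ℝ) * τ n c' a}
  zero_mem' := ⟨fun _ _ _ _ => rfl, fun _ _ => contDiffOn_const, fun _ _ _ _ _ _ _ => by simp⟩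
  add_mem' := by
    rintro τ η ⟨hτ, hτ', hτ''⟩ ⟨hη, hη', hη''⟩
    refine ⟨fun n c a h => by simp [hτ n c a h, hη n c a h], fun n c => (hτ' n c).add (hη' n c),
      fun n c c' a h1 h2 h3 => ?_⟩
    simp only [Pi.add_apply]
    rw [hτ'' n c c' a h1 h2 h3, hη'' n c c' a h1 h2 h3, mul_add]
  smul_mem' := by
    rintro z τ ⟨hτ, hτ', hτ''⟩
    refine ⟨fun n c a h => by simp [hτ n c a h], fun n c => (contDiffOn_const (c := z)).mul (hτ' n c),
      fun n c c' a h1 h2 h3 => ?_⟩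
    simp only [Pi.smul_apply, smul_eq_mul]
    rw [hτ'' n c c' a h1 h2 h3, mul_left_comm]

variable {M}

/-- The product of a formal function and a function on the reduction. -/
def redSmul {U : Opens M.pt} (f : M.Fun U) (h : M.redFun U) : M.redFun U :=
  ⟨fun a => M.value f a * h.1 a, fun a ha => by simp [h.2.1 a ha], fun a ha => by
    obtain ⟨V, g, hV, haV, hg⟩ := h.2.2 a ha
    refine ⟨V, M.res hV f * g, hV, haV, fun b hb => ?_⟩
    change M.value f b * h.1 b = _
    rw [value_mul, value_res _ _ hb, hg b hb]⟩

/-- The product of a formal function and a smooth density. -/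
def densSmul {U : Opens M.pt} (f : M.Fun U) (τ : M.densFun U) : M.densFun U :=
  ⟨fun n c a => M.value f a * τ.1 n c a, fun n c a ha => by simp [τ.2.1 n c a ha],
    fun n c => (contDiffOn_value f c).mul (τ.2.2.1 n c), fun n c c' a h1 h2 h3 => by
      change M.value f a * τ.1 n c a = _ * (M.value f a * τ.1 n c' a)
      rw [τ.2.2.2 n c c' a h1 h2 h3, mul_left_comm]⟩

lemma value_one {U : Opens M.pt} {a : M.pt} (ha : a ∈ U) : M.value (1 : M.Fun U) a = 1 := by
  simpa using value_const (M := M) (1 : ℂ) ha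

lemma value_zero {U : Opens M.pt} (a : M.pt) : M.value (0 : M.Fun U) a = 0 := by
  by_cases ha : a ∈ U
  · simpa using value_const (M := M) (0 : ℂ) ha
  · exact value_of_notMem _ ha

instance (U : Opens M.pt) : Module (M.Fun U) (M.redFun U) where
  smul := redSmul
  one_smul h := Subtype.ext (funext fun a => by
    change M.value 1 a * h.1 a = h.1 a
    by_cases ha : a ∈ U
    · rw [value_one ha, one_mul]
    · rw [h.2.1 a ha, mul_zero])
  mul_smul f g h := Subtype.ext (funext fun a => by
    change M.value (f * g) a * h.1 a = M.value f a * (M.value g a * h.1 a)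
    rw [value_mul, mul_assoc])
  smul_zero f := Subtype.ext (funext fun a => mul_zero _)
  smul_add f h k := Subtype.ext (funext fun a => mul_add _ _ _)
  add_smul f g h := Subtype.ext (funext fun a => by
    change M.value (f + g) a * h.1 a = M.value f a * h.1 a + M.value g a * h.1 a
    rw [value_add, add_mul])
  zero_smul h := Subtype.ext (funext fun a => by
    change M.value 0 a * h.1 a = 0
    rw [value_zero, zero_mul])

instance (U : Opens M.pt) : Module (M.Fun U) (M.densFun U) where
  smul := densSmul
  one_smul τ := Subtype.ext (funext fun n => funext fun c => funext fun a => by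
    change M.value 1 a * τ.1 n c a = τ.1 n c a
    by_cases ha : a ∈ U
    · rw [value_one ha, one_mul]
    · rw [τ.2.1 n c a (fun h => ha h.1), mul_zero])
  mul_smul f g τ := Subtype.ext (funext fun n => funext fun c => funext fun a => by
    change M.value (f * g) a * τ.1 n c a = M.value f a * (M.value g a * τ.1 n c a)
    rw [value_mul, mul_assoc])
  smul_zero f := Subtype.ext (funext fun n => funext fun c => funext fun a => mul_zero _)
  smul_add f τ η := Subtype.ext (funext fun n => funext fun c => funext fun a => mul_add _ _ _)
  add_smul f g τ := Subtype.ext (funext fun n => funext fun c => funext fun a => by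
    change M.value (f + g) a * τ.1 n c a = M.value f a * τ.1 n c a + M.value g a * τ.1 n c a
    rw [value_add, add_mul])
  zero_smul τ := Subtype.ext (funext fun n => funext fun c => funext fun a => by
    change M.value 0 a * τ.1 n c a = 0
    rw [value_zero, zero_mul])

lemma redFun_smul_apply {U : Opens M.pt} (f : M.Fun U) (h : M.redFun U) (a : M.pt) :
    (f • h).1 a = M.value f a * h.1 a := rfl

lemma densFun_smul_apply {U : Opens M.pt} (f : M.Fun U) (τ : M.densFun U) {n : ℕ}
    (c : M.Chart n) (a : M.pt) : (f • τ).1 n c a = M.value f a * τ.1 n c a := rfl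

lemma value_smul {U : Opens M.pt} (z : ℂ) (f : M.Fun U) (a : M.pt) :
    M.value (z • f) a = z * M.value f a := by
  by_cases ha : a ∈ U
  · rw [Algebra.smul_def, value_mul, value_const z ha]
  · simp [value_of_notMem _ ha]

instance (U : Opens M.pt) : IsScalarTower ℂ (M.Fun U) (M.redFun U) :=
  ⟨fun z f h => Subtype.ext (funext fun a => by
    change M.value (z • f) a * h.1 a = z * (M.value f a * h.1 a)
    rw [value_smul, mul_assoc])⟩

instance (U : Opens M.pt) : IsScalarTower ℂ (M.Fun U) (M.densFun U) :=
  ⟨fun z f τ => Subtype.ext (funext fun n => funext fun c => funext fun a => by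
    change M.value (z • f) a * τ.1 n c a = z * (M.value f a * τ.1 n c a)
    rw [value_smul, mul_assoc])⟩

open Classical in
/-- Restriction of functions on the reduction. -/
def redRes {U V : Opens M.pt} (h : V ≤ U) : M.redFun U →ₗ[ℂ] M.redFun V where
  toFun k := ⟨fun a => if a ∈ V then k.1 a else 0, fun a ha => if_neg ha, fun a ha => by
    obtain ⟨W, f, hW, haW, hf⟩ := k.2.2 a (h ha)
    refine ⟨W ⊓ V, M.res inf_le_left f, inf_le_right, ⟨haW, ha⟩, fun b hb => ?_⟩
    exact (if_pos hb.2).trans ((hf b hb.1).trans (value_res _ _ hb).symm)⟩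
  map_add' k l := Subtype.ext (funext fun a => by
    by_cases ha : a ∈ V <;> simp [ha])
  map_smul' z k := Subtype.ext (funext fun a => by
    by_cases ha : a ∈ V <;> simp [ha])

open Classical in
/-- Restriction of smooth densities. -/
def densRes {U V : Opens M.pt} (h : V ≤ U) : M.densFun U →ₗ[ℂ] M.densFun V where
  toFun τ := ⟨fun n c a => if a ∈ V then τ.1 n c a else 0,
    fun n c a ha => by
      by_cases haV : a ∈ V
      · exact (if_pos haV).trans (τ.2.1 n c a fun h' => ha ⟨haV, h'.2⟩)
      · exact if_neg haV,
    fun n c => ((τ.2.2.1 n c).mono (Set.preimage_mono h)).congr fun x hx => if_pos hx,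
    fun n c c' a h1 h2 h3 => by
      simp only [if_pos h1]
      exact τ.2.2.2 n c c' a (h h1) h2 h3⟩
  map_add' k l := Subtype.ext (funext fun n => funext fun c => funext fun a => by
    by_cases ha : a ∈ V <;> simp [ha])
  map_smul' z k := Subtype.ext (funext fun n => funext fun c => funext fun a => by
    by_cases ha : a ∈ V <;> simp [ha])

variable (M)

/-- The structure sheaf of the reduction of `M`, as a sheaf of `𝒪`-modules. -/
def redMod : OMod.{u, u} M where
  sec U := M.redFun U
  res h := redRes h
  res_smul {U V} h f k := Subtype.ext (funext fun a => by
    rw [redFun_smul_apply]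
    by_cases ha : a ∈ V
    · simp [redRes, ha, redFun_smul_apply, value_res h f ha]
    · simp [redRes, ha])
  res_self {U} k := Subtype.ext (funext fun a => by
    by_cases ha : a ∈ U
    · simp [redRes, ha]
    · simp [redRes, ha, k.2.1 a ha])
  res_res {U V W} h h' k := Subtype.ext (funext fun a => by
    by_cases ha : a ∈ W
    · simp [redRes, ha, h' ha]
    · simp [redRes, ha])

/-- The sheaf of smooth densities on the reduction of `M`, as a sheaf of `𝒪`-modules. -/
def densMod : OMod.{u, u} M where
  sec U := M.densFun U
  res h := densRes h
  res_smul {U V} h f τ := Subtype.ext (funext fun n => funext fun c => funext fun a => by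
    rw [densFun_smul_apply]
    by_cases ha : a ∈ V
    · simp [densRes, ha, densFun_smul_apply, value_res h f ha]
    · simp [densRes, ha])
  res_self {U} τ := Subtype.ext (funext fun n => funext fun c => funext fun a => by
    by_cases ha : a ∈ U
    · simp [densRes, ha]
    · simp [densRes, ha, τ.2.1 n c a fun h => ha h.1])
  res_res {U V W} h h' τ := Subtype.ext (funext fun n => funext fun c => funext fun a => by
    by_cases ha : a ∈ W
    · simp [densRes, ha, h' ha]
    · simp [densRes, ha])

/-- A chosen chart around each point. -/
def chartDim (a : M.pt) : ℕ := (IsFormalManifold.exists_chart a).choose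

/-- A chosen chart around each point. -/
def chartAt (a : M.pt) : M.Chart (M.chartDim a) :=
  (IsFormalManifold.exists_chart a).choose_spec.choose

lemma mem_chartAt (a : M.pt) : a ∈ (M.chartAt a).toHomeo.source :=
  (IsFormalManifold.exists_chart a).choose_spec.choose_spec

lemma exists_partition : ∃ p : PartitionOfUnity M.pt M.pt Set.univ,
    p.IsSubordinate fun a => (M.chartAt a).toHomeo.source :=
  PartitionOfUnity.exists_isSubordinate isClosed_univ _ (fun a => (M.chartAt a).toHomeo.open_source)
    fun a _ => Set.mem_iUnion.2 ⟨a, M.mem_chartAt a⟩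

/-- A chosen continuous partition of unity subordinate to the domains of the chosen charts. -/
def partition : PartitionOfUnity M.pt M.pt Set.univ := M.exists_partition.choose

lemma partition_subordinate :
    M.partition.IsSubordinate fun a => (M.chartAt a).toHomeo.source :=
  M.exists_partition.choose_spec

variable {M}

/-- The coefficient functions of a smooth density. -/
def coeff {U : Opens M.pt} : M.densMod.sec U →ₗ[ℂ] (∀ n : ℕ, M.Chart n → M.pt → ℂ) :=
  (M.densFun U).subtype

/-- The function on `M` given by a section of the structure sheaf of the reduction (extended by
zero). -/
def redVal {U : Opens M.pt} : M.redMod.sec U →ₗ[ℂ] (M.pt → ℂ) :=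
  (M.redFun U).subtype

/-- The part of a smooth density belonging to the `a`-th member of the partition of unity, in
coordinates. -/
def densLocal {U : Opens M.pt} (τ : M.densMod.sec U) (a : M.pt)
    (x : EuclideanSpace ℝ (Fin (M.chartDim a))) : ℂ :=
  (M.partition a ((M.chartAt a).toHomeo.symm x) : ℂ) *
    coeff τ _ (M.chartAt a) ((M.chartAt a).toHomeo.symm x)

lemma coeff_eq_zero {U : Opens M.pt} {τ : M.densMod.sec U} {K : Set M.pt}
    (hτ : τ ∈ M.densMod.secSupp U K) {a : M.pt} (ha : a ∉ K) {n : ℕ} (c : M.Chart n) :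
    coeff τ n c a = 0 := by
  by_cases haU : a ∈ U
  · have h : a ∉ M.densMod.supp τ := fun h => ha (hτ h)
    simp only [OMod.supp, Set.mem_ofPred_eq, not_and, not_forall, not_not] at h
    obtain ⟨V, hV, haV, h⟩ := h haU
    have h' : coeff (M.densMod.res hV τ) n c a = 0 := by rw [h]; rfl
    exact (if_pos haV).symm.trans h'
  · exact τ.2.1 n c a fun h => haU h.1

lemma redVal_eq_zero {U : Opens M.pt} {k : M.redMod.sec U} {K : Set M.pt}
    (hk : k ∈ M.redMod.secSupp U K) {a : M.pt} (ha : a ∉ K) : redVal k a = 0 := by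
  by_cases haU : a ∈ U
  · have h : a ∉ M.redMod.supp k := fun h => ha (hk h)
    simp only [OMod.supp, Set.mem_ofPred_eq, not_and, not_forall, not_not] at h
    obtain ⟨V, hV, haV, h⟩ := h haU
    have h' : redVal (M.redMod.res hV k) a = 0 := by rw [h]; rfl
    exact (if_pos haV).symm.trans h'
  · exact k.2.1 a haU

lemma integrable_densLocal {U : Opens M.pt} {τ : M.densMod.sec U} (hτ : τ ∈ M.densMod.secC U)
    (a : M.pt) : Integrable (densLocal τ a) := by
  obtain ⟨K, hK⟩ := hτ
  have hKc : IsClosed K.1 := K.2.1.isClosed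
  have hcont : Continuous fun x => coeff τ _ (M.chartAt a) ((M.chartAt a).toHomeo.symm x) := by
    rw [continuous_iff_continuousAt]
    intro x
    by_cases hx : (M.chartAt a).toHomeo.symm x ∈ U
    · exact (τ.2.2.1 _ (M.chartAt a)).continuousOn.continuousAt
        ((U.2.preimage (M.chartAt a).continuous_symm).mem_nhds hx)
    · have : (M.chartAt a).toHomeo.symm ⁻¹' K.1ᶜ ∈ 𝓝 x :=
        (hKc.isOpen_compl.preimage (M.chartAt a).continuous_symm).mem_nhds
          (fun h => hx (K.2.2 h))
      refine (continuousAt_const (y := (0 : ℂ))).congr ?_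
      filter_upwards [this] with y hy
      exact (coeff_eq_zero hK hy _).symm
  refine Continuous.integrable_of_hasCompactSupport ?_ ?_
  · exact (Complex.continuous_ofReal.comp ((M.partition a).continuous.comp
      (M.chartAt a).continuous_symm)).mul hcont
  · refine HasCompactSupport.intro (K := (M.chartAt a).toHomeo '' (tsupport (M.partition a) ∩ K.1))
      ?_ ?_
    · refine (K.2.1.inter_left (isClosed_tsupport _)).image_of_continuousOn
        ((M.chartAt a).toHomeo.continuousOn.mono ?_)
      exact fun y hy => M.partition_subordinate a hy.1
    · intro x hx
      by_cases h1 : (M.chartAt a).toHomeo.symm x ∈ K.1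
      · have h2 : (M.chartAt a).toHomeo.symm x ∉ tsupport (M.partition a) := fun h2 =>
          hx ⟨_, ⟨h2, h1⟩, (M.chartAt a).apply_symm x⟩
        simp [densLocal, image_eq_zero_of_notMem_tsupport h2]
      · simp [densLocal, coeff_eq_zero hK h1]

lemma finite_support_densLocal {U : Opens M.pt} {τ : M.densMod.sec U}
    (hτ : τ ∈ M.densMod.secC U) :
    (Function.support fun a => ∫ x, densLocal τ a x).Finite := by
  obtain ⟨K, hK⟩ := hτ
  refine (M.partition.locallyFinite.finite_nonempty_inter_compact K.2.1).subset fun a ha => ?_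
  by_contra hne
  refine ha (integral_eq_zero_of_ae (Filter.Eventually.of_forall fun x => ?_))
  by_cases h1 : (M.chartAt a).toHomeo.symm x ∈ K.1
  · have h2 : M.partition a ((M.chartAt a).toHomeo.symm x) = 0 := by
      by_contra h2
      exact hne ⟨_, h2, h1⟩
    simp [densLocal, h2]
  · simp [densLocal, coeff_eq_zero hK h1]

/-- The integral over `U` of compactly supported smooth densities, by means of a partition of
unity (the result does not depend on the chosen one). -/
def integral (U : Opens M.pt) : M.densMod.secC U →ₗ[ℂ] ℂ where
  toFun τ := ∑ᶠ a, ∫ x, densLocal τ.1 a x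
  map_add' τ η := by
    rw [← finsum_add_distrib (finite_support_densLocal τ.2) (finite_support_densLocal η.2)]
    refine finsum_congr fun a => ?_
    rw [← integral_add (integrable_densLocal τ.2 a) (integrable_densLocal η.2 a)]
    refine integral_congr_ae (Filter.Eventually.of_forall fun x => ?_)
    exact mul_add _ _ _
  map_smul' z τ := by
    rw [RingHom.id_apply, smul_eq_mul, mul_finsum]
    refine finsum_congr fun a => ?_
    rw [← integral_const_mul]
    refine integral_congr_ae (Filter.Eventually.of_forall fun x => ?_)
    exact mul_left_comm _ _ _

lemma continuousOn_redVal {U : Opens M.pt} (k : M.redMod.sec U) :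
    ContinuousOn (redVal k) U := by
  intro a ha
  obtain ⟨V, f, hV, haV, hf⟩ := k.2.2 a ha
  obtain ⟨n, c, hc⟩ := IsFormalManifold.exists_chart a
  have h : ContinuousAt (fun b => M.value f (c.toHomeo.symm (c.toHomeo b))) a := by
    refine ContinuousAt.comp (f := c.toHomeo) (g := fun x => M.value f (c.toHomeo.symm x)) ?_
      (c.toHomeo.continuousAt hc)
    refine (contDiffOn_value f c).continuousOn.continuousAt
      ((V.2.preimage c.continuous_symm).mem_nhds ?_)
    rwa [Set.mem_preimage, c.toHomeo.left_inv hc]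
  refine (h.congr ?_).continuousWithinAt
  filter_upwards [V.2.mem_nhds haV, c.toHomeo.open_source.mem_nhds hc] with b hb hb'
  rw [c.toHomeo.left_inv hb']
  exact (hf b hb).symm

lemma bddAbove_redVal {U : Opens M.pt} {k : M.redMod.sec U} (hk : k ∈ M.redMod.secC U) :
    BddAbove (Set.range fun a => ‖redVal k a‖) := by
  obtain ⟨K, hK⟩ := hk
  obtain ⟨C, hC⟩ := K.2.1.exists_bound_of_continuousOn
    ((continuousOn_redVal k).mono K.2.2)
  refine ⟨max C 0, ?_⟩
  rintro _ ⟨a, rfl⟩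
  by_cases ha : a ∈ K.1
  · exact (hC a ha).trans (le_max_left _ _)
  · simp [redVal_eq_zero hK ha]

variable (M) in
/-- The supremum norm of the compactly supported sections over `U` of the structure sheaf of the
reduction. -/
def supNorm (U : Opens M.pt) : Seminorm ℂ (M.redMod.secC U) where
  toFun k := ⨆ a, ‖redVal k.1 a‖
  map_zero' := by simp
  add_le' k l := by
    refine Real.iSup_le (fun a => ?_)
      (add_nonneg (Real.iSup_nonneg fun _ => norm_nonneg _) (Real.iSup_nonneg fun _ => norm_nonneg _))
    rw [Submodule.coe_add, map_add]
    exact (norm_add_le _ _).trans (add_le_add (le_ciSup (bddAbove_redVal k.2) a)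
      (le_ciSup (bddAbove_redVal l.2) a))
  neg' k := by simp
  smul' z k := by
    rw [Real.mul_iSup_of_nonneg (norm_nonneg z)]
    simp

end ComplexLRS

/-! ### Locally convex inductive limits and direct sums -/

/-- The final locally convex topology on `V` with respect to linear maps `f i : E i → V`, i.e. the
finest locally convex vector space topology on `V` for which all `f i` are continuous. If `V` is
the algebraic inductive limit of the `E i`, this is the inductive limit topology in the category of
locally convex spaces. -/
@[reducible]
def lcFinal {ι : Type*} {V : Type*} [AddCommGroup V] [Module ℂ V] {E : ι → Type*}
    [∀ i, AddCommGroup (E i)] [∀ i, Module ℂ (E i)] (t : ∀ i, TopologicalSpace (E i))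
    (f : ∀ i, E i →ₗ[ℂ] V) : TopologicalSpace V :=
  sInf {T : TopologicalSpace V | IsTopologicalAddGroup V ∧ ContinuousSMul ℂ V ∧
    LocallyConvexSpace ℝ V ∧ ∀ i, @Continuous _ _ (t i) T (f i)}

open Classical in
/-- The topology of the direct sum in the category of locally convex spaces. -/
instance {ι : Type*} {E : ι → Type*} [∀ i, AddCommGroup (E i)] [∀ i, Module ℂ (E i)]
    [∀ i, TopologicalSpace (E i)] : TopologicalSpace (⨁ i, E i) :=
  lcFinal (fun _ => inferInstance) (fun i => DirectSum.lof ℂ ι E i)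

/-! ### The three cosheaves -/

namespace OMod

variable {M : ComplexLRS.{u}} [IsFormalManifold M]

/-- The action of compactly supported differential operators on the sections over `U`. -/
def applyC (P : OMod.{u, v} M) (Q : OMod.{u, w} M) (U : Opens M.pt) :
    P.diffC Q U →ₗ[ℂ] P.sec U →ₗ[ℂ] Q.secC U where
  toFun D := (homTop D.1).codRestrict _ fun s => by
    obtain ⟨K, hK⟩ := D.2.2
    exact ⟨K, subset_trans (supp_homTop D.1 s) hK⟩
  map_add' D E := by ext s; rfl
  map_smul' z D := by ext s; rfl

variable (P : OMod.{u, v} M) (U : Opens M.pt)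

/-- The seminorm `u ↦ sup_a |(D u)(a)|` on the sections over `U`, for a compactly supported
differential operator `D` from `P|_U` to the structure sheaf of the reduction. -/
def smoothSeminorm : SeminormFamily ℂ (P.sec U) (P.diffC M.redMod U) :=
  fun D => (M.supNorm U).comp (P.applyC M.redMod U D)

/-- The smooth topology on the sections over `U`. -/
@[reducible]
def smoothTopology : TopologicalSpace (P.sec U) :=
  (P.smoothSeminorm U).moduleFilterBasis.topology

/-- The seminorm `D ↦ sup_a |(X (D u))(a)|` on the differential operators of finite order from
`P|_U` to the sheaf of smooth densities. -/
def diffSeminorm : SeminormFamily ℂ (P.diffFin M.densMod U)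
    (M.densMod.diffC M.redMod U × P.sec U) :=
  fun Xu => (M.densMod.smoothSeminorm U Xu.1).comp
    ((homTop.flip Xu.2).comp (P.diffFin M.densMod U).subtype)

/-- The topology on the differential operators of finite order from `P|_U` to the sheaf of smooth
densities. -/
@[reducible]
def diffFinTopology : TopologicalSpace (P.diffFin M.densMod U) :=
  (P.diffSeminorm U).moduleFilterBasis.topology

/-- The map `ρ_U`, sending a compactly supported differential operator `D` from `P|_U` to the sheaf
of smooth densities to the linear functional `u ↦ ∫_U D u`. -/
def rho : P.diffC M.densMod U →ₗ[ℂ] P.sec U →ₗ[ℂ] ℂ :=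
  (LinearMap.llcomp ℂ (P.sec U) (M.densMod.secC U) ℂ (ComplexLRS.integral U)).comp
    (P.applyC M.densMod U)

/-- The restriction of `ρ_U` to the operators of order at most `r` supported in `K`. -/
def rhoKr (K : CompactIn U) (r : ℕ) : P.diffKr M.densMod U K r →ₗ[ℂ] P.sec U →ₗ[ℂ] ℂ :=
  (P.rho U).comp (Submodule.inclusion (P.diffKr_le_diffC M.densMod U K r))

/-- The quotient topology on the image of the differential operators of order at most `r`
supported in `K` under `ρ_U`. -/
@[reducible]
def densKrTopology (K : CompactIn U) (r : ℕ) : TopologicalSpace (LinearMap.range (P.rhoKr U K r)) :=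
  TopologicalSpace.coinduced (P.rhoKr U K r).rangeRestrict
    (TopologicalSpace.induced (Submodule.inclusion (P.diffKr_le_diffFin M.densMod U K r))
      (P.diffFinTopology U))

/-- The space `D_c^∞(U; P)`: the image of `ρ_U`, a space of linear functionals on the sections
over `U`. -/
def FormalDensity : Type v := LinearMap.range (P.rho U)

instance : AddCommGroup (P.FormalDensity U) :=
  inferInstanceAs (AddCommGroup (LinearMap.range (P.rho U)))

instance : Module ℂ (P.FormalDensity U) :=
  inferInstanceAs (Module ℂ (LinearMap.range (P.rho U)))

/-- The inclusion of the image of the differential operators of order at most `r` supported in `K`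
into `D_c^∞(U; P)`. -/
def densKrIncl (K : CompactIn U) (r : ℕ) :
    LinearMap.range (P.rhoKr U K r) →ₗ[ℂ] P.FormalDensity U :=
  Submodule.inclusion (LinearMap.range_comp_le_range _ (P.rho U))

/-- The inductive limit topology on `D_c^∞(U; P)`. -/
instance : TopologicalSpace (P.FormalDensity U) :=
  lcFinal (ι := CompactIn U × ℕ) (fun i => P.densKrTopology U i.1 i.2)
    (fun i => P.densKrIncl U i.1 i.2)

/-- The space `P_c(U)` of compactly supported sections over `U`. -/
def CSec : Type v := P.secC U

instance : AddCommGroup (P.CSec U) := inferInstanceAs (AddCommGroup (P.secC U))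

instance : Module ℂ (P.CSec U) := inferInstanceAs (Module ℂ (P.secC U))

/-- The inclusion of the sections over `U` supported in `K` into the compactly supported ones. -/
def secSuppIncl (K : CompactIn U) : P.secSupp U K →ₗ[ℂ] P.CSec U :=
  Submodule.inclusion (P.secSupp_le_secC K)

/-- The inductive limit topology on `P_c(U)`, where the space of sections supported in `K` carries
the subspace topology of the smooth topology. -/
instance : TopologicalSpace (P.CSec U) :=
  lcFinal (fun K : CompactIn U => TopologicalSpace.induced (P.secSupp U K).subtype
    (P.smoothTopology U)) (fun K => P.secSuppIncl U K)

variable (E : Type x) [AddCommGroup E] [Module ℂ E] [TopologicalSpace E] [IsTopologicalAddGroup E]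
  [ContinuousSMul ℂ E]

/-- The space `D^{-∞}(U; P; E)` of continuous linear maps `P_c(U) → E`, with the strong topology
(uniform convergence on bounded sets). -/
abbrev Dist : Type (max v x) := P.CSec U →L[ℂ] E

variable {P U E} in
/-- `η` vanishes on `V`, i.e. its composition with the extension map `P_c(V) → P_c(U)` is zero;
the image of the extension map consists of the sections supported in `V`. -/
def Dist.VanishesOn (η : P.Dist U E) (V : Opens M.pt) : Prop :=
  ∀ s : P.CSec U, P.supp s.1 ⊆ V → η s = 0

variable {P U E} in
/-- The support of `η`, as a subset of `M`. -/
def Dist.supp (η : P.Dist U E) : Set M.pt :=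
  {a | a ∈ U ∧ ∀ V : Opens M.pt, V ≤ U → a ∈ V → ¬ η.VanishesOn V}

/-- The space `D^{-∞}_K(U; P; E)` of those `η` which are supported in `K`. -/
def distSupp (K : Set M.pt) : Submodule ℂ (P.Dist U E) where
  carrier := {η | η.supp ⊆ K}
  zero_mem' a ha := (ha.2 U le_rfl ha.1 fun _ _ => rfl).elim
  add_mem' {η θ} hη hθ := by
    intro a ha
    by_contra hK
    have hη' : a ∉ η.supp := fun h => hK (hη h)
    have hθ' : a ∉ θ.supp := fun h => hK (hθ h)
    simp only [Dist.supp, Set.mem_ofPred_eq, not_and, not_forall, not_not] at hη' hθ'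
    obtain ⟨V, hV, haV, hηV⟩ := hη' ha.1
    obtain ⟨W, hW, haW, hθW⟩ := hθ' ha.1
    refine ha.2 (V ⊓ W) (inf_le_left.trans hV) ⟨haV, haW⟩ fun s hs => ?_
    rw [add_apply, hηV s fun b hb => (hs hb).1, hθW s fun b hb => (hs hb).2,
      add_zero]
  smul_mem' z η hη := by
    intro a ha
    refine hη ⟨ha.1, fun V hV haV h => ha.2 V hV haV fun s hs => ?_⟩
    rw [smul_apply, h s hs, smul_zero]

/-- The elements of `D^{-∞}(U; P; E)` with compact support. -/
def distC : Submodule ℂ (P.Dist U E) where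
  carrier := {η | ∃ K : CompactIn U, η ∈ P.distSupp U E K}
  zero_mem' := ⟨⟨∅, isCompact_empty, Set.empty_subset _⟩, Submodule.zero_mem _⟩
  add_mem' := by
    rintro η θ ⟨K, hη⟩ ⟨L, hθ⟩
    exact ⟨⟨K ∪ L, K.2.1.union L.2.1, Set.union_subset K.2.2 L.2.2⟩, Submodule.add_mem _
      (fun _ h => Set.mem_union_left _ (hη h)) (fun _ h => Set.mem_union_right _ (hθ h))⟩
  smul_mem' := by
    rintro z η ⟨K, hη⟩
    exact ⟨K, Submodule.smul_mem _ z hη⟩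

/-- The space `D_c^{-∞}(U; P; E)`. -/
def CDist : Type (max v x) := P.distC U E

instance : AddCommGroup (P.CDist U E) := inferInstanceAs (AddCommGroup (P.distC U E))

instance : Module ℂ (P.CDist U E) := inferInstanceAs (Module ℂ (P.distC U E))

/-- The inclusion of `D^{-∞}_K(U; P; E)` into `D_c^{-∞}(U; P; E)`. -/
def distSuppIncl (K : CompactIn U) : P.distSupp U E K →ₗ[ℂ] P.CDist U E :=
  Submodule.inclusion fun _ h => ⟨K, h⟩

/-- The inductive limit topology on `D_c^{-∞}(U; P; E)`, where `D^{-∞}_K(U; P; E)` carries the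
subspace topology of the strong topology. -/
instance : TopologicalSpace (P.CDist U E) :=
  lcFinal (fun K : CompactIn U => (instTopologicalSpaceSubtype : TopologicalSpace
    (P.distSupp U E K))) (fun K => P.distSuppIncl U E K)

/-! ### Extension maps and multiplication by formal functions -/

variable {P U E}

/-- The extension map of the cosheaf `D_c^∞(P)`, as a relation: `η'` is the image of `η` under
the transpose of the restriction map from `M` to `U`. -/
def IsExtDensity (η : P.FormalDensity U) (η' : P.FormalDensity ⊤) : Prop :=
  ∀ s : P.sec ⊤, η'.1 s = η.1 (P.res le_top s)

/-- The extension map of the cosheaf `P_c`, as a relation: `s'` is the extension of `s` by zero,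
i.e. `s'|_U = s` and `s'` vanishes outside the support of `s`. -/
def IsExtSec (s : P.CSec U) (s' : P.CSec ⊤) : Prop :=
  P.res le_top s'.1 = s.1 ∧ P.supp s'.1 ⊆ P.supp s.1

/-- The extension map of the cosheaf `D_c^{-∞}(P; E)`, as a relation: `η'` is the extension of `η`
by zero, i.e. `η'|_U = η` (the restriction being the transpose of the extension map of `P_c`) and
`η'` vanishes outside the support of `η`. -/
def IsExtDist (η : P.CDist U E) (η' : P.CDist ⊤ E) : Prop :=
  (∀ (s : P.CSec U) (s' : P.CSec ⊤), IsExtSec s s' → η'.1 s' = η.1 s) ∧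
    Dist.supp η'.1 ⊆ Dist.supp η.1

/-- For a formal function `f` on `M` supported in `U` and a section `s` over `U`, the section `t`
over `M` is the product `f s`: `t|_U = f|_U s` and `t` vanishes outside the support of `f`. -/
def IsProduct (f : M.Fun ⊤) (s : P.sec U) (t : P.sec ⊤) : Prop :=
  P.res le_top t = (M.res le_top f : M.Fun U) • s ∧ P.supp t ⊆ M.supp f

variable (P) in
/-- Multiplication of a compactly supported section over `M` by a formal function. -/
def fmul (f : M.Fun ⊤) (s : P.CSec ⊤) : P.CSec ⊤ :=
  ⟨f • s.1, by
    obtain ⟨K, hK⟩ := s.2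
    refine ⟨K, fun a ha => hK ⟨ha.1, fun V hV haV h => ha.2 V hV haV ?_⟩⟩
    rw [P.res_smul, h, smul_zero]⟩

end OMod

/-- A partition of unity on `M`, by formal functions, subordinate to the family `U`. -/
structure IsFormalPartition {M : ComplexLRS.{u}} {Γ : Type w} (U : Γ → Opens M.pt)
    (f : Γ → M.Fun ⊤) : Prop where
  supp_subset : ∀ α, M.supp (f α) ⊆ U α
  locallyFinite : LocallyFinite fun α => M.supp (f α)
  sum_eq_one : ∀ (V : Opens M.pt) (A : Finset Γ), (∀ α ∉ A, M.res le_top (f α) = (0 : M.Fun V)) →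
    ∑ α ∈ A, M.res le_top (f α) = (1 : M.Fun V)
  value_mem : ∀ (α : Γ) (a : M.pt), ∃ t ∈ Set.Icc (0 : ℝ) 1, M.value (f α) a = (t : ℂ)

/-! ### Separation and extension by zero -/

/-! A map with a continuous linear right inverse is surjective, and it is open because a continuous
affine section passes through every point of its source (`isOpenMap_of_rightInverse`). So the
theorem reduces to two points: formal partitions of unity exist, and multiplication by their
members, followed by restriction, gives a continuous right inverse in each of the three cases.

Partitions of unity (`exists_isFormalPartition`) are made from smooth bumps in charts, read as
constant power series and extended by zero. A locally finite sum of such bumps with positive values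
is invertible, since a germ with nonzero value lies outside the maximal ideal of a local ring.
Dividing by the sum normalises the family. Cutoff functions (`exists_cutoff`) are a special case.

For the right inverse, continuity out of an inductive limit is tested on each step. A step is
attached to a compact set `K`, which meets only finitely many of the supports, so on that step the
map is a finite sum of coordinate maps (`exists_directSumDesc_rightInverse`). It is a right inverse
because the corresponding finite sum of the `f α` equals one on a neighbourhood of `K`
(`exists_opens_sum_eq_one`). A neighbourhood is needed since a formal function is not determined by
its values on `K`.

It remains to see that extension by zero and multiplication by `f` are well defined and continuous.
For sections this is a comparison of seminorms: a compactly supported operator stays one after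
composition with a multiplication, after extension by zero, or after being cut off to `U`
(`exists_smoothSeminorm_smul`, `exists_smoothSeminorm_res`, `exists_smoothSeminorm_of_supp`). For
formal densities the maps are lifted from functionals to operators (`extDiffKr`, `mulDiffKr`), where
the same comparison applies. For distributions supported in a fixed `K`, a single cutoff turns
extension by zero into the transpose of a continuous map of sections, and such transposes are
continuous for the strong topology.

All gluing goes through `IsLocal`, which holds for the given sheaf, for the structure sheaf, for the
reduction and for the densities. -/

lemma exists_unique_amalgamation {X : TopCat.{u}} {P : (Opens X)ᵒᵖ ⥤ AddCommGrpCat.{v}}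
    (hP : Presheaf.IsSheaf (Opens.grothendieckTopology X) P) {U : Opens X} (S : Sieve U)
    (hS : S ∈ Opens.grothendieckTopology X U)
    (s : ∀ ⦃V : Opens X⦄ (h : V ⟶ U), S h → P.obj (op V))
    (hs : ∀ ⦃V W : Opens X⦄ (h : V ⟶ U) (hV : S h) (i : W ⟶ V) (hW : S (i ≫ h)),
      (P.map i.op).hom (s h hV) = s (i ≫ h) hW) :
    ∃! t : P.obj (op U), ∀ ⦃V : Opens X⦄ (h : V ⟶ U) (hV : S h), (P.map h.op).hom t = s h hV := by
  -- A homomorphism from `ℤ` is the same as an element, so the sheaf condition tested against this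
  -- object is gluing of elements.
  let Z : AddCommGrpCat.{v} := AddCommGrpCat.of (ULift.{v} ℤ)
  let hom {A : AddCommGrpCat.{v}} (a : A) : Z ⟶ A :=
    AddCommGrpCat.ofHom ((zmultiplesHom A a).comp AddEquiv.ulift.toAddMonoidHom)
  have hom_one {A : AddCommGrpCat.{v}} (a : A) : (hom a).hom ⟨1⟩ = a :=
    one_zsmul a
  have ext {A : AddCommGrpCat.{v}} {f g : Z ⟶ A} (h : f.hom ⟨1⟩ = g.hom ⟨1⟩) : f = g := by
    refine AddCommGrpCat.hom_ext (AddMonoidHom.ext fun n => ?_)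
    let e : ℤ →+ ULift.{v} ℤ := AddEquiv.ulift.symm.toAddMonoidHom
    exact DFunLike.congr_fun (AddMonoidHom.ext_int (f := f.hom.comp e) (g := g.hom.comp e) h) n.down
  let y : Presieve.FamilyOfElements (P ⋙ coyoneda.obj (op Z)) (S : Presieve U) :=
    fun V h hV => hom (s h hV)
  have hy : y.Compatible := by
    rw [Presieve.compatible_iff_sieveCompatible]
    intro V W h i hV
    refine ext ?_
    change (hom _).hom ⟨1⟩ = (P.map i.op).hom ((hom _).hom ⟨1⟩)
    rw [hom_one, hom_one, hs h hV i]
  obtain ⟨t, ht, ht'⟩ := hP Z S hS y hy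
  refine ⟨t.hom ⟨1⟩, fun V h hV => ?_, fun t' h' => ?_⟩
  · have := congrArg (fun f : Z ⟶ P.obj (op V) => f.hom ⟨1⟩) (ht h hV)
    exact this.trans (hom_one _)
  · rw [← ht' (hom t') fun V h hV => ext ?_, hom_one]
    change (P.map h.op).hom ((hom t').hom ⟨1⟩) = (hom _).hom ⟨1⟩
    rw [hom_one, hom_one, h']

namespace OMod

variable {M : ComplexLRS.{u}}

/-- A presheaf of modules in which sections are determined locally, and in which a section
which vanishes near the complement of `V` extends by zero. -/
structure IsLocal (P : OMod.{u, v} M) : Prop where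
  ext : ∀ {U : Opens M.pt} {s t : P.sec U},
    (∀ a ∈ U, ∃ (V : Opens M.pt) (h : V ≤ U), a ∈ V ∧ P.res h s = P.res h t) → s = t
  extend : ∀ {U V W : Opens M.pt} (hV : V ≤ U) (hW : W ≤ U), U ≤ V ⊔ W → ∀ s : P.sec V,
    P.res (inf_le_left : V ⊓ W ≤ V) s = 0 → ∃ t : P.sec U, P.res hV t = s ∧ P.res hW t = 0

/-- This is the compatible family to be glued when extending by zero. The default value zero is the
correct one on subsets of `W`, and the hypothesis on `V ⊓ W` makes the two prescriptions agree.
Outside subsets of `V` or of `W` the value is junk, excluded by the disjunction in the last clause.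
-/
lemma exists_extension_family (P : OMod.{u, v} M) {V W : Opens M.pt} (s : P.sec V)
    (hs : P.res (inf_le_left : V ⊓ W ≤ V) s = 0) :
    ∃ x : ∀ Y, P.sec Y, (∀ Y (h : Y ≤ V), x Y = P.res h s) ∧ (∀ Y ≤ W, x Y = 0) ∧
      ∀ (Y Y' : Opens M.pt) (h : Y' ≤ Y), Y ≤ V ∨ Y ≤ W → P.res h (x Y) = x Y' := by
  classical
  let x : ∀ Y, P.sec Y := fun Y => if h : Y ≤ V then P.res h s else 0
  have hV : ∀ Y (h : Y ≤ V), x Y = P.res h s := fun Y h => dif_pos h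
  have hW : ∀ Y ≤ W, x Y = 0 := fun Y h => by
    by_cases h' : Y ≤ V
    · rw [hV Y h', ← P.res_res (inf_le_left : V ⊓ W ≤ V) (le_inf h' h), hs, map_zero]
    · exact dif_neg h'
  refine ⟨x, hV, hW, fun Y Y' h hY => ?_⟩
  rcases hY with hY | hY
  · rw [hV Y hY, hV Y' (h.trans hY), P.res_res]
  · rw [hW Y hY, hW Y' (h.trans hY), map_zero]

lemma isLocal_ofSheaf (F : SheafOfModules.{v} M.ringSheaf) : (ofSheaf F).IsLocal where
  ext {U s t} h := by
    -- The opens on which `s` and `t` agree form a covering sieve, and both sections amalgamate the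
    -- restrictions of `s` to it.
    let S : Sieve U :=
      { arrows := fun V i => (ofSheaf F).res i.le s = (ofSheaf F).res i.le t
        downward_closed := fun {V W i} hi j => by
          rw [← (ofSheaf F).res_res i.le j.le, hi, (ofSheaf F).res_res] }
    have hS : S ∈ Opens.grothendieckTopology M.pt U := fun a ha => by
      obtain ⟨V, hV, haV, hst⟩ := h a ha
      exact ⟨V, homOfLE hV, hst, haV⟩
    obtain ⟨r, -, hr⟩ := exists_unique_amalgamation F.isSheaf S hS
      (fun V i _ => (F.val.presheaf.map i.op).hom s)
      (fun V W i _ j _ => ((ofSheaf F).res_res i.le j.le s))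
    rw [hr s fun V i _ => rfl, hr t fun V i hi => hi.symm]
  extend {U V W} hV hW hU s hs := by
    obtain ⟨x, hxV, hxW, hx⟩ := exists_extension_family _ s hs
    -- The sieve generated by the two-member cover; the family is compatible exactly on its members.
    let S : Sieve U :=
      { arrows := fun Y _ => Y ≤ V ∨ Y ≤ W
        downward_closed := fun {Y Y' i} hi j => hi.imp j.le.trans j.le.trans }
    have hS : S ∈ Opens.grothendieckTopology M.pt U := fun a ha => by
      rcases hU ha with h | h
      · exact ⟨V, homOfLE hV, Or.inl le_rfl, h⟩
      · exact ⟨W, homOfLE hW, Or.inr le_rfl, h⟩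
    obtain ⟨t, ht, -⟩ := exists_unique_amalgamation F.isSheaf S hS (fun Y i _ => x Y)
      (fun Y Y' i hY j _ => hx Y Y' j.le hY)
    exact ⟨t, ((ht (homOfLE hV) (Or.inl le_rfl)).trans (hxV V le_rfl)).trans
      ((ofSheaf F).res_self s), (ht (homOfLE hW) (Or.inr le_rfl)).trans (hxW W le_rfl)⟩

variable (M) in
/-- The structure sheaf as a presheaf of modules over itself. -/
def funMod : OMod.{u, u} M where
  sec U := M.Fun U
  res h := (M.res h).toLinearMap
  res_smul h f s := map_mul (M.res h) f s
  res_self {U} s := congrArg (fun g => g.hom s) (M.toLRS.presheaf.map_id (op U))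
  res_res h h' s := M.res_res h h' s

end OMod

namespace ComplexLRS

variable {M : ComplexLRS.{u}}

lemma exists_unique_glue {U : Opens M.pt} (V : M.pt → Opens M.pt) (hV : ∀ a, V a ≤ U)
    (hU : ∀ a ∈ U, a ∈ V a) (s : ∀ a, M.Fun (V a))
    (hs : ∀ a b, M.res (inf_le_left : V a ⊓ V b ≤ V a) (s a) =
      M.res (inf_le_right : V a ⊓ V b ≤ V b) (s b)) :
    ∃! t : M.Fun U, ∀ a, M.res (hV a) t = s a :=
  TopCat.Sheaf.existsUnique_gluing' M.toLRS.sheaf V U (fun a => homOfLE (hV a))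
    (fun a ha => Opens.mem_iSup.2 ⟨a, hU a ha⟩) s hs

lemma isLocal_funMod : (OMod.funMod M).IsLocal where
  ext {U s t} h := by
    choose! V hV haV hst using h
    refine TopCat.Sheaf.eq_of_locally_eq' M.toLRS.sheaf (fun a : U => V a) U
      (fun a => homOfLE (hV a a.2)) (fun a ha => Opens.mem_iSup.2 ⟨⟨a, ha⟩, haV a ha⟩) s t
      fun a => hst a a.2
  extend {U V W} hV hW hU s hs := by
    classical
    obtain ⟨x, hxV, hxW, hx⟩ := OMod.exists_extension_family _ s hs
    have hVW (b : Bool) : (if b then V else W) ≤ V ∨ (if b then V else W) ≤ W := by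
      cases b <;> simp
    obtain ⟨t, ht, -⟩ := TopCat.Sheaf.existsUnique_gluing' M.toLRS.sheaf
      (fun b : Bool => if b then V else W) U
      (fun b => homOfLE (by cases b; exacts [hW, hV]))
      (fun a ha => Opens.mem_iSup.2 ((hU ha).elim (fun h => ⟨true, h⟩) (fun h => ⟨false, h⟩)))
      (fun b => x _) (fun b b' => (hx _ _ inf_le_left (hVW b)).trans
        (hx _ _ inf_le_right (hVW b')).symm)
    exact ⟨t, ((ht true).trans (hxV V le_rfl)).trans ((OMod.funMod M).res_self s),
      (ht false).trans (hxW W le_rfl)⟩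

end ComplexLRS

namespace OMod

variable {M : ComplexLRS.{u}} {P : OMod.{u, v} M} {U V : Opens M.pt}

lemma notMem_supp_iff {s : P.sec U} {a : M.pt} (ha : a ∈ U) :
    a ∉ P.supp s ↔ ∃ (V : Opens M.pt) (h : V ≤ U), a ∈ V ∧ P.res h s = 0 := by
  simp only [supp, Set.mem_ofPred_eq, not_and, not_forall, not_not]
  exact ⟨fun h => let ⟨V, hV, haV, h⟩ := h ha; ⟨V, hV, haV, h⟩,
    fun ⟨V, hV, haV, h⟩ _ => ⟨V, hV, haV, h⟩⟩

lemma supp_subset (s : P.sec U) : P.supp s ⊆ U := fun _ ha => ha.1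

lemma supp_res_subset (h : V ≤ U) (s : P.sec U) : P.supp (P.res h s) ⊆ P.supp s := by
  intro a ha
  by_contra ha'
  obtain ⟨W, hW, haW, hs⟩ := (notMem_supp_iff (h ha.1)).1 ha'
  refine ha.2 (W ⊓ V) inf_le_right ⟨haW, ha.1⟩ ?_
  rw [P.res_res, ← P.res_res hW inf_le_left, hs, map_zero]

/-- Only over `⊤` is the support closed in `M`; over a smaller open set it is merely relatively
closed. This is why extension by zero below asks for a closed set of `M` containing the support. -/
lemma isClosed_supp (s : P.sec ⊤) : IsClosed (P.supp s) := by
  rw [← isOpen_compl_iff, isOpen_iff_forall_mem_open]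
  intro a ha
  obtain ⟨V, hV, haV, hs⟩ := (notMem_supp_iff (Opens.mem_top _)).1 ha
  exact ⟨V, fun b hb => (notMem_supp_iff (Opens.mem_top _)).2 ⟨V, hV, hb, hs⟩, V.2, haV⟩

lemma supp_smul_subset_right (f : M.Fun U) (s : P.sec U) : P.supp (f • s) ⊆ P.supp s := by
  intro a ha
  by_contra ha'
  obtain ⟨W, hW, haW, hs⟩ := (notMem_supp_iff ha.1).1 ha'
  exact ha.2 W hW haW (by rw [P.res_smul, hs, smul_zero])

lemma supp_smul_subset_left (f : M.Fun U) (s : P.sec U) : P.supp (f • s) ⊆ M.supp f := by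
  intro a ha
  by_contra ha'
  obtain ⟨W, hW, haW, hs⟩ := (notMem_supp_iff (P := funMod M) ha.1).1 ha'
  exact ha.2 W hW haW (by rw [P.res_smul, show M.res hW f = 0 from hs, zero_smul])

namespace IsLocal

lemma eq_zero_of_supp (hP : P.IsLocal) {s : P.sec U} (h : P.supp s ⊆ ∅) : s = 0 :=
  hP.ext fun _ ha => let ⟨V, hV, haV, hs⟩ := (notMem_supp_iff ha).1 (fun h' => h h')
    ⟨V, hV, haV, by rw [hs, map_zero]⟩

lemma res_eq_zero (hP : P.IsLocal) (h : V ≤ U) {s : P.sec U} (hs : Disjoint (V : Set M.pt) (P.supp s)) :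
    P.res h s = 0 :=
  hP.eq_zero_of_supp fun _ ha => hs.le_bot ⟨ha.1, supp_res_subset h s ha⟩

/-- Sections which agree on `V` and vanish outside a subset of `V` are equal. -/
lemma ext_of_supp (hP : P.IsLocal) (h : V ≤ U) {s t : P.sec U} {K : Set M.pt} (hK : K ⊆ V)
    (hs : P.supp s ⊆ K) (ht : P.supp t ⊆ K) (hst : P.res h s = P.res h t) : s = t := by
  refine hP.ext fun a ha => ?_
  by_cases haK : a ∈ K
  · exact ⟨V, h, hK haK, hst⟩
  · obtain ⟨W, hW, haW, h1⟩ := (notMem_supp_iff ha).1 fun h => haK (hs h)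
    obtain ⟨W', hW', haW', h2⟩ := (notMem_supp_iff ha).1 fun h => haK (ht h)
    refine ⟨W ⊓ W', inf_le_left.trans hW, ⟨haW, haW'⟩, ?_⟩
    rw [← P.res_res hW inf_le_left, h1, ← P.res_res hW' inf_le_right, h2, map_zero, map_zero]

/-- Extension by zero. -/
lemma exists_extension (hP : P.IsLocal) (h : V ≤ U) (s : P.sec V) {K : Set M.pt} (hK : IsClosed K)
    (hKV : K ∩ U ⊆ V) (hs : P.supp s ⊆ K) :
    ∃ t : P.sec U, P.res h t = s ∧ P.supp t ⊆ P.supp s := by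
  -- The complement of `K` in `U`: it covers `U` together with `V` because `K ∩ U ⊆ V`, and `s`
  -- vanishes on `V ⊓ W`.
  let W : Opens M.pt := U ⊓ ⟨Kᶜ, hK.isOpen_compl⟩
  obtain ⟨t, ht, ht'⟩ := hP.extend h (inf_le_left : W ≤ U) (fun a ha => by
    by_cases haK : a ∈ K
    · exact Or.inl (hKV ⟨haK, ha⟩)
    · exact Or.inr ⟨ha, haK⟩) s
    (hP.res_eq_zero _ (Set.disjoint_left.2 fun a ha has => ha.2.2 (hs has)))
  refine ⟨t, ht, fun a ha => ?_⟩
  by_contra has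
  by_cases haV : a ∈ V
  · obtain ⟨Y, hY, haY, h0⟩ := (notMem_supp_iff haV).1 has
    refine ha.2 Y (hY.trans h) haY ?_
    rw [← P.res_res h hY, ht, h0]
  · exact ha.2 W inf_le_left ⟨ha.1, fun haK => haV (hKV ⟨haK, ha.1⟩)⟩ ht'

/-- A section on which a function equal to one near its support acts. -/
lemma smul_eq_self (hP : P.IsLocal) {f : M.Fun U} {s : P.sec U}
    (h : Disjoint (M.supp (1 - f)) (P.supp s)) : f • s = s := by
  -- The difference is `(1 - f) • s`, whose support lies in two disjoint sets.
  rw [← sub_eq_zero, ← neg_eq_zero, neg_sub]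
  nth_rw 1 [← one_smul (M.Fun U) s]
  rw [← sub_smul]
  exact hP.eq_zero_of_supp fun a ha =>
    h.le_bot ⟨supp_smul_subset_left _ _ ha, supp_smul_subset_right _ _ ha⟩

lemma smul_eq_zero (hP : P.IsLocal) {f : M.Fun U} {s : P.sec U}
    (h : Disjoint (M.supp f) (P.supp s)) : f • s = 0 :=
  hP.eq_zero_of_supp fun _ ha =>
    h.le_bot ⟨supp_smul_subset_left _ _ ha, supp_smul_subset_right _ _ ha⟩

end IsLocal

end OMod

/-! ### Locality of the reduction and of the density sheaf -/

namespace ComplexLRS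

variable {M : ComplexLRS.{u}} [IsFormalManifold M] {U V : Opens M.pt}

lemma redVal_res (h : V ≤ U) (k : M.redMod.sec U) {a : M.pt} (ha : a ∈ V) :
    redVal (M.redMod.res h k) a = redVal k a :=
  if_pos ha

lemma redVal_of_notMem (k : M.redMod.sec U) {a : M.pt} (ha : a ∉ U) : redVal k a = 0 :=
  k.2.1 a ha

lemma coeff_res (h : V ≤ U) (k : M.densMod.sec U) {n : ℕ} (c : M.Chart n) {a : M.pt} (ha : a ∈ V) :
    coeff (M.densMod.res h k) n c a = coeff k n c a :=
  if_pos ha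

lemma coeff_of_notMem (k : M.densMod.sec U) {n : ℕ} (c : M.Chart n) {a : M.pt} (ha : a ∉ U) :
    coeff k n c a = 0 :=
  k.2.1 n c a fun h => ha h.1

/-- Sections of the reduction are stored as functions on all of `M`, zero outside their domain.
Restriction to an open set containing the support therefore leaves the function literally unchanged,
so seminorms over `U` and over `M` can be compared as suprema of the same function. -/
lemma redVal_res_of_supp (h : V ≤ U) {k : M.redMod.sec U} (hk : M.redMod.supp k ⊆ V) :
    redVal (M.redMod.res h k) = redVal k := by
  funext a
  by_cases ha : a ∈ V
  · exact redVal_res h k ha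
  · rw [redVal_of_notMem _ ha, redVal_eq_zero (K := V) hk ha]

lemma coeff_res_of_supp (h : V ≤ U) {k : M.densMod.sec U} (hk : M.densMod.supp k ⊆ V) :
    coeff (M.densMod.res h k) = coeff k := by
  funext n c a
  by_cases ha : a ∈ V
  · exact coeff_res h k c ha
  · rw [coeff_of_notMem _ c ha, coeff_eq_zero (K := V) hk ha]

/-- Since sections are already extended by zero, the extension of `s` is the same function. What
needs checking is that near points of `W` it is locally given by the formal function zero. -/
lemma isLocal_redMod : M.redMod.IsLocal where
  ext {U s t} h := Subtype.ext (funext fun a => by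
    by_cases ha : a ∈ U
    · obtain ⟨V, hV, haV, hst⟩ := h a ha
      have := congrArg (fun k => redVal k a) hst
      simp only [redVal_res hV _ haV] at this
      exact this
    · rw [s.2.1 a ha, t.2.1 a ha])
  extend {U V W} hV hW hU s hs := by
    have h0 : ∀ a ∈ V ⊓ W, s.1 a = 0 := fun a ha =>
      (redVal_res inf_le_left s ha).symm.trans (by rw [hs]; rfl)
    refine ⟨⟨s.1, fun a ha => s.2.1 a fun h => ha (hV h), fun a ha => ?_⟩, ?_, ?_⟩
    · rcases hU ha with h | h
      · obtain ⟨Y, f, hY, haY, hf⟩ := s.2.2 a h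
        exact ⟨Y, f, hY.trans hV, haY, hf⟩
      · refine ⟨W, 0, hW, h, fun b hb => ?_⟩
        rw [value_zero]
        by_cases hbV : b ∈ V
        · exact h0 b ⟨hbV, hb⟩
        · exact s.2.1 b hbV
    · refine Subtype.ext (funext fun a => ?_)
      by_cases ha : a ∈ V
      · exact if_pos ha
      · exact (if_neg ha).trans (s.2.1 a ha).symm
    · refine Subtype.ext (funext fun a => ?_)
      by_cases ha : a ∈ W
      · refine (if_pos ha).trans ?_
        by_cases haV : a ∈ V
        · exact h0 a ⟨haV, ha⟩
        · exact s.2.1 a haV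
      · exact if_neg ha

/-- As for the reduction, the coefficient functions themselves serve as the extension. On `W` they
vanish, which gives smoothness and the transformation rule there. -/
lemma isLocal_densMod : M.densMod.IsLocal where
  ext {U s t} h := Subtype.ext (funext fun n => funext fun c => funext fun a => by
    by_cases ha : a ∈ U
    · obtain ⟨V, hV, haV, hst⟩ := h a ha
      have := congrArg (fun k => coeff k n c a) hst
      simp only [coeff_res hV _ c haV] at this
      exact this
    · rw [s.2.1 n c a fun h => ha h.1, t.2.1 n c a fun h => ha h.1])
  extend {U V W} hV hW hU s hs := by
    have h0 : ∀ a ∈ W, ∀ n c, s.1 n c a = 0 := fun a ha n c => by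
      by_cases haV : a ∈ V
      · exact (coeff_res inf_le_left s c ⟨haV, ha⟩).symm.trans (by rw [hs]; rfl)
      · exact s.2.1 n c a fun h => haV h.1
    refine ⟨⟨s.1, fun n c a ha => s.2.1 n c a fun h => ha ⟨hV h.1, h.2⟩, fun n c => ?_,
      fun n c c' a ha h1 h2 => ?_⟩, ?_, ?_⟩
    · intro x hx
      rcases hU hx with h | h
      · exact ((s.2.2.1 n c).contDiffAt
          ((V.2.preimage c.continuous_symm).mem_nhds h)).contDiffWithinAt
      · refine (contDiffAt_const (c := (0 : ℂ))).contDiffWithinAt.congr_of_eventuallyEq ?_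
          (h0 _ h n c)
        filter_upwards [mem_nhdsWithin_of_mem_nhds
          ((W.2.preimage c.continuous_symm).mem_nhds h)] with y hy
        exact h0 _ hy n c
    · rcases hU ha with h | h
      · exact s.2.2.2 n c c' a h h1 h2
      · rw [h0 a h n c, h0 a h n c', mul_zero]
    · refine Subtype.ext (funext fun n => funext fun c => funext fun a => ?_)
      by_cases ha : a ∈ V
      · exact if_pos ha
      · exact (if_neg ha).trans (s.2.1 n c a fun h => ha h.1).symm
    · refine Subtype.ext (funext fun n => funext fun c => funext fun a => ?_)
      by_cases ha : a ∈ W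
      · exact (if_pos ha).trans (h0 a ha n c)
      · exact if_neg ha

/-- The integral sees only the coefficient functions on `M`, not the open set over which the density
is regarded. -/
lemma integral_congr (τ : M.densMod.secC U) (τ' : M.densMod.secC V)
    (h : coeff τ.1 = coeff τ'.1) : integral U τ = integral V τ' := by
  change ∑ᶠ a, ∫ x, densLocal τ.1 a x = ∑ᶠ a, ∫ x, densLocal τ'.1 a x
  simp only [densLocal, h]

lemma smoothSeminorm_congr {P : OMod.{u, v} M} {Q : OMod.{u, w} M} (D : P.diffC M.redMod U)
    (E : Q.diffC M.redMod V) (s : P.sec U) (t : Q.sec V)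
    (h : redVal (OMod.homTop D.1 s) = redVal (OMod.homTop E.1 t)) :
    P.smoothSeminorm U D s = Q.smoothSeminorm V E t := by
  change ⨆ a, ‖redVal (OMod.homTop D.1 s) a‖ = ⨆ a, ‖redVal (OMod.homTop E.1 t) a‖
  rw [h]

end ComplexLRS

/-! ### Formal partitions of unity -/

namespace ComplexLRS

variable {M : ComplexLRS.{u}}

lemma notMem_supp_iff {U : Opens M.pt} {f : M.Fun U} {a : M.pt} (ha : a ∈ U) :
    a ∉ M.supp f ↔ ∃ (V : Opens M.pt) (h : V ≤ U), a ∈ V ∧ M.res h f = 0 :=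
  OMod.notMem_supp_iff (P := OMod.funMod M) ha

lemma isClosed_supp (f : M.Fun ⊤) : IsClosed (M.supp f) :=
  OMod.isClosed_supp (P := OMod.funMod M) f

/-- A non-unit germ lies in the maximal ideal and hence has value zero; units can be recognised on
germs. This permits division by the sum of the bumps. -/
lemma isUnit_of_value_ne_zero {U : Opens M.pt} {f : M.Fun U} (h : ∀ a ∈ U, M.value f a ≠ 0) :
    IsUnit f := by
  refine M.toLRS.toRingedSpace.isUnit_of_isUnit_germ U f fun a ha => ?_
  by_contra hu
  have : M.HasValue f a 0 := ⟨ha, by rw [map_zero, sub_zero]; exact hu⟩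
  exact h a ha this.value_eq

/-- The sum of a locally finite family. -/
lemma exists_locallyFinite_sum {ι : Type*} (g : ι → M.Fun ⊤)
    (hg : ∀ a : M.pt, ∃ (W : Opens M.pt) (A : Finset ι), a ∈ W ∧
      ∀ i ∉ A, M.res (le_top : W ≤ ⊤) (g i) = 0) :
    ∃ t : M.Fun ⊤, ∀ (W : Opens M.pt) (A : Finset ι),
      (∀ i ∉ A, M.res (le_top : W ≤ ⊤) (g i) = 0) →
      M.res (le_top : W ≤ ⊤) t = ∑ i ∈ A, M.res (le_top : W ≤ ⊤) (g i) := by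
  classical
  -- The finite sum does not depend on the index set as long as all omitted terms vanish, so the
  -- local sums are compatible.
  have key (W : Opens M.pt) (A B : Finset ι) (hA : ∀ i ∉ A, M.res (le_top : W ≤ ⊤) (g i) = 0)
      (hB : ∀ i ∉ B, M.res (le_top : W ≤ ⊤) (g i) = 0) :
      ∑ i ∈ A, M.res (le_top : W ≤ ⊤) (g i) = ∑ i ∈ B, M.res (le_top : W ≤ ⊤) (g i) := by
    rw [Finset.sum_subset Finset.subset_union_left fun i _ hi => hA i hi,
      Finset.sum_subset (Finset.subset_union_right (s₁ := A)) fun i _ hi => hB i hi]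
  have mono {W W' : Opens M.pt} (h : W' ≤ W) {i : ι} (hi : M.res (le_top : W ≤ ⊤) (g i) = 0) :
      M.res (le_top : W' ≤ ⊤) (g i) = 0 := by
    rw [← M.res_res le_top h, hi, map_zero]
  choose W A ha hA using hg
  obtain ⟨t, ht, -⟩ := exists_unique_glue (U := ⊤) W (fun _ => le_top) (fun a _ => ha a)
    (fun a => ∑ i ∈ A a, M.res (le_top : W a ≤ ⊤) (g i)) (fun a b => by
      simp only [map_sum, M.res_res]
      exact key _ _ _ (fun i hi => mono inf_le_left (hA a i hi))
        (fun i hi => mono inf_le_right (hA b i hi)))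
  refine ⟨t, fun V B hB => isLocal_funMod.ext fun a haV => ⟨W a ⊓ V, inf_le_right, ⟨ha a, haV⟩, ?_⟩⟩
  change M.res _ (M.res _ _) = M.res _ (∑ i ∈ B, _)
  rw [M.res_res, ← M.res_res le_top (inf_le_left : W a ⊓ V ≤ W a), ht, map_sum, map_sum]
  simp only [M.res_res]
  exact key _ _ _ (fun i hi => mono inf_le_left (hA a i hi))
    (fun i hi => mono inf_le_right (hB i hi))

variable [IsFormalManifold M]

/-- The inverse of a chart is defined and continuous on all of `ℝⁿ`, so images of closed balls are
compact neighbourhoods; in a Hausdorff space this weak form suffices. -/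
lemma locallyCompactSpace : LocallyCompactSpace M.pt := by
  have : WeaklyLocallyCompactSpace M.pt := ⟨fun a => by
    obtain ⟨n, c, hc⟩ := IsFormalManifold.exists_chart a
    refine ⟨c.toHomeo.symm '' Metric.closedBall (c.toHomeo a) 1,
      (isCompact_closedBall _ _).image c.continuous_symm, ?_⟩
    filter_upwards [c.toHomeo.open_source.mem_nhds hc, (c.toHomeo.continuousAt hc).preimage_mem_nhds
      (Metric.closedBall_mem_nhds _ one_pos)] with b hb hb'
    exact ⟨_, hb', c.toHomeo.left_inv hb⟩⟩
  infer_instance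

attribute [local instance] locallyCompactSpace

lemma value_eq_zero_of_notMem_supp {U : Opens M.pt} {f : M.Fun U} {a : M.pt} (ha : a ∉ M.supp f) :
    M.value f a = 0 := by
  by_cases haU : a ∈ U
  · obtain ⟨V, hV, haV, h⟩ := (notMem_supp_iff haU).1 ha
    rw [← value_res hV f haV, h, value_zero]
  · exact value_of_notMem f haU

/-- A smooth bump in coordinates, viewed as a constant power series, is a formal function on the
chart domain. Its support lies in a compact subset of that domain, which is closed in `M`, so it
extends by zero. -/
lemma exists_bump {n : ℕ} (c : M.Chart n) {K V : Set M.pt} (hK : IsCompact K) (hV : IsOpen V)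
    (hKV : K ⊆ V) (hKc : K ⊆ c.toHomeo.source) :
    ∃ b : M.Fun ⊤, M.supp b ⊆ V ∧ (∀ a, ∃ t ∈ Set.Icc (0 : ℝ) 1, M.value b a = (t : ℂ)) ∧
      ∀ a ∈ K, M.value b a = 1 := by
  -- The real bump is made to vanish off the interior of `L`, which keeps the support of the formal
  -- function inside the compact image of `L`.
  obtain ⟨L, hL, hKL, hLV⟩ := exists_compact_between
    (hK.image_of_continuousOn (c.toHomeo.continuousOn.mono hKc)) (hV.preimage c.continuous_symm)
    (by rintro _ ⟨a, ha, rfl⟩; rw [Set.mem_preimage, c.toHomeo.left_inv (hKc ha)]; exact hKV ha)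
  obtain ⟨g, hg0, hg1, hg⟩ := exists_contMDiffMap_zero_one_of_isClosed (n := ⊤)
    (modelWithCornersSelf ℝ (EuclideanSpace ℝ (Fin n))) isOpen_interior.isClosed_compl
    (hK.image_of_continuousOn (c.toHomeo.continuousOn.mono hKc)).isClosed
    (Set.disjoint_left.2 fun x hx hx' => hx (hKL hx'))
  have hgs : ContDiff ℝ ∞ fun x => (g x : ℂ) := Complex.ofRealCLM.contDiff.comp g.contMDiff.contDiff
  let G (W : Set (EuclideanSpace ℝ (Fin n))) : SmoothFn W :=
    ⟨fun x => (g x : ℂ), hgs.contDiffOn.congr fun x hx => extend_val_apply _ hx⟩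
  let s : M.Fun c.opens := (c.iso c.opens subset_rfl).symm (MvPowerSeries.C (G _))
  have hs : M.supp s ⊆ c.toHomeo.symm '' L := by
    intro a ha
    by_contra haL
    have hclosed : IsClosed (c.toHomeo.symm '' L) := (hL.image c.continuous_symm).isClosed
    let W : Opens M.pt := c.opens ⊓ ⟨_, hclosed.isOpen_compl⟩
    refine ha.2 W inf_le_left ⟨ha.1, haL⟩ ((c.iso W fun b hb => hb.1).injective ?_)
    rw [c.iso_res c.opens W subset_rfl inf_le_left, AlgEquiv.apply_symm_apply, MvPowerSeries.map_C,
      map_zero]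
    refine (congrArg (MvPowerSeries.C (σ := Fin c.k)) (a₂ := 0) ?_).trans (map_zero _)
    refine Subtype.ext (funext fun x => ?_)
    change ((g x.1 : ℝ) : ℂ) = 0
    rw [hg0 fun hx => x.2.2 ⟨_, interior_subset hx, rfl⟩]
    rfl
  obtain ⟨b, hb, hb'⟩ := isLocal_funMod.exists_extension (le_top : c.opens ≤ ⊤) s
    (hL.image c.continuous_symm).isClosed
    (by rintro _ ⟨⟨x, -, rfl⟩, -⟩; exact c.symm_mem x) hs
  have hval (a : M.pt) (ha : a ∈ c.toHomeo.source) : M.value b a = g (c.toHomeo a) := by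
    have ha' : a ∈ c.opens := ha
    rw [← value_res (le_top : c.opens ≤ ⊤) b ha', show M.res le_top b = s from hb]
    have hx : c.toHomeo.symm (c.toHomeo a) = a := c.toHomeo.left_inv ha
    have := (c.hasValue (V := c.opens) subset_rfl s (c.toHomeo a) (c.symm_mem _)).value_eq
    rw [hx] at this
    rw [this]
    simp only [s, AlgEquiv.apply_symm_apply, MvPowerSeries.constantCoeff_C]
    rfl
  refine ⟨b, fun a ha => ?_, fun a => ?_, fun a ha => ?_⟩
  · obtain ⟨x, hx, rfl⟩ := hs (hb' ha)
    exact hLV hx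
  · by_cases ha : a ∈ c.toHomeo.source
    · exact ⟨_, hg _, hval a ha⟩
    · refine ⟨0, by simp, ?_⟩
      rw [Complex.ofReal_zero]
      exact value_eq_zero_of_notMem_supp fun h => ha (hb' h).1
  · rw [hval a (hKc ha), hg1 ⟨a, ha, rfl⟩]
    simp

lemma value_sum {ι : Type*} {U : Opens M.pt} (A : Finset ι) (f : ι → M.Fun U) (a : M.pt) :
    M.value (∑ i ∈ A, f i) a = ∑ i ∈ A, M.value (f i) a := by
  classical
  induction A using Finset.induction_on with
  | empty => simp [value_zero]
  | insert i A hi ih => rw [Finset.sum_insert hi, Finset.sum_insert hi, value_add, ih]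

/-- Relatively compact neighbourhoods with closure inside a chart are refined to a locally finite
cover, which is then shrunk. Each bump equals one in value on the closure of a shrunken set and is
supported in the unshrunken one, so the supports stay locally finite while some bump has value one
at every point. -/
lemma exists_locallyFinite_bumps (N : M.pt → Set M.pt) (hN : ∀ a, N a ∈ 𝓝 a) :
    ∃ b : M.pt → M.Fun ⊤, (∀ i, M.supp (b i) ⊆ N i) ∧ LocallyFinite (fun i => M.supp (b i)) ∧
      (∀ i a, ∃ t ∈ Set.Icc (0 : ℝ) 1, M.value (b i) a = (t : ℂ)) ∧
      ∀ a, ∃ i, M.value (b i) a = 1 := by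
  have (a : M.pt) : ∃ O : Set M.pt, IsOpen O ∧ a ∈ O ∧ O ⊆ N a ∧ IsCompact (closure O) ∧
      closure O ⊆ (M.chartAt a).toHomeo.source := by
    obtain ⟨O, hO, haO, hON, hOc⟩ := exists_open_between_and_isCompact_closure
      (isCompact_singleton (x := a)) (isOpen_interior.inter (M.chartAt a).toHomeo.open_source)
      (Set.singleton_subset_iff.2 ⟨mem_interior_iff_mem_nhds.2 (hN a), M.mem_chartAt a⟩)
    exact ⟨O, hO, haO rfl, fun b hb => interior_subset (hON (subset_closure hb)).1, hOc,
      fun b hb => (hON hb).2⟩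
  choose O hO haO hON hOc hOs using this
  obtain ⟨V, hV, hVc, hVf, hVO⟩ := precise_refinement O hO
    (Set.eq_univ_of_forall fun a => Set.mem_iUnion.2 ⟨a, haO a⟩)
  obtain ⟨W, hWc, -, hWV⟩ := exists_iUnion_eq_closure_subset hV hVf.point_finite hVc
  choose b hbV hb01 hb1 using fun i => exists_bump (M.chartAt i)
    ((hOc i).of_isClosed_subset isClosed_closure (closure_mono (subset_closure.trans
      ((hWV i).trans (hVO i))))) (hV i) (hWV i)
    ((closure_mono (subset_closure.trans ((hWV i).trans (hVO i)))).trans (hOs i))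
  refine ⟨b, fun i => (hbV i).trans ((hVO i).trans (hON i)), hVf.subset hbV, hb01, fun a => ?_⟩
  obtain ⟨i, hi⟩ := Set.mem_iUnion.1 (hWc ▸ Set.mem_univ a)
  exact ⟨i, hb1 i a (subset_closure hi)⟩

/-- Each bump `b i` is assigned to one index `α i` with support in `U (α i)`. The member at `β` is
the sum of the bumps assigned to `β`, divided by the sum of all of them. -/
lemma exists_isFormalPartition {Γ : Type w} (U : Γ → Opens M.pt) (hU : ⨆ α, U α = ⊤) :
    ∃ f, IsFormalPartition U f := by
  classical
  have hU' (a : M.pt) : ∃ α, a ∈ U α := Opens.mem_iSup.1 (hU ▸ Opens.mem_top a)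
  choose α hα using hU'
  obtain ⟨b, hbU, hbf, hb01, hb1⟩ := exists_locallyFinite_bumps (fun a => (U (α a) : Set M.pt))
    fun a => (U (α a)).2.mem_nhds (hα a)
  choose r hr01 hr using hb01
  have hbf' (a : M.pt) : ∃ (W : Opens M.pt) (A : Finset M.pt), a ∈ W ∧
      ∀ i ∉ A, M.res (le_top : W ≤ ⊤) (b i) = 0 := by
    obtain ⟨t, ht, hfin⟩ := hbf a
    obtain ⟨W, hWt, hW, haW⟩ := mem_nhds_iff.1 ht
    refine ⟨⟨W, hW⟩, hfin.toFinset, haW, fun i hi => ?_⟩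
    refine isLocal_funMod.res_eq_zero le_top (Set.disjoint_left.2 fun c hc hc' => hi ?_)
    exact hfin.mem_toFinset.2 ⟨c, hc', hWt hc⟩
  choose W A haW hA using hbf'
  obtain ⟨S, hS⟩ := exists_locallyFinite_sum b fun a => ⟨W a, A a, haW a, hA a⟩
  choose B hB using fun β : Γ => exists_locallyFinite_sum (fun i => if α i = β then b i else 0)
    fun a => ⟨W a, A a, haW a, fun i hi => by
      split_ifs
      · exact hA a i hi
      · exact map_zero _⟩
  have hB' (β : Γ) (V : Opens M.pt) (A : Finset M.pt)
      (hA : ∀ i ∉ A, M.res (le_top : V ≤ ⊤) (b i) = 0) :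
      M.res (le_top : V ≤ ⊤) (B β) = ∑ i ∈ A with α i = β, M.res (le_top : V ≤ ⊤) (b i) := by
    rw [hB β V A fun i hi => by split_ifs; exacts [hA i hi, map_zero _], Finset.sum_filter]
    exact Finset.sum_congr rfl fun i _ => by split_ifs; exacts [rfl, map_zero _]
  have hSval (a : M.pt) : M.value S a = ((∑ i ∈ A a, r i a : ℝ) : ℂ) := by
    rw [← value_res le_top S (haW a), hS _ _ (hA a), value_sum, Complex.ofReal_sum]
    exact Finset.sum_congr rfl fun i _ => by rw [value_res le_top _ (haW a), hr]
  have hBval (β : Γ) (a : M.pt) : M.value (B β) a = ((∑ i ∈ A a with α i = β, r i a : ℝ) : ℂ) := by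
    rw [← value_res le_top (B β) (haW a), hB' _ _ _ (hA a), value_sum, Complex.ofReal_sum]
    exact Finset.sum_congr rfl fun i _ => by rw [value_res le_top _ (haW a), hr]
  have hpos (a : M.pt) : 0 < ∑ i ∈ A a, r i a := by
    obtain ⟨i, hi⟩ := hb1 a
    refine Finset.sum_pos' (fun i _ => (hr01 i a).1) ⟨i, ?_, ?_⟩
    · by_contra hiA
      rw [← value_res le_top (b i) (haW a), hA a i hiA, value_zero] at hi
      exact zero_ne_one hi
    · rw [hr] at hi
      exact (Complex.ofReal_eq_one.1 hi) ▸ one_pos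
  -- The values of `S` are positive reals, so `S` is invertible as a formal function and not merely
  -- pointwise.
  obtain ⟨T, hT⟩ := (isUnit_of_value_ne_zero (U := ⊤) (f := S) fun a _ => by
    rw [hSval]; exact Complex.ofReal_ne_zero.2 (hpos a).ne').exists_right_inv
  have hTval (a : M.pt) : M.value T a = (((∑ i ∈ A a, r i a)⁻¹ : ℝ) : ℂ) := by
    have h := congrArg (fun f => M.value f a) hT
    simp only [value_mul, value_one (Opens.mem_top a), hSval] at h
    rw [Complex.ofReal_inv]
    exact eq_inv_of_mul_eq_one_right h
  have hsupp (β : Γ) (V : Opens M.pt) (h : M.res (le_top : V ≤ ⊤) (B β) = 0) :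
      M.res (le_top : V ≤ ⊤) (B β * T) = 0 := by rw [map_mul, h, zero_mul]
  refine ⟨fun β => B β * T, fun β a ha => ?_, fun a => ?_, fun V C hC => ?_, fun β a => ?_⟩
  · obtain ⟨i, hi, hai⟩ : ∃ i, α i = β ∧ a ∈ M.supp (b i) := by
      by_contra! hne
      -- If no bump assigned to `β` had `a` in its support, removing these finitely many closed
      -- supports would leave a neighbourhood of `a` on which `B β` vanishes. For `α i ≠ β` the set
      -- in the union is empty.
      have hcl : IsClosed (⋃ i ∈ A a, {c | α i = β ∧ c ∈ M.supp (b i)}) :=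
        isClosed_biUnion_finset fun i _ => isClosed_const.inter (isClosed_supp (b i))
      let V : Opens M.pt := W a ⊓ ⟨_, hcl.isOpen_compl⟩
      have haV : a ∈ V := ⟨haW a, fun h =>
        let ⟨i, _, hi⟩ := Set.mem_iUnion₂.1 h
        hne i hi.1 hi.2⟩
      refine ha.2 V le_top haV (hsupp β V ?_)
      rw [hB' β V (A a) fun i hi => by
        rw [← M.res_res le_top (inf_le_left : V ≤ W a), hA a i hi, map_zero]]
      refine Finset.sum_eq_zero fun i hi => isLocal_funMod.res_eq_zero le_top
        (Set.disjoint_left.2 fun c hc hc' => hc.2 ?_)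
      rw [Finset.mem_filter] at hi
      exact Set.mem_biUnion hi.1 ⟨hi.2, hc'⟩
    rw [← hi]
    exact hbU i hai
  · refine ⟨W a, (W a).2.mem_nhds (haW a), ((A a).image α).finite_toSet.subset ?_⟩
    rintro β ⟨c, hc, hcW⟩
    by_contra hβ
    refine hc.2 (W a) le_top hcW (hsupp β _ ?_)
    rw [hB' β _ _ (hA a), Finset.filter_eq_empty_iff.2, Finset.sum_empty]
    exact fun i hi h => hβ (Finset.mem_coe.2 (Finset.mem_image.2 ⟨i, hi, h⟩))
  -- The identity is checked near each point, where only the bumps in `A a` survive. The index set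
  -- `C` is enlarged by the image of `A a`, which adds only zero terms; the double sum over the
  -- fibres of `α` is then the restriction of `S`.
  · refine isLocal_funMod.ext fun a ha => ⟨W a ⊓ V, inf_le_right, ⟨haW a, ha⟩, ?_⟩
    have hA' : ∀ i ∉ A a, M.res (le_top : W a ⊓ V ≤ ⊤) (b i) = 0 := fun i hi => by
      rw [← M.res_res le_top (inf_le_left : W a ⊓ V ≤ W a), hA a i hi, map_zero]
    change M.res _ (∑ β ∈ C, _) = M.res _ 1
    rw [map_sum, map_one]
    simp only [M.res_res]
    rw [Finset.sum_subset (Finset.subset_union_left (s₂ := (A a).image α)) fun β _ hβ => by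
      rw [← M.res_res le_top (inf_le_right : W a ⊓ V ≤ V), hC β hβ, map_zero]]
    simp only [map_mul]
    rw [← Finset.sum_mul, ← map_one (M.res (le_top : W a ⊓ V ≤ ⊤)), ← hT, map_mul, hS _ _ hA']
    congr 1
    rw [Finset.sum_congr rfl fun β _ => hB' β _ _ hA']
    exact Finset.sum_fiberwise_of_maps_to
      (fun i hi => Finset.mem_union_right _ (Finset.mem_image_of_mem α hi)) _
  · refine ⟨(∑ i ∈ A a with α i = β, r i a) * (∑ i ∈ A a, r i a)⁻¹, ⟨?_, ?_⟩, ?_⟩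
    · exact mul_nonneg (Finset.sum_nonneg fun i _ => (hr01 i a).1) (inv_nonneg.2 (hpos a).le)
    · rw [← div_eq_mul_inv, div_le_one (hpos a)]
      exact Finset.sum_le_sum_of_subset_of_nonneg (Finset.filter_subset _ _)
        fun i _ _ => (hr01 i a).1
    · rw [value_mul, hBval, hTval, Complex.ofReal_mul]

/-- Formal cutoff functions. -/
lemma exists_cutoff {K : Set M.pt} (hK : IsCompact K) {U : Opens M.pt} (hKU : K ⊆ U) :
    ∃ g : M.Fun ⊤, IsCompact (M.supp g) ∧ M.supp g ⊆ U ∧ Disjoint (M.supp (1 - g)) K := by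
  obtain ⟨V, hV, hKV, hVU, hVc⟩ := exists_open_between_and_isCompact_closure hK U.2 hKU
  -- For the cover by a relatively compact `V` and the complement of `K`, the first member is the
  -- cutoff: one minus it is the second member, supported off `K`.
  obtain ⟨f, hf⟩ := exists_isFormalPartition
    (fun b : Bool => if b then (⟨V, hV⟩ : Opens M.pt) else ⟨Kᶜ, hK.isClosed.isOpen_compl⟩)
    (eq_top_iff.2 fun a _ => Opens.mem_iSup.2 (by
      by_cases ha : a ∈ K
      · exact ⟨true, hKV ha⟩
      · exact ⟨false, ha⟩))
  have h1 := hf.sum_eq_one ⊤ Finset.univ fun b hb => (hb (Finset.mem_univ b)).elim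
  have hres (f : M.Fun ⊤) : M.res le_top f = f := (OMod.funMod M).res_self f
  simp only [hres, Fintype.sum_bool] at h1
  have h2 : M.supp (f true) ⊆ V := hf.supp_subset true
  refine ⟨f true, hVc.of_isClosed_subset (isClosed_supp _) (h2.trans subset_closure),
    h2.trans (subset_closure.trans hVU), ?_⟩
  rw [← h1, add_sub_cancel_left]
  exact Set.disjoint_left.2 fun a ha => hf.supp_subset false ha

end ComplexLRS

/-! ### Restriction and extension of differential operators -/

section
variable {A : Type*} [CommRing A] [Algebra ℂ A] {P Q : Type*} [AddCommGroup P]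
  [AddCommGroup Q] [Module ℂ P] [Module ℂ Q] [Module A P] [Module A Q] [IsScalarTower ℂ A P]
  [IsScalarTower ℂ A Q]

lemma mem_orderLE_zero {D : P →ₗ[ℂ] Q} :
    D ∈ orderLE A P Q 0 ↔ ∀ f : A, commutatorMap f D = 0 := by
  simp [orderLE, Submodule.mem_iInf]

lemma mem_orderLE_succ {D : P →ₗ[ℂ] Q} {r : ℕ} :
    D ∈ orderLE A P Q (r + 1) ↔ ∀ f : A, commutatorMap f D ∈ orderLE A P Q r := by
  simp [orderLE, Submodule.mem_iInf]

/-- Since the ring is commutative, taking commutators commutes with precomposition by a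
multiplication; the rest is induction on the order. -/
lemma comp_lsmul_mem_orderLE {D : P →ₗ[ℂ] Q} {r : ℕ} (hD : D ∈ orderLE A P Q r) (f : A) :
    D.comp (Algebra.lsmul ℂ ℂ P f) ∈ orderLE A P Q r := by
  have key (D : P →ₗ[ℂ] Q) (g : A) : commutatorMap g (D.comp (Algebra.lsmul ℂ ℂ P f)) =
      (commutatorMap g D).comp (Algebra.lsmul ℂ ℂ P f) := by
    ext s
    simp [smul_comm f g s]
  induction r generalizing D with
  | zero =>
    rw [mem_orderLE_zero] at hD ⊢
    exact fun g => by rw [key, hD, LinearMap.zero_comp]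
  | succ r ih =>
    rw [mem_orderLE_succ] at hD ⊢
    exact fun g => by rw [key]; exact ih (hD g)

end

namespace OMod

variable {M : ComplexLRS.{u}} {P : OMod.{u, v} M} {Q : OMod.{u, w} M} {U V : Opens M.pt}

/-- Commutators are compatible with restriction and sections of `Q` are determined locally. The
local comparison operator `T'` is arbitrary, which allows the zero operator to be used away from a
support. -/
lemma orderLE_of_locally (hQ : Q.IsLocal) {T : P.sec V →ₗ[ℂ] Q.sec V} {r : ℕ}
    (h : ∀ a ∈ V, ∃ (W : Opens M.pt) (hW : W ≤ V), a ∈ W ∧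
      ∃ T' ∈ orderLE (M.Fun W) (P.sec W) (Q.sec W) r, ∀ s, Q.res hW (T s) = T' (P.res hW s)) :
    T ∈ orderLE (M.Fun V) (P.sec V) (Q.sec V) r := by
  have key {W : Opens M.pt} (hW : W ≤ V) {T : P.sec V →ₗ[ℂ] Q.sec V} {T' : P.sec W →ₗ[ℂ] Q.sec W}
      (hT : ∀ s, Q.res hW (T s) = T' (P.res hW s)) (f : M.Fun V) (s : P.sec V) :
      Q.res hW (commutatorMap f T s) = commutatorMap (M.res hW f) T' (P.res hW s) := by
    simp only [commutatorMap_apply, map_sub, Q.res_smul, hT, P.res_smul]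
  induction r generalizing T with
  | zero =>
    refine mem_orderLE_zero.2 fun f => LinearMap.ext fun s => hQ.ext fun a ha => ?_
    obtain ⟨W, hW, haW, T', hT', hT⟩ := h a ha
    refine ⟨W, hW, haW, ?_⟩
    rw [key hW hT, mem_orderLE_zero.1 hT', LinearMap.zero_apply, LinearMap.zero_apply, map_zero]
  | succ r ih =>
    refine mem_orderLE_succ.2 fun f => ih fun a ha => ?_
    obtain ⟨W, hW, haW, T', hT', hT⟩ := h a ha
    exact ⟨W, hW, haW, _, mem_orderLE_succ.1 hT' _, key hW hT f⟩

lemma supp_apply_subset (D : P.sheafHom Q U) (V : {V : Opens M.pt // V ≤ U}) (s : P.sec V) :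
    Q.supp (D.1 V s) ⊆ suppHom D := by
  intro a ha
  refine ⟨V.2 ha.1, fun W haW => ⟨⟨W.1 ⊓ V.1, inf_le_left.trans W.2⟩, inf_le_left, fun h => ?_⟩⟩
  refine ha.2 (W.1 ⊓ V.1) inf_le_right ⟨haW, ha.1⟩ ?_
  rw [D.2 V ⟨W.1 ⊓ V.1, inf_le_left.trans W.2⟩ inf_le_right, h, LinearMap.zero_apply]

/-- Sheaf homomorphisms do not increase supports. -/
lemma supp_homTop_subset (D : P.sheafHom Q U) (s : P.sec U) : Q.supp (homTop D s) ⊆ P.supp s := by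
  intro a ha
  by_contra has
  obtain ⟨V, hV, haV, hs⟩ := (notMem_supp_iff ha.1).1 has
  refine ha.2 V hV haV ((D.2 ⟨U, le_rfl⟩ ⟨V, hV⟩ hV s).trans ?_)
  rw [hs, map_zero]

lemma sheafHom_ext {D E : P.sheafHom Q U} (h : ∀ V s, D.1 V s = E.1 V s) : D = E :=
  Subtype.ext (funext fun V => LinearMap.ext (h V))

lemma sheafHom_add_apply (D E : P.sheafHom Q U) (V : {V : Opens M.pt // V ≤ U}) (s : P.sec V) :
    (D + E).1 V s = D.1 V s + E.1 V s :=
  rfl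

lemma sheafHom_smul_apply (z : ℂ) (D : P.sheafHom Q U) (V : {V : Opens M.pt // V ≤ U})
    (s : P.sec V) : (z • D).1 V s = z • D.1 V s :=
  rfl

/-- The restriction to `U` of the composition of `D` with the multiplication by `f`. -/
def mulResHom (f : M.Fun ⊤) (U : Opens M.pt) (D : P.sheafHom Q ⊤) : P.sheafHom Q U :=
  ⟨fun V => (D.1 ⟨V.1, le_top⟩).comp (Algebra.lsmul ℂ ℂ (P.sec V) (M.res le_top f)),
    fun V W h s => by
      simp only [LinearMap.comp_apply, Algebra.lsmul_coe]
      rw [D.2 ⟨V.1, le_top⟩ ⟨W.1, le_top⟩ h, P.res_smul, M.res_res]⟩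

lemma mulResHom_apply (f : M.Fun ⊤) (D : P.sheafHom Q ⊤) (V : {V : Opens M.pt // V ≤ U})
    (s : P.sec V) :
    (mulResHom f U D).1 V s = D.1 ⟨V.1, le_top⟩ ((M.res le_top f : M.Fun V.1) • s) :=
  rfl

/-- The map sending `D` to the restriction to `U` of the composition of `D` with the
multiplication by `f`. -/
def mulRes (f : M.Fun ⊤) (U : Opens M.pt) : P.sheafHom Q ⊤ →ₗ[ℂ] P.sheafHom Q U where
  toFun := mulResHom f U
  map_add' D E := sheafHom_ext fun V s => by
    rw [sheafHom_add_apply, mulResHom_apply, mulResHom_apply, mulResHom_apply, sheafHom_add_apply]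
  map_smul' z D := sheafHom_ext fun V s => by
    rw [RingHom.id_apply, sheafHom_smul_apply, mulResHom_apply, mulResHom_apply,
      sheafHom_smul_apply]

/-- The hypothesis says that `s` is a version over `M` of the product `f t`. It covers both uses: `s
= f • u` with `t` the restriction of `u`, and `s` the extension by zero of a product formed over
`U`. -/
lemma homTop_mulRes (f : M.Fun ⊤) (D : P.sheafHom Q ⊤) {s : P.sec ⊤} {t : P.sec U}
    (h : P.res le_top s = M.res (le_top : U ≤ ⊤) f • t) :
    homTop (mulRes f U D) t = Q.res le_top (homTop D s) := by
  refine Eq.trans ?_ (D.2 ⟨⊤, le_rfl⟩ ⟨U, le_top⟩ le_top _).symm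
  rw [h]
  rfl

lemma mulRes_mem_diffOn {f : M.Fun ⊤} {D : P.sheafHom Q ⊤} {W : Opens M.pt} {r : ℕ}
    (hD : D ∈ P.diffOn Q ⊤ W r) : mulRes f U D ∈ P.diffOn Q U W r :=
  fun V hV => comp_lsmul_mem_orderLE (hD ⟨V.1, le_top⟩ hV) _

lemma suppHom_mulRes (f : M.Fun ⊤) (D : P.sheafHom Q ⊤) :
    suppHom (mulRes f U D) ⊆ suppHom D ∩ M.supp f := by
  intro a ha
  refine ⟨⟨trivial, fun V haV => ?_⟩, ?_⟩
  · obtain ⟨W, hW, hne⟩ := ha.2 ⟨V.1 ⊓ U, inf_le_right⟩ ⟨haV, ha.1⟩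
    refine ⟨⟨W.1, le_top⟩, hW.trans inf_le_left, fun h => hne ?_⟩
    change (D.1 ⟨W.1, le_top⟩).comp _ = 0
    rw [h, LinearMap.zero_comp]
  · by_contra haf
    obtain ⟨V, hV, haV, h⟩ := (ComplexLRS.notMem_supp_iff (Opens.mem_top a)).1 haf
    obtain ⟨W, hW, hne⟩ := ha.2 ⟨V ⊓ U, inf_le_right⟩ ⟨haV, ha.1⟩
    refine hne (LinearMap.ext fun s => ?_)
    change D.1 ⟨W.1, le_top⟩ ((M.res le_top f : M.Fun W.1) • s) = 0
    rw [← M.res_res hV (hW.trans inf_le_left), h, map_zero, zero_smul, map_zero]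

/-- A compact subset of `U`, as a compact subset of `M`. -/
def CompactIn.toTop (K : CompactIn U) : CompactIn (⊤ : Opens M.pt) :=
  ⟨K.1, K.2.1, fun _ _ => trivial⟩

/-- The intersection of a compact set with the support of a formal function. -/
def CompactIn.inter (K : CompactIn (⊤ : Opens M.pt)) {f : M.Fun ⊤} (hf : M.supp f ⊆ U) :
    CompactIn U :=
  ⟨K.1 ∩ M.supp f, K.2.1.inter_right (ComplexLRS.isClosed_supp f),
    Set.inter_subset_right.trans hf⟩

lemma mulRes_mem_homSupp {f : M.Fun ⊤} (hf : M.supp f ⊆ U) {K : CompactIn (⊤ : Opens M.pt)}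
    {D : P.sheafHom Q ⊤} (hD : D ∈ P.homSupp Q ⊤ K) :
    mulRes f U D ∈ P.homSupp Q U (K.inter hf) :=
  (suppHom_mulRes f D).trans (Set.inter_subset_inter_left _ hD)

lemma mulRes_mem_diffC {f : M.Fun ⊤} (hf : M.supp f ⊆ U) {D : P.sheafHom Q ⊤}
    (hD : D ∈ P.diffC Q ⊤) : mulRes f U D ∈ P.diffC Q U := by
  obtain ⟨hD, K, hK⟩ := hD
  refine ⟨fun a _ => ?_, K.inter hf, mulRes_mem_homSupp hf hK⟩
  obtain ⟨W, r, haW, h⟩ := hD a trivial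
  exact ⟨W, r, haW, mulRes_mem_diffOn h⟩

lemma mulRes_mem_diffKr {f : M.Fun ⊤} (hf : M.supp f ⊆ U) {K : CompactIn (⊤ : Opens M.pt)} {r : ℕ}
    {D : P.sheafHom Q ⊤} (hD : D ∈ P.diffKr Q ⊤ K r) :
    mulRes f U D ∈ P.diffKr Q U (K.inter hf) r :=
  ⟨mulRes_mem_homSupp hf hD.1, mulRes_mem_diffOn (P.diffOn_mono Q ⊤ le_top le_rfl hD.2)⟩

lemma IsLocal.ext_of_res_inf (hQ : Q.IsLocal) {K : CompactIn U} {t t' : Q.sec V}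
    (ht : Q.supp t ⊆ K) (ht' : Q.supp t' ⊆ K)
    (h : Q.res (inf_le_left : V ⊓ U ≤ V) t = Q.res inf_le_left t') : t = t' :=
  hQ.ext_of_supp inf_le_left (K := K.1 ∩ V) (fun _ ha => ⟨ha.2, K.2.2 ha.1⟩)
    (Set.subset_inter ht (Q.supp_subset t)) (Set.subset_inter ht' (Q.supp_subset t')) h

variable [T2Space M.pt]

/-- The operator is applied on `V ⊓ U`. The result is supported in `K`, closed because `M` is
Hausdorff, and so extends by zero to `V`. The support condition makes the extension unique, which
gives linearity and compatibility with restriction below. -/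
lemma exists_extHom (hQ : Q.IsLocal) {K : CompactIn U} {D : P.sheafHom Q U}
    (hD : D ∈ P.homSupp Q U K) (V : Opens M.pt) (s : P.sec V) :
    ∃ t : Q.sec V, Q.res inf_le_left t = D.1 ⟨V ⊓ U, inf_le_right⟩ (P.res inf_le_left s) ∧
      Q.supp t ⊆ K := by
  have h := (supp_apply_subset D ⟨V ⊓ U, inf_le_right⟩ (P.res inf_le_left s)).trans hD
  obtain ⟨t, ht, ht'⟩ := hQ.exists_extension (inf_le_left : V ⊓ U ≤ V) _ K.2.1.isClosed
    (fun a ha => ⟨ha.2, K.2.2 ha.1⟩) h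
  exact ⟨t, ht, ht'.trans h⟩

/-- The value on a section over `V` of the extension by zero of a sheaf homomorphism. -/
def extVal (hQ : Q.IsLocal) {K : CompactIn U} (D : P.homSupp Q U K) (V : Opens M.pt)
    (s : P.sec V) : Q.sec V :=
  (exists_extHom hQ D.2 V s).choose

lemma res_extVal (hQ : Q.IsLocal) {K : CompactIn U} (D : P.homSupp Q U K) (V : Opens M.pt)
    (s : P.sec V) : Q.res inf_le_left (extVal hQ D V s) =
      D.1.1 ⟨V ⊓ U, inf_le_right⟩ (P.res inf_le_left s) :=
  (exists_extHom hQ D.2 V s).choose_spec.1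

lemma extVal_mem (hQ : Q.IsLocal) {K : CompactIn U} (D : P.homSupp Q U K) (V : Opens M.pt)
    (s : P.sec V) : extVal hQ D V s ∈ Q.secSupp V K :=
  (exists_extHom hQ D.2 V s).choose_spec.2

lemma extVal_eq (hQ : Q.IsLocal) {K : CompactIn U} (D : P.homSupp Q U K) {V : Opens M.pt}
    {s : P.sec V} {t : Q.sec V} (ht : t ∈ Q.secSupp V K) (h : Q.res inf_le_left t =
      D.1.1 ⟨V ⊓ U, inf_le_right⟩ (P.res inf_le_left s)) : extVal hQ D V s = t :=
  hQ.ext_of_res_inf (extVal_mem hQ D V s) ht ((res_extVal hQ D V s).trans h.symm)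

/-- The extension by zero of a sheaf homomorphism. -/
def extZero (hQ : Q.IsLocal) {K : CompactIn U} (D : P.homSupp Q U K) : P.sheafHom Q ⊤ :=
  ⟨fun V =>
    { toFun := extVal hQ D V.1
      map_add' := fun s t => extVal_eq hQ D
        (Submodule.add_mem _ (extVal_mem hQ D _ s) (extVal_mem hQ D _ t))
        (by simp only [map_add, res_extVal])
      map_smul' := fun z s => extVal_eq hQ D (Submodule.smul_mem _ z (extVal_mem hQ D _ s))
        (by simp only [map_smul, res_extVal, RingHom.id_apply]) },
    -- Both sides are supported in `K`, so it is enough to compare them on `W ⊓ U`, where both are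
    -- given by `D`.
    fun V W h s => Eq.symm <| extVal_eq hQ D
      ((supp_res_subset h _).trans (extVal_mem hQ D V.1 s)) (by
        have h1 := congrArg (Q.res (inf_le_inf_right U h)) (res_extVal hQ D V.1 s)
        rw [Q.res_res, D.1.2 ⟨V.1 ⊓ U, inf_le_right⟩ ⟨W.1 ⊓ U, inf_le_right⟩
          (inf_le_inf_right U h), P.res_res] at h1
        refine (Q.res_res _ _ _).trans (h1.trans ?_)
        rw [P.res_res])⟩

lemma extZero_apply (hQ : Q.IsLocal) {K : CompactIn U} (D : P.homSupp Q U K)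
    (V : {V : Opens M.pt // V ≤ ⊤}) (s : P.sec V) : (extZero hQ D).1 V s = extVal hQ D V.1 s :=
  rfl

/-- Extension by zero of sheaf homomorphisms, as a linear map. -/
def extHom (hQ : Q.IsLocal) (K : CompactIn U) : P.homSupp Q U K →ₗ[ℂ] P.sheafHom Q ⊤ where
  toFun := extZero hQ
  map_add' D E := sheafHom_ext fun V s => by
    rw [sheafHom_add_apply, extZero_apply, extZero_apply, extZero_apply]
    refine extVal_eq hQ (D + E)
      (Submodule.add_mem _ (extVal_mem hQ D V.1 s) (extVal_mem hQ E V.1 s)) ?_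
    rw [map_add, res_extVal, res_extVal, Submodule.coe_add, sheafHom_add_apply]
  map_smul' z D := sheafHom_ext fun V s => by
    rw [RingHom.id_apply, sheafHom_smul_apply, extZero_apply, extZero_apply]
    refine extVal_eq hQ (z • D) (Submodule.smul_mem _ z (extVal_mem hQ D V.1 s)) ?_
    rw [map_smul, res_extVal, Submodule.coe_smul, sheafHom_smul_apply]

section
variable (hQ : Q.IsLocal) {K : CompactIn U} (D : P.homSupp Q U K)

lemma supp_extHom_apply (V : {V : Opens M.pt // V ≤ ⊤}) (s : P.sec V) :
    Q.supp ((extHom hQ K D).1 V s) ⊆ K :=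
  extVal_mem hQ D V.1 s

lemma res_extHom (V : {V : Opens M.pt // V ≤ ⊤}) (W : {V : Opens M.pt // V ≤ U}) (h : W.1 ≤ V.1)
    (s : P.sec V) : Q.res h ((extHom hQ K D).1 V s) = D.1.1 W (P.res h s) := by
  have h1 := congrArg (Q.res (le_inf h W.2)) (res_extVal hQ D V.1 s)
  rw [Q.res_res, D.1.2 ⟨V.1 ⊓ U, inf_le_right⟩ W (le_inf h W.2), P.res_res] at h1
  exact h1

lemma res_homTop_extHom (s : P.sec ⊤) :
    Q.res (le_top : U ≤ ⊤) (homTop (extHom hQ K D) s) = homTop D.1 (P.res le_top s) :=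
  res_extHom hQ D ⟨⊤, le_rfl⟩ ⟨U, le_rfl⟩ le_top s

lemma supp_homTop_extHom (s : P.sec ⊤) : Q.supp (homTop (extHom hQ K D) s) ⊆ K :=
  supp_extHom_apply hQ D ⟨⊤, le_rfl⟩ s

lemma extHom_mem_homSupp : extHom hQ K D ∈ P.homSupp Q ⊤ K.toTop := by
  intro a ha
  by_contra haK
  obtain ⟨W, hW, hne⟩ := ha.2 ⟨⟨K.1ᶜ, K.2.1.isClosed.isOpen_compl⟩, le_top⟩ haK
  exact hne (LinearMap.ext fun s => hQ.eq_zero_of_supp fun b hb =>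
    hW hb.1 (supp_extHom_apply hQ D W s hb))

/-- An order bound is needed only near points of `K`; elsewhere the extended operator is locally
zero. -/
lemma extHom_mem_orderLE {V : Opens M.pt} {r : ℕ}
    (h : ∀ a ∈ V, a ∈ K.1 → ∃ W : Opens M.pt, a ∈ W ∧ D.1 ∈ P.diffOn Q U W r) :
    (extHom hQ K D).1 ⟨V, le_top⟩ ∈ orderLE (M.Fun V) (P.sec V) (Q.sec V) r := by
  refine orderLE_of_locally hQ fun a ha => ?_
  by_cases haK : a ∈ K.1
  · obtain ⟨W, haW, hW⟩ := h a ha haK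
    have hle : V ⊓ (W ⊓ U) ≤ U := inf_le_right.trans inf_le_right
    exact ⟨V ⊓ (W ⊓ U), inf_le_left, ⟨ha, haW, K.2.2 haK⟩, D.1.1 ⟨_, hle⟩,
      hW ⟨_, hle⟩ (inf_le_right.trans inf_le_left),
      fun s => res_extHom hQ D ⟨V, le_top⟩ ⟨_, hle⟩ inf_le_left s⟩
  · refine ⟨V ⊓ ⟨K.1ᶜ, K.2.1.isClosed.isOpen_compl⟩, inf_le_left, ⟨ha, haK⟩, 0,
      Submodule.zero_mem _, fun s => ?_⟩
    exact hQ.res_eq_zero _ (Set.disjoint_left.2 fun b hb hb' =>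
      hb.2 (supp_extHom_apply hQ D ⟨V, le_top⟩ s hb'))

lemma extHom_mem_diffKr {r : ℕ} (hD : D.1 ∈ P.diffLE Q U r) :
    extHom hQ K D ∈ P.diffKr Q ⊤ K.toTop r :=
  ⟨extHom_mem_homSupp hQ D, fun _ _ => extHom_mem_orderLE hQ D fun _ _ haK => ⟨U, K.2.2 haK, hD⟩⟩

lemma extHom_mem_diffC (hD : D.1 ∈ P.diff Q U) : extHom hQ K D ∈ P.diffC Q ⊤ := by
  refine ⟨fun a _ => ?_, K.toTop, extHom_mem_homSupp hQ D⟩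
  by_cases haK : a ∈ K.1
  · obtain ⟨W, r, haW, h⟩ := hD a (K.2.2 haK)
    exact ⟨W, r, haW, fun V hV => extHom_mem_orderLE hQ D fun b hb _ => ⟨W, hV hb, h⟩⟩
  · exact ⟨⟨K.1ᶜ, K.2.1.isClosed.isOpen_compl⟩, 0, haK,
      fun V hV => extHom_mem_orderLE hQ D fun b hb hbK => (hV hb hbK).elim⟩

end

end OMod

/-! ### Locally convex inductive limits and direct sums -/

section
variable {ι : Type*} {V : Type*} [AddCommGroup V] [Module ℂ V] {E : ι → Type*}
  [∀ i, AddCommGroup (E i)] [∀ i, Module ℂ (E i)] (t : ∀ i, TopologicalSpace (E i))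
  (f : ∀ i, E i →ₗ[ℂ] V)

lemma isTopologicalAddGroup_lcFinal : @IsTopologicalAddGroup V (lcFinal t f) _ :=
  topologicalAddGroup_sInf fun _ h => h.1

lemma continuousSMul_lcFinal : @ContinuousSMul ℂ V _ _ (lcFinal t f) :=
  continuousSMul_sInf fun _ h => h.2.1

lemma locallyConvexSpace_lcFinal : @LocallyConvexSpace ℝ V _ _ _ _ (lcFinal t f) :=
  .sInf fun _ h => h.2.2.1

lemma continuous_lcFinal_rng (i : ι) : @Continuous _ _ (t i) (lcFinal t f) (f i) :=
  continuous_sInf_rng.2 fun _ h => h.2.2.2 i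

/-- The topology pulled back along `g` is itself one of the locally convex topologies whose infimum
defines `lcFinal`. -/
lemma continuous_lcFinal_dom {W : Type*} [AddCommGroup W] [Module ℂ W] [TopologicalSpace W]
    [IsTopologicalAddGroup W] [ContinuousSMul ℂ W] [LocallyConvexSpace ℝ W] (g : V →ₗ[ℂ] W)
    (h : ∀ i, @Continuous _ _ (t i) _ (g ∘ₗ f i)) : @Continuous _ _ (lcFinal t f) _ g := by
  rw [continuous_iff_le_induced]
  refine sInf_le ⟨topologicalAddGroup_induced g, continuousSMul_induced g,
    LocallyConvexSpace.induced (g.restrictScalars ℝ), fun i => ?_⟩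
  exact continuous_induced_rng.2 (h i)

end

section
variable {Γ : Type*} {E : Γ → Type*} [∀ i, AddCommGroup (E i)] [∀ i, Module ℂ (E i)]

/-- The chosen finite set varies with the vector in no linear way, but the coordinates do not depend
on it, so linearity can be checked coordinatewise. -/
lemma exists_directSum_lift {C : Type*} [AddCommGroup C] [Module ℂ C] {m : ∀ α, C →ₗ[ℂ] E α}
    (hm : ∀ x, ∃ A : Finset Γ, ∀ α ∉ A, m α x = 0) :
    ∃ S : C →ₗ[ℂ] ⨁ α, E α, ∀ x α, S x α = m α x := by
  classical
  choose A hA using hm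
  have h (x : C) (α : Γ) : DirectSum.mk E (A x) (fun α => m α x) α = m α x := by
    by_cases hα : α ∈ A x
    · exact DirectSum.mk_apply_of_mem hα
    · rw [DirectSum.mk_apply_of_notMem hα, hA x α hα]
  refine ⟨{ toFun := fun x => DirectSum.mk E (A x) (fun α => m α x),
            map_add' := fun x y => ?_, map_smul' := fun z x => ?_ }, h⟩
  · refine DFinsupp.ext fun α => ?_
    rw [DirectSum.add_apply, h, h, h, map_add]
  · refine DFinsupp.ext fun α => ?_
    rw [DirectSum.smul_apply, h, h, map_smul, RingHom.id_apply]

lemma eq_sum_lof [DecidableEq Γ] (x : ⨁ α, E α) (A : Finset Γ) (hA : ∀ α ∉ A, x α = 0) :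
    x = ∑ α ∈ A, DirectSum.lof ℂ Γ E α (x α) := by
  refine DFinsupp.ext fun β => ?_
  rw [DFinsupp.finsetSum_apply]
  by_cases hβ : β ∈ A
  · rw [Finset.sum_eq_single_of_mem β hβ fun α _ hne => DirectSum.of_eq_of_ne _ _ _ hne.symm]
    exact (DirectSum.of_eq_same β _).symm
  · rw [Finset.sum_eq_zero fun α hα => DirectSum.of_eq_of_ne _ _ _
      (by rintro rfl; exact hβ hα), hA β hβ]

variable [∀ i, TopologicalSpace (E i)]

instance : IsTopologicalAddGroup (⨁ i, E i) := isTopologicalAddGroup_lcFinal _ _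

instance : ContinuousSMul ℂ (⨁ i, E i) := continuousSMul_lcFinal _ _

instance : LocallyConvexSpace ℝ (⨁ i, E i) := locallyConvexSpace_lcFinal _ _

lemma continuous_lof [dec : DecidableEq Γ] (α : Γ) : Continuous (DirectSum.lof ℂ Γ E α) := by
  classical
  -- The topology on the direct sum was defined with classical decidable equality; the given
  -- instance is identified with it.
  obtain rfl : dec = fun a b => Classical.propDecidable (a = b) := Subsingleton.elim _ _
  exact continuous_lcFinal_rng (fun _ => inferInstance) (fun i => DirectSum.lof ℂ Γ E i) α

variable {C : Type*} [AddCommGroup C] [Module ℂ C] [TopologicalSpace C]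

/-- The continuous linear map on a direct sum given by continuous linear maps on the summands. -/
def directSumDesc [dec : DecidableEq Γ] [IsTopologicalAddGroup C] [ContinuousSMul ℂ C]
    [LocallyConvexSpace ℝ C] (e : ∀ α, E α →L[ℂ] C) : (⨁ α, E α) →L[ℂ] C where
  toLinearMap := DirectSum.toModule ℂ Γ C fun α => (e α).toLinearMap
  cont := by
    classical
    obtain rfl : dec = fun a b => Classical.propDecidable (a = b) := Subsingleton.elim _ _
    exact continuous_lcFinal_dom _ _ _ fun α => (e α).continuous.congr fun x =>
      (DirectSum.toModule_lof ℂ (φ := fun α => (e α).toLinearMap) α x).symm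

lemma directSumDesc_lof [DecidableEq Γ] [IsTopologicalAddGroup C] [ContinuousSMul ℂ C]
    [LocallyConvexSpace ℝ C] (e : ∀ α, E α →L[ℂ] C) (α : Γ) (x : E α) :
    directSumDesc e (DirectSum.lof ℂ Γ E α x) = e α x :=
  DirectSum.toModule_lof ℂ _ _

/-- A right inverse of a map from a direct sum to an inductive limit, given by a family of maps
which is finite on each step of the limit. -/
lemma exists_directSumDesc_rightInverse [DecidableEq Γ] [IsTopologicalAddGroup C]
    [ContinuousSMul ℂ C] [LocallyConvexSpace ℝ C] (e : ∀ α, E α →L[ℂ] C) {ι : Type*} {X : ι → Type*}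
    [∀ i, AddCommGroup (X i)] [∀ i, Module ℂ (X i)] (t : ∀ i, TopologicalSpace (X i))
    (f : ∀ i, X i →ₗ[ℂ] C) (hC : ‹TopologicalSpace C› = lcFinal t f)
    (m : ∀ α, C →ₗ[ℂ] E α)
    (hm : ∀ i α, @Continuous _ _ (t i) _ (m α ∘ₗ f i))
    (hfin : ∀ i, ∃ A : Finset Γ, ∀ α ∉ A, ∀ y, m α (f i y) = 0)
    (hsum : ∀ x, ∃ A : Finset Γ, (∀ α ∉ A, m α x = 0) ∧ ∑ α ∈ A, e α (m α x) = x) :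
    ∃ S : C →L[ℂ] ⨁ α, E α,
      (directSumDesc e).comp S = ContinuousLinearMap.id ℂ C ∧ ∀ x α, S x α = m α x := by
  obtain ⟨S, hS⟩ := exists_directSum_lift (m := m) fun x => by
    obtain ⟨A, hA, -⟩ := hsum x
    exact ⟨A, hA⟩
  have hcont : Continuous S := by
    rw [hC]
    refine continuous_lcFinal_dom t f S fun i => ?_
    obtain ⟨A, hA⟩ := hfin i
    -- Here the finite set must serve the whole step `X i` at once: the restriction of `S` is then a
    -- finite sum of continuous maps. Finiteness at each single vector would give only the linear
    -- map.
    have h : (S ∘ₗ f i : X i → ⨁ α, E α) =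
        fun y => ∑ α ∈ A, DirectSum.lof ℂ Γ E α ((m α ∘ₗ f i) y) := by
      funext y
      rw [LinearMap.comp_apply, eq_sum_lof (S (f i y)) A fun α hα => by rw [hS, hA α hα]]
      simp only [hS, LinearMap.comp_apply]
    rw [h]
    let _ := t i
    exact continuous_finsetSum _ fun α _ => (continuous_lof α).comp (hm i α)
  refine ⟨⟨S, hcont⟩, ?_, hS⟩
  ext x
  obtain ⟨A, hA, hx⟩ := hsum x
  change directSumDesc e (S x) = x
  rw [eq_sum_lof (S x) A fun α hα => by rw [hS, hA α hα], map_sum]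
  simp only [directSumDesc_lof, hS, hx]

/-- Through each `x` passes the continuous section `y ↦ x + S (y - Φ x)`. -/
lemma isOpenMap_of_rightInverse {X : Type*} [AddCommGroup X] [Module ℂ X] [TopologicalSpace X]
    [IsTopologicalAddGroup X] [IsTopologicalAddGroup C] (Φ : X →L[ℂ] C) (S : C →L[ℂ] X)
    (h : Φ.comp S = ContinuousLinearMap.id ℂ C) : IsOpenMap Φ := by
  have hS (y : C) : Φ (S y) = y := DFunLike.congr_fun h y
  refine IsOpenMap.of_sections fun x => ⟨fun y => x + S (y - Φ x), ?_, by simp, fun y => ?_⟩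
  · fun_prop
  · simp [hS]

end

/-- A linear map is continuous if the seminorms defining the topology of the target are
bounded by those defining the topology of the source. -/
lemma continuous_of_seminorm_le {X X' Y Y' ι κ : Type*} [AddCommGroup X] [Module ℂ X]
    [AddCommGroup X'] [Module ℂ X'] [AddCommGroup Y] [Module ℂ Y] [AddCommGroup Y'] [Module ℂ Y']
    [Nonempty ι] [Nonempty κ]
    (p : SeminormFamily ℂ X ι) (q : SeminormFamily ℂ Y κ) (a : X' →ₗ[ℂ] X) (b : Y' →ₗ[ℂ] Y)
    (T : X' →ₗ[ℂ] Y') (h : ∀ j, ∃ i, ∀ x, q j (b (T x)) ≤ p i (a x)) :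
    @Continuous _ _ (TopologicalSpace.induced a p.moduleFilterBasis.topology)
      (TopologicalSpace.induced b q.moduleFilterBasis.topology) T := by
  let _ : TopologicalSpace X := p.moduleFilterBasis.topology
  let _ : TopologicalSpace Y := q.moduleFilterBasis.topology
  have hp : WithSeminorms p := ⟨rfl⟩
  have hq : WithSeminorms q := ⟨rfl⟩
  let _ : TopologicalSpace X' := TopologicalSpace.induced a inferInstance
  let _ : TopologicalSpace Y' := TopologicalSpace.induced b inferInstance
  refine (LinearMap.withSeminorms_induced hp a).continuous_of_isBounded
    (LinearMap.withSeminorms_induced hq b) T fun j => ?_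
  obtain ⟨i, hi⟩ := h j
  refine ⟨{i}, 1, fun x => ?_⟩
  rw [Finset.sup_singleton, one_smul]
  exact hi x

/-! ### Compactly supported sections -/

namespace OMod

section
variable {M : ComplexLRS.{u}} {P : OMod.{u, v} M} {U : Opens M.pt}

lemma IsExtSec.supp_subset {s : P.CSec U} {t : P.CSec ⊤} (h : IsExtSec s t) :
    P.supp t.1 ⊆ U :=
  h.2.trans (P.supp_subset _)

/-- The competitor need only be supported in `U`, not in the support of `s`. This weaker condition
is additive, which makes the chosen extensions linear. -/
lemma IsExtSec.eq (hP : P.IsLocal) {s : P.CSec U} {t t' : P.CSec ⊤} (h : IsExtSec s t)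
    (hres : P.res le_top t'.1 = s.1) (hsupp : P.supp t'.1 ⊆ U) : t = t' :=
  Subtype.ext (hP.ext_of_supp le_top subset_rfl h.supp_subset hsupp (h.1.trans hres.symm))

lemma supp_res_smul_subset {f : M.Fun ⊤} (hf : M.supp f ⊆ U) {K : CompactIn (⊤ : Opens M.pt)}
    {s : P.sec ⊤} (hs : P.supp s ⊆ K) :
    P.supp (P.res (le_top : U ≤ ⊤) (f • s)) ⊆ K.inter hf :=
  (supp_res_subset le_top _).trans (Set.subset_inter
    ((supp_smul_subset_right f s).trans hs) (supp_smul_subset_left f s))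

end

variable {M : ComplexLRS.{u}} [IsFormalManifold M]

section
variable (P : OMod.{u, v} M) (U : Opens M.pt)

instance : IsTopologicalAddGroup (P.CSec U) := isTopologicalAddGroup_lcFinal _ _

instance : ContinuousSMul ℂ (P.CSec U) := continuousSMul_lcFinal _ _

instance : LocallyConvexSpace ℝ (P.CSec U) := locallyConvexSpace_lcFinal _ _

end

variable {P : OMod.{u, v} M} {Q : OMod.{u, w} M} {U V : Opens M.pt}

lemma smoothSeminorm_mulRes (f : M.Fun ⊤) (D : P.diffC M.redMod ⊤)
    {D' : P.diffC M.redMod ⊤} (hD' : D'.1 = mulRes f ⊤ D.1) (s : P.sec ⊤) :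
    P.smoothSeminorm ⊤ D' s = P.smoothSeminorm ⊤ D (f • s) := by
  refine ComplexLRS.smoothSeminorm_congr _ _ _ _ ?_
  rw [hD', homTop_mulRes f D.1 (s := f • s) (by rw [P.res_smul, P.res_self]), M.redMod.res_self]

/-- Restricting `D` alone to `U` may destroy compactness of its support. Composing with a function
supported in `U` repairs this and changes nothing on sections on which that function acts as the
identity. -/
lemma smoothSeminorm_mulRes_res {f : M.Fun ⊤} (D : P.diffC M.redMod ⊤) {D' : P.diffC M.redMod U}
    (hD' : D'.1 = mulRes f U D.1) {s : P.sec ⊤} (hs : P.supp s ⊆ U) (hfs : f • s = s) :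
    P.smoothSeminorm U D' (P.res le_top s) = P.smoothSeminorm ⊤ D s := by
  refine ComplexLRS.smoothSeminorm_congr _ _ _ _ ?_
  rw [hD', homTop_mulRes f D.1 (s := f • s) (P.res_smul le_top f s), hfs]
  exact ComplexLRS.redVal_res_of_supp le_top ((supp_homTop_subset D.1 s).trans hs)

/-- Values of the extended operator are supported in `K ⊆ U` and restrict to those of `D`, so as
functions on `M` the two coincide. -/
lemma smoothSeminorm_extHom {K : CompactIn U} (D : P.diffC M.redMod U)
    (hK : D.1 ∈ P.homSupp M.redMod U K) {D' : P.diffC M.redMod ⊤}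
    (hD' : D'.1 = extHom ComplexLRS.isLocal_redMod K ⟨D.1, hK⟩) (s : P.sec ⊤) :
    P.smoothSeminorm U D (P.res le_top s) = P.smoothSeminorm ⊤ D' s := by
  refine ComplexLRS.smoothSeminorm_congr _ _ _ _ ?_
  rw [hD', ← res_homTop_extHom ComplexLRS.isLocal_redMod ⟨D.1, hK⟩ s]
  exact ComplexLRS.redVal_res_of_supp le_top
    ((supp_homTop_extHom ComplexLRS.isLocal_redMod ⟨D.1, hK⟩ s).trans K.2.2)

lemma exists_smoothSeminorm_smul (f : M.Fun ⊤) (D : P.diffC M.redMod ⊤) :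
    ∃ D' : P.diffC M.redMod ⊤, ∀ s, P.smoothSeminorm ⊤ D (f • s) = P.smoothSeminorm ⊤ D' s :=
  ⟨⟨_, mulRes_mem_diffC (Set.subset_univ _) D.2⟩,
    fun s => (smoothSeminorm_mulRes f D rfl s).symm⟩

lemma exists_smoothSeminorm_res (D : P.diffC M.redMod U) :
    ∃ D' : P.diffC M.redMod ⊤, ∀ s,
      P.smoothSeminorm U D (P.res le_top s) = P.smoothSeminorm ⊤ D' s := by
  obtain ⟨K, hK⟩ := D.2.2
  exact ⟨⟨_, extHom_mem_diffC ComplexLRS.isLocal_redMod ⟨D.1, hK⟩ D.2.1⟩,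
    smoothSeminorm_extHom D hK rfl⟩

/-- The operator over `U` is `D` composed with a cutoff equal to one near `K`. It depends on `K`,
hence the passage through the steps of the inductive limit. -/
lemma exists_smoothSeminorm_of_supp (hP : P.IsLocal) (K : CompactIn U) (D : P.diffC M.redMod ⊤) :
    ∃ D' : P.diffC M.redMod U, ∀ s : P.sec ⊤, P.supp s ⊆ K →
      P.smoothSeminorm ⊤ D s = P.smoothSeminorm U D' (P.res le_top s) := by
  obtain ⟨g, -, hgU, hg⟩ := ComplexLRS.exists_cutoff K.2.1 K.2.2
  exact ⟨⟨_, mulRes_mem_diffC hgU D.2⟩, fun s hs => (smoothSeminorm_mulRes_res D rfl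
    (hs.trans K.2.2) (hP.smul_eq_self (hg.mono_right hs))).symm⟩

/-- A linear map out of the compactly supported sections is continuous if it is so on the
sections supported in any given compact set. -/
lemma continuous_CSec_dom {W : Type*} [AddCommGroup W] [Module ℂ W] [TopologicalSpace W]
    [IsTopologicalAddGroup W] [ContinuousSMul ℂ W] [LocallyConvexSpace ℝ W] (T : P.CSec U →ₗ[ℂ] W)
    (h : ∀ K : CompactIn U, @Continuous _ _ (TopologicalSpace.induced (P.secSupp U K).subtype
      (P.smoothTopology U)) _ (T ∘ₗ P.secSuppIncl U K)) : Continuous T :=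
  continuous_lcFinal_dom _ _ T h

lemma continuous_secSuppIncl (K : CompactIn U) :
    @Continuous _ _ (TopologicalSpace.induced (P.secSupp U K).subtype (P.smoothTopology U)) _
      (P.secSuppIncl U K) :=
  continuous_lcFinal_rng (fun K : CompactIn U => TopologicalSpace.induced
    (P.secSupp U K).subtype (P.smoothTopology U)) (fun K => P.secSuppIncl U K) K

/-- The map sends each step of the source limit into one step of the target limit, and there each
defining seminorm is dominated by a single one of the source. -/
lemma continuous_of_smoothSeminorm (T : P.CSec U →ₗ[ℂ] Q.CSec V)
    (hT : ∀ K : CompactIn U, ∃ L : CompactIn V,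
      (∀ s : P.CSec U, P.supp s.1 ⊆ K → Q.supp (T s).1 ⊆ L) ∧
      ∀ D : Q.diffC M.redMod V, ∃ D' : P.diffC M.redMod U, ∀ s : P.CSec U, P.supp s.1 ⊆ K →
        Q.smoothSeminorm V D (T s).1 ≤ P.smoothSeminorm U D' s.1) : Continuous T := by
  refine continuous_CSec_dom T fun K => ?_
  obtain ⟨L, hL, h⟩ := hT K
  let T' : P.secSupp U K →ₗ[ℂ] Q.secSupp V L :=
    ((Q.secC V).subtype ∘ₗ T ∘ₗ P.secSuppIncl U K).codRestrict _ fun s => hL _ s.2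
  have h1 := continuous_of_seminorm_le (P.smoothSeminorm U) (Q.smoothSeminorm V)
    (P.secSupp U K).subtype (Q.secSupp V L).subtype T' fun D => by
      obtain ⟨D', hD'⟩ := h D
      exact ⟨D', fun s => hD' (P.secSuppIncl U K s) s.2⟩
  let _ : TopologicalSpace (P.secSupp U K) :=
    TopologicalSpace.induced (P.secSupp U K).subtype (P.smoothTopology U)
  let _ : TopologicalSpace (Q.secSupp V L) :=
    TopologicalSpace.induced (Q.secSupp V L).subtype (Q.smoothTopology V)
  exact (continuous_secSuppIncl L).comp h1

lemma exists_isExtSec (hP : P.IsLocal) (s : P.CSec U) : ∃ t : P.CSec ⊤, IsExtSec s t := by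
  obtain ⟨K, hK⟩ := s.2
  obtain ⟨t, ht, hts⟩ := hP.exists_extension le_top s.1 K.2.1.isClosed
    (Set.inter_subset_left.trans K.2.2) hK
  exact ⟨⟨t, K.toTop, hts.trans hK⟩, ht, hts⟩

lemma isExtSec_iff (hP : P.IsLocal) {s : P.CSec U} {t : P.CSec ⊤} :
    IsExtSec s t ↔ P.res le_top t.1 = s.1 ∧ P.supp t.1 ⊆ U := by
  refine ⟨fun h => ⟨h.1, h.supp_subset⟩, fun h => ?_⟩
  obtain ⟨t', ht'⟩ := exists_isExtSec hP s
  rwa [← ht'.eq hP h.1 h.2]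

/-- Extension by zero of compactly supported sections, as a linear map. -/
def extSecLin (hP : P.IsLocal) (U : Opens M.pt) : P.CSec U →ₗ[ℂ] P.CSec ⊤ :=
  have h := fun s : P.CSec U => (exists_isExtSec hP s).choose_spec
  { toFun := fun s => (exists_isExtSec hP s).choose
    map_add' := fun s t => (h _).eq hP
      ((map_add (P.res le_top) _ _).trans (congrArg₂ _ (h s).1 (h t).1))
      (Submodule.add_mem (P.secSupp ⊤ U) (h s).supp_subset (h t).supp_subset)
    map_smul' := fun _ s => (h _).eq hP
      ((map_smul (P.res le_top) _ _).trans (congrArg _ (h s).1))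
      (Submodule.smul_mem (P.secSupp ⊤ U) _ (h s).supp_subset) }

lemma isExtSec_extSecLin (hP : P.IsLocal) (s : P.CSec U) : IsExtSec s (extSecLin hP U s) :=
  (exists_isExtSec hP s).choose_spec

/-- Extension by zero of compactly supported sections. -/
def extSec (hP : P.IsLocal) (U : Opens M.pt) : P.CSec U →L[ℂ] P.CSec ⊤ where
  toLinearMap := extSecLin hP U
  cont := by
    refine continuous_of_smoothSeminorm _ fun K =>
      ⟨K.toTop, fun s hs => (isExtSec_extSecLin hP s).2.trans hs, fun D => ?_⟩
    obtain ⟨D', hD'⟩ := exists_smoothSeminorm_of_supp hP K D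
    refine ⟨D', fun s hs => ?_⟩
    rw [← (isExtSec_extSecLin hP s).1]
    exact (hD' _ ((isExtSec_extSecLin hP s).2.trans hs)).le

lemma isExtSec_extSec (hP : P.IsLocal) (s : P.CSec U) : IsExtSec s (extSec hP U s) :=
  isExtSec_extSecLin hP s

lemma isExtSec_iff_extSec_eq (hP : P.IsLocal) {s : P.CSec U} {t : P.CSec ⊤} :
    IsExtSec s t ↔ extSec hP U s = t :=
  ⟨fun h => (isExtSec_extSec hP s).eq hP h.1 h.supp_subset, fun h => h ▸ isExtSec_extSec hP s⟩

/-- Multiplication of compactly supported sections by a formal function, as a linear map. -/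
def fmulLin (f : M.Fun ⊤) : P.CSec ⊤ →ₗ[ℂ] P.CSec ⊤ where
  toFun := P.fmul f
  map_add' s t := Subtype.ext (smul_add f s.1 t.1)
  map_smul' z s := Subtype.ext (smul_comm f z s.1)

/-- Multiplication of compactly supported sections by a formal function. -/
def fmulCLM (f : M.Fun ⊤) : P.CSec ⊤ →L[ℂ] P.CSec ⊤ where
  toLinearMap := fmulLin f
  cont := by
    refine continuous_of_smoothSeminorm _ fun K =>
      ⟨K, fun s hs => (supp_smul_subset_right f s.1).trans hs, fun D => ?_⟩
    obtain ⟨D', hD'⟩ := exists_smoothSeminorm_smul f D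
    exact ⟨D', fun s _ => (hD' s.1).le⟩

/-- Multiplication of compactly supported sections by a formal function supported in `U`,
followed by the restriction to `U`, as a linear map. -/
def mulSecLin {f : M.Fun ⊤} (hf : M.supp f ⊆ U) : P.CSec ⊤ →ₗ[ℂ] P.CSec U where
  toFun s := ⟨P.res le_top (f • s.1), by
    obtain ⟨K, hK⟩ := s.2
    exact ⟨K.inter hf, supp_res_smul_subset hf hK⟩⟩
  map_add' s t := Subtype.ext
    ((congrArg (P.res le_top) (smul_add f s.1 t.1)).trans (map_add _ _ _))
  map_smul' z s := Subtype.ext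
    ((congrArg (P.res le_top) (smul_comm f z s.1)).trans (map_smul _ _ _))

/-- Multiplication of compactly supported sections by a formal function supported in `U`,
followed by the restriction to `U`. -/
def mulSec {f : M.Fun ⊤} (hf : M.supp f ⊆ U) : P.CSec ⊤ →L[ℂ] P.CSec U where
  toLinearMap := mulSecLin hf
  cont := by
    refine continuous_of_smoothSeminorm _ fun K =>
      ⟨K.inter hf, fun s hs => supp_res_smul_subset hf hs, fun D => ?_⟩
    obtain ⟨D₁, h₁⟩ := exists_smoothSeminorm_res D
    obtain ⟨D₂, h₂⟩ := exists_smoothSeminorm_smul f D₁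
    exact ⟨D₂, fun s _ => ((h₁ _).trans (h₂ s.1)).le⟩

lemma mulSec_val {f : M.Fun ⊤} (hf : M.supp f ⊆ U) (s : P.CSec ⊤) :
    (mulSec hf s).1 = P.res le_top (f • s.1) :=
  rfl

/-- Nothing is lost by restricting `f s` to `U`, since its support lies there. Summed over a
partition of unity, this identity yields the right inverse. -/
lemma extSec_mulSec (hP : P.IsLocal) {f : M.Fun ⊤} (hf : M.supp f ⊆ U) (s : P.CSec ⊤) :
    extSec hP U (mulSec hf s) = P.fmul f s :=
  (isExtSec_iff_extSec_eq hP).1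
    ((isExtSec_iff hP).2 ⟨rfl, (supp_smul_subset_left f s.1).trans hf⟩)

end OMod

/-! ### Formal partitions of unity near a compact set -/

namespace IsFormalPartition

variable {M : ComplexLRS.{u}} {Γ : Type x} {U : Γ → Opens M.pt} {f : Γ → M.Fun ⊤}

lemma exists_finset (hf : IsFormalPartition U f) {K : Set M.pt} (hK : IsCompact K) :
    ∃ A : Finset Γ, ∀ α ∉ A, Disjoint (M.supp (f α)) K := by
  have h := hf.locallyFinite.finite_nonempty_inter_compact hK
  refine ⟨h.toFinset, fun α hα => ?_⟩
  rw [Set.Finite.mem_toFinset] at hα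
  exact Set.disjoint_iff_inter_eq_empty.2 (Set.not_nonempty_iff_eq_empty.1 hα)

/-- By local finiteness the union of the supports of the omitted members is closed; its complement
is the required neighbourhood. Equality of formal functions holds there, not just of values. -/
lemma exists_opens_sum_eq_one (hf : IsFormalPartition U f) {A : Finset Γ} {K : Set M.pt}
    (hA : ∀ α ∉ A, Disjoint (M.supp (f α)) K) :
    ∃ V : Opens M.pt, K ⊆ V ∧ M.res (le_top : V ≤ ⊤) (∑ α ∈ A, f α) = 1 := by
  have hcl : IsClosed (⋃ α : {α // α ∉ A}, M.supp (f α)) :=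
    (hf.locallyFinite.comp_injective Subtype.val_injective).isClosed_iUnion
      fun α => ComplexLRS.isClosed_supp _
  refine ⟨⟨_, hcl.isOpen_compl⟩, fun a ha h => ?_, ?_⟩
  · obtain ⟨α, hα⟩ := Set.mem_iUnion.1 h
    exact (hA α α.2).le_bot ⟨hα, ha⟩
  · rw [map_sum, hf.sum_eq_one _ A fun α hα => ?_]
    exact ComplexLRS.isLocal_funMod.res_eq_zero le_top
      (Set.disjoint_left.2 fun b hb hb' => hb (Set.mem_iUnion.2 ⟨⟨α, hα⟩, hb'⟩))

lemma sum_smul_eq (hf : IsFormalPartition U f) {P : OMod.{u, v} M} (hP : P.IsLocal) {A : Finset Γ}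
    {s : P.sec ⊤} (hA : ∀ α ∉ A, Disjoint (M.supp (f α)) (P.supp s)) :
    ∑ α ∈ A, f α • s = s := by
  obtain ⟨V, hV, h⟩ := hf.exists_opens_sum_eq_one hA
  rw [← Finset.sum_smul]
  refine hP.smul_eq_self (Set.disjoint_right.2 fun a ha => ?_)
  refine (ComplexLRS.notMem_supp_iff (Opens.mem_top a)).2 ⟨V, le_top, hV ha, ?_⟩
  rw [map_sub, map_one, h, sub_self]

end IsFormalPartition

namespace OMod

variable {M : ComplexLRS.{u}} [IsFormalManifold M] {P : OMod.{u, v} M} {Γ : Type x} [DecidableEq Γ]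
  {U : Γ → Opens M.pt}

/-- Compactness of `K` bounds the relevant indices for all sections supported in `K`, and
`sum_smul_eq` recovers the section from its pieces. -/
lemma exists_rightInverse_CSec (hP : P.IsLocal) {f : Γ → M.Fun ⊤} (hf : IsFormalPartition U f) :
    ∃ S : P.CSec ⊤ →L[ℂ] (⨁ α, P.CSec (U α)),
      (directSumDesc fun α => extSec hP (U α)).comp S = ContinuousLinearMap.id ℂ _ ∧
      ∀ s α, S s α = mulSec (hf.supp_subset α) s := by
  have hzero {s : P.CSec ⊤} {α : Γ} (h : Disjoint (M.supp (f α)) (P.supp s.1)) :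
      mulSec (hf.supp_subset α) s = 0 :=
    Subtype.ext (by rw [mulSec_val, hP.smul_eq_zero h, map_zero]; rfl)
  refine exists_directSumDesc_rightInverse (fun α => extSec hP (U α)) _ _ rfl
    (fun α => (mulSec (hf.supp_subset α)).toLinearMap) (fun K α => ?_) (fun K => ?_) fun s => ?_
  · let _ : TopologicalSpace (P.secSupp ⊤ K) :=
      TopologicalSpace.induced (P.secSupp ⊤ K).subtype (P.smoothTopology ⊤)
    exact (mulSec (hf.supp_subset α)).continuous.comp (continuous_secSuppIncl K)
  · obtain ⟨A, hA⟩ := hf.exists_finset K.2.1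
    exact ⟨A, fun α hα s => hzero ((hA α hα).mono_right s.2)⟩
  · obtain ⟨K, hK⟩ := s.2
    obtain ⟨A, hA⟩ := hf.exists_finset K.2.1
    refine ⟨A, fun α hα => hzero ((hA α hα).mono_right hK), ?_⟩
    refine (Finset.sum_congr rfl fun α _ => extSec_mulSec hP (hf.supp_subset α) s).trans ?_
    refine Subtype.ext ((map_sum (P.secC ⊤).subtype _ _).trans ?_)
    exact hf.sum_smul_eq hP fun α hα => (hA α hα).mono_right hK

end OMod

/-! ### Compactly supported formal densities -/

namespace OMod

section
variable {M : ComplexLRS.{u}} {P : OMod.{u, v} M} {U : Opens M.pt}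

lemma exists_isProduct (hP : P.IsLocal) {f : M.Fun ⊤} (hf : M.supp f ⊆ U) (s : P.sec U) :
    ∃ t : P.sec ⊤, IsProduct f s t := by
  have h : P.supp ((M.res le_top f : M.Fun U) • s) ⊆ M.supp f :=
    (supp_smul_subset_left _ _).trans (supp_res_subset (P := funMod M) le_top f)
  obtain ⟨t, ht, hts⟩ := hP.exists_extension le_top ((M.res le_top f : M.Fun U) • s)
    (ComplexLRS.isClosed_supp f) (Set.inter_subset_left.trans hf) h
  exact ⟨t, ht, hts.trans h⟩

lemma IsProduct.eq (hP : P.IsLocal) {f : M.Fun ⊤} (hf : M.supp f ⊆ U) {s : P.sec U}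
    {t t' : P.sec ⊤} (h : IsProduct f s t) (h' : IsProduct f s t') : t = t' :=
  hP.ext_of_supp le_top hf h.2 h'.2 (h.1.trans h'.1.symm)

/-- Multiplication of sections over `U` by a formal function supported in `U`. -/
def mulExt (hP : P.IsLocal) {f : M.Fun ⊤} (hf : M.supp f ⊆ U) : P.sec U →ₗ[ℂ] P.sec ⊤ :=
  have h := fun s : P.sec U => (exists_isProduct hP hf s).choose_spec
  { toFun := fun s => (exists_isProduct hP hf s).choose
    map_add' := fun s t => (h _).eq hP hf
      ⟨(map_add _ _ _).trans ((congrArg₂ _ (h s).1 (h t).1).trans (smul_add _ _ _).symm),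
        Submodule.add_mem (P.secSupp ⊤ _) (h s).2 (h t).2⟩
    map_smul' := fun _ s => (h _).eq hP hf
      ⟨(map_smul _ _ _).trans ((congrArg _ (h s).1).trans (smul_comm _ _ _)),
        Submodule.smul_mem (P.secSupp ⊤ _) _ (h s).2⟩ }

lemma isProduct_mulExt (hP : P.IsLocal) {f : M.Fun ⊤} (hf : M.supp f ⊆ U) (s : P.sec U) :
    IsProduct f s (mulExt hP hf s) :=
  (exists_isProduct hP hf s).choose_spec

lemma mulExt_res (hP : P.IsLocal) {f : M.Fun ⊤} (hf : M.supp f ⊆ U) (s : P.sec ⊤) :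
    mulExt hP hf (P.res le_top s) = f • s :=
  (isProduct_mulExt hP hf _).eq hP hf ⟨P.res_smul _ _ _, supp_smul_subset_left f s⟩

/-- Cutting the operator by `f` and restricting it to `U` is dual to multiplying sections by `f` and
extending them to `M`. -/
lemma homTop_mulRes_mulExt (hP : P.IsLocal) {f : M.Fun ⊤} (hf : M.supp f ⊆ U)
    {Q : OMod.{u, w} M} (D : P.sheafHom Q ⊤) (s : P.sec U) :
    homTop (mulRes f U D) s = Q.res le_top (homTop D (mulExt hP hf s)) :=
  homTop_mulRes f D (isProduct_mulExt hP hf s).1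

end

variable {M : ComplexLRS.{u}} [IsFormalManifold M]

section
variable (P : OMod.{u, v} M) (U : Opens M.pt)

instance : IsTopologicalAddGroup (P.FormalDensity U) := isTopologicalAddGroup_lcFinal _ _

instance : ContinuousSMul ℂ (P.FormalDensity U) := continuousSMul_lcFinal _ _

instance : LocallyConvexSpace ℝ (P.FormalDensity U) := locallyConvexSpace_lcFinal _ _

/-- The topology on the differential operators of order at most `r` supported in `K`. -/
@[reducible]
def diffKrTopology (K : CompactIn U) (r : ℕ) : TopologicalSpace (P.diffKr M.densMod U K r) :=
  TopologicalSpace.induced (Submodule.inclusion (P.diffKr_le_diffFin M.densMod U K r))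
    (P.diffFinTopology U)

/-- The formal density given by a differential operator. -/
def toDensity (K : CompactIn U) (r : ℕ) : P.diffKr M.densMod U K r →ₗ[ℂ] P.FormalDensity U :=
  P.densKrIncl U K r ∘ₗ (P.rhoKr U K r).rangeRestrict

end

variable {P : OMod.{u, v} M} {U V : Opens M.pt}

lemma continuous_densKrIncl (K : CompactIn U) (r : ℕ) :
    @Continuous _ _ (P.densKrTopology U K r) _ (P.densKrIncl U K r) :=
  continuous_lcFinal_rng (ι := CompactIn U × ℕ) (fun i => P.densKrTopology U i.1 i.2)
    (fun i => P.densKrIncl U i.1 i.2) (K, r)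

lemma continuous_toDensity (K : CompactIn U) (r : ℕ) :
    @Continuous _ _ (P.diffKrTopology U K r) _ (P.toDensity U K r) := by
  let _ := P.diffKrTopology U K r
  let _ := P.densKrTopology U K r
  exact (continuous_densKrIncl K r).comp continuous_coinduced_rng

/-- The quotient and inductive limit topologies combine, so continuity is tested on spaces of
operators. Maps of functionals are therefore lifted to maps of operators below. -/
lemma continuous_FormalDensity_dom {W : Type*} [AddCommGroup W] [Module ℂ W] [TopologicalSpace W]
    [IsTopologicalAddGroup W] [ContinuousSMul ℂ W] [LocallyConvexSpace ℝ W]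
    (T : P.FormalDensity U →ₗ[ℂ] W)
    (h : ∀ (K : CompactIn U) (r : ℕ),
      @Continuous _ _ (P.diffKrTopology U K r) _ (T ∘ₗ P.toDensity U K r)) : Continuous T :=
  continuous_lcFinal_dom _ _ T fun i => continuous_coinduced_dom.2 (h i.1 i.2)

lemma diffSeminorm_apply (X : M.densMod.diffC M.redMod U) (u : P.sec U)
    (D : P.diffFin M.densMod U) :
    P.diffSeminorm U (X, u) D = M.densMod.smoothSeminorm U X (homTop D.1 u) :=
  rfl

lemma continuous_diffKr_of_seminorm {K : CompactIn U} {L : CompactIn V} {r r' : ℕ}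
    (Z : P.diffKr M.densMod U K r →ₗ[ℂ] P.diffKr M.densMod V L r')
    (h : ∀ (X : M.densMod.diffC M.redMod V) (u : P.sec V),
      ∃ (X' : M.densMod.diffC M.redMod U) (u' : P.sec U), ∀ D,
        M.densMod.smoothSeminorm V X (homTop (Z D).1 u) ≤
          M.densMod.smoothSeminorm U X' (homTop D.1 u')) :
    @Continuous _ _ (P.diffKrTopology U K r) (P.diffKrTopology V L r') Z := by
  refine continuous_of_seminorm_le (X' := P.diffKr M.densMod U K r)
    (Y' := P.diffKr M.densMod V L r') (P.diffSeminorm U) (P.diffSeminorm V)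
    (Submodule.inclusion (P.diffKr_le_diffFin M.densMod U K r))
    (Submodule.inclusion (P.diffKr_le_diffFin M.densMod V L r')) Z ?_
  rintro ⟨X, u⟩
  obtain ⟨X', u', h'⟩ := h X u
  refine ⟨(X', u'), fun D => ?_⟩
  rw [diffSeminorm_apply, diffSeminorm_apply]
  exact h' D

lemma rho_eq_rho (D : P.diffC M.densMod U) (E : P.diffC M.densMod V) {s : P.sec U} {t : P.sec V}
    (h : ComplexLRS.coeff (homTop D.1 s) = ComplexLRS.coeff (homTop E.1 t)) :
    P.rho U D s = P.rho V E t :=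
  ComplexLRS.integral_congr (P.applyC M.densMod U D s) (P.applyC M.densMod V E t) h

/-- The extension of the functional of `D` is the functional of the extension of `D`: both integrate
the same coefficient functions. -/
lemma rho_extHom {K : CompactIn U} (D : P.diffC M.densMod U) (hK : D.1 ∈ P.homSupp M.densMod U K)
    {D' : P.diffC M.densMod ⊤}
    (hD' : D'.1 = extHom ComplexLRS.isLocal_densMod K ⟨D.1, hK⟩) (s : P.sec ⊤) :
    P.rho ⊤ D' s = P.rho U D (P.res le_top s) := by
  refine rho_eq_rho _ _ ?_
  rw [hD', ← res_homTop_extHom ComplexLRS.isLocal_densMod ⟨D.1, hK⟩ s]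
  exact (ComplexLRS.coeff_res_of_supp le_top
    ((supp_homTop_extHom ComplexLRS.isLocal_densMod ⟨D.1, hK⟩ s).trans K.2.2)).symm

/-- The extension map of formal densities, as a linear map. -/
def extDensLin (P : OMod.{u, v} M) (U : Opens M.pt) :
    P.FormalDensity U →ₗ[ℂ] P.FormalDensity ⊤ where
  toFun η := ⟨η.1 ∘ₗ P.res le_top, by
    obtain ⟨_, D, rfl⟩ := η
    obtain ⟨K, hK⟩ := D.2.2
    exact ⟨⟨_, extHom_mem_diffC ComplexLRS.isLocal_densMod ⟨D.1, hK⟩ D.2.1⟩,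
      LinearMap.ext (rho_extHom D hK rfl)⟩⟩
  map_add' _ _ := Subtype.ext (LinearMap.ext fun _ => rfl)
  map_smul' _ _ := Subtype.ext (LinearMap.ext fun _ => rfl)

/-- The extension by zero of differential operators of order at most `r` supported in `K`. -/
def extDiffKr (P : OMod.{u, v} M) (K : CompactIn U) (r : ℕ) :
    P.diffKr M.densMod U K r →ₗ[ℂ] P.diffKr M.densMod ⊤ K.toTop r :=
  (extHom ComplexLRS.isLocal_densMod K ∘ₗ Submodule.inclusion inf_le_left).codRestrict _
    fun D => extHom_mem_diffKr ComplexLRS.isLocal_densMod ⟨D.1, D.2.1⟩ D.2.2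

lemma extDiffKr_val (K : CompactIn U) (r : ℕ) (D : P.diffKr M.densMod U K r) :
    (extDiffKr P K r D).1 = extHom ComplexLRS.isLocal_densMod K ⟨D.1, D.2.1⟩ :=
  rfl

/-- The values of the extended operators are supported in `K`, so a test operator `X` over `M` may
be cut off to one over `U`, and the test section is restricted to `U`. -/
lemma continuous_extDiffKr (K : CompactIn U) (r : ℕ) :
    @Continuous _ _ (P.diffKrTopology U K r) (P.diffKrTopology ⊤ K.toTop r)
      (extDiffKr P K r) := by
  refine continuous_diffKr_of_seminorm _ fun X u => ?_
  obtain ⟨X', hX'⟩ := exists_smoothSeminorm_of_supp ComplexLRS.isLocal_densMod K X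
  refine ⟨X', P.res le_top u, fun D => ?_⟩
  rw [extDiffKr_val, hX' _ (supp_homTop_extHom ComplexLRS.isLocal_densMod ⟨D.1, D.2.1⟩ u),
    res_homTop_extHom]

lemma extDensLin_toDensity (K : CompactIn U) (r : ℕ) (D : P.diffKr M.densMod U K r) :
    extDensLin P U (P.toDensity U K r D) = P.toDensity ⊤ K.toTop r (extDiffKr P K r D) :=
  Subtype.ext (LinearMap.ext fun s =>
    (rho_extHom ⟨D.1, P.diffKr_le_diffC M.densMod U K r D.2⟩ D.2.1 (D' := ⟨(extDiffKr P K r D).1,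
      P.diffKr_le_diffC M.densMod ⊤ K.toTop r (extDiffKr P K r D).2⟩) rfl s).symm)

/-- The extension map of formal densities. -/
def extDens (P : OMod.{u, v} M) (U : Opens M.pt) : P.FormalDensity U →L[ℂ] P.FormalDensity ⊤ where
  toLinearMap := extDensLin P U
  cont := continuous_FormalDensity_dom _ fun K r => by
    let _ := P.diffKrTopology U K r
    let _ := P.diffKrTopology ⊤ K.toTop r
    exact ((continuous_toDensity K.toTop r).comp (continuous_extDiffKr K r)).congr
      fun D => (extDensLin_toDensity K r D).symm

lemma extDens_apply (η : P.FormalDensity U) (s : P.sec ⊤) :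
    (extDens P U η).1 s = η.1 (P.res le_top s) :=
  rfl

lemma isExtDensity_iff (η : P.FormalDensity U) (η' : P.FormalDensity ⊤) :
    IsExtDensity η η' ↔ extDens P U η = η' :=
  ⟨fun h => Subtype.ext (LinearMap.ext fun s => (h s).symm), fun h _ => h ▸ rfl⟩

/-- This exhibits the functional `s ↦ η (f s)` as coming from an operator over `U`, so that it is
again a formal density. -/
lemma rho_mulRes (hP : P.IsLocal) {f : M.Fun ⊤} (hf : M.supp f ⊆ U) (D : P.diffC M.densMod ⊤)
    {D' : P.diffC M.densMod U} (hD' : D'.1 = mulRes f U D.1) (s : P.sec U) :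
    P.rho U D' s = P.rho ⊤ D (mulExt hP hf s) := by
  refine rho_eq_rho _ _ ?_
  rw [hD', homTop_mulRes_mulExt hP hf]
  exact ComplexLRS.coeff_res_of_supp le_top
    ((supp_homTop_subset _ _).trans ((isProduct_mulExt hP hf s).2.trans hf))

/-- The transpose of the multiplication of sections over `U` by a formal function supported
in `U`, as a linear map of formal densities. -/
def mulDensLin (hP : P.IsLocal) {f : M.Fun ⊤} (hf : M.supp f ⊆ U) :
    P.FormalDensity ⊤ →ₗ[ℂ] P.FormalDensity U where
  toFun η := ⟨η.1 ∘ₗ mulExt hP hf, by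
    obtain ⟨_, D, rfl⟩ := η
    exact ⟨⟨_, mulRes_mem_diffC hf D.2⟩, LinearMap.ext fun s => rho_mulRes hP hf D rfl s⟩⟩
  map_add' _ _ := Subtype.ext (LinearMap.ext fun _ => rfl)
  map_smul' _ _ := Subtype.ext (LinearMap.ext fun _ => rfl)

/-- The composition of differential operators with the multiplication by a formal function
supported in `U`, restricted to `U`. -/
def mulDiffKr (P : OMod.{u, v} M) {f : M.Fun ⊤} (hf : M.supp f ⊆ U)
    (K : CompactIn (⊤ : Opens M.pt)) (r : ℕ) :
    P.diffKr M.densMod ⊤ K r →ₗ[ℂ] P.diffKr M.densMod U (K.inter hf) r :=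
  (mulRes f U ∘ₗ (P.diffKr M.densMod ⊤ K r).subtype).codRestrict _
    fun D => mulRes_mem_diffKr hf D.2

lemma mulDiffKr_val {f : M.Fun ⊤} (hf : M.supp f ⊆ U) (K : CompactIn (⊤ : Opens M.pt)) (r : ℕ)
    (D : P.diffKr M.densMod ⊤ K r) : (mulDiffKr P hf K r D).1 = mulRes f U D.1 :=
  rfl

/-- Here the test operator is extended by zero to `M`, and the test section `u` is replaced by the
extension by zero of `f u`. -/
lemma continuous_mulDiffKr (hP : P.IsLocal) {f : M.Fun ⊤} (hf : M.supp f ⊆ U)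
    (K : CompactIn (⊤ : Opens M.pt)) (r : ℕ) :
    @Continuous _ _ (P.diffKrTopology ⊤ K r) (P.diffKrTopology U (K.inter hf) r)
      (mulDiffKr P hf K r) := by
  refine continuous_diffKr_of_seminorm _ fun X u => ?_
  obtain ⟨X', hX'⟩ := exists_smoothSeminorm_res X
  refine ⟨X', mulExt hP hf u, fun D => ?_⟩
  rw [mulDiffKr_val, homTop_mulRes_mulExt hP hf, hX']

lemma mulDensLin_toDensity (hP : P.IsLocal) {f : M.Fun ⊤} (hf : M.supp f ⊆ U)
    (K : CompactIn (⊤ : Opens M.pt)) (r : ℕ) (D : P.diffKr M.densMod ⊤ K r) :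
    mulDensLin hP hf (P.toDensity ⊤ K r D) =
      P.toDensity U (K.inter hf) r (mulDiffKr P hf K r D) :=
  Subtype.ext (LinearMap.ext fun s =>
    (rho_mulRes hP hf ⟨D.1, P.diffKr_le_diffC M.densMod ⊤ K r D.2⟩
      (D' := ⟨(mulDiffKr P hf K r D).1,
        P.diffKr_le_diffC M.densMod U (K.inter hf) r (mulDiffKr P hf K r D).2⟩) rfl s).symm)

/-- The transpose of the multiplication of sections over `U` by a formal function supported
in `U`. -/
def mulDens (hP : P.IsLocal) {f : M.Fun ⊤} (hf : M.supp f ⊆ U) :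
    P.FormalDensity ⊤ →L[ℂ] P.FormalDensity U where
  toLinearMap := mulDensLin hP hf
  cont := continuous_FormalDensity_dom _ fun K r => by
    let _ := P.diffKrTopology ⊤ K r
    let _ := P.diffKrTopology U (K.inter hf) r
    exact ((continuous_toDensity (K.inter hf) r).comp (continuous_mulDiffKr hP hf K r)).congr
      fun D => (mulDensLin_toDensity hP hf K r D).symm

lemma mulDens_apply (hP : P.IsLocal) {f : M.Fun ⊤} (hf : M.supp f ⊆ U) (η : P.FormalDensity ⊤)
    (s : P.sec U) : (mulDens hP hf η).1 s = η.1 (mulExt hP hf s) :=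
  rfl

/-- Already the integrand vanishes: it is supported both in the support of `D` and in that of `s`.
-/
lemma rho_eq_zero_of_disjoint (D : P.diffC M.densMod U) {K : Set M.pt}
    (hK : D.1 ∈ P.homSupp M.densMod U K) {s : P.sec U} (hs : Disjoint K (P.supp s)) :
    P.rho U D s = 0 := by
  have h : P.applyC M.densMod U D s = 0 :=
    Subtype.ext (ComplexLRS.isLocal_densMod.eq_zero_of_supp fun a ha =>
      hs.le_bot ⟨hK (supp_homTop D.1 s ha), supp_homTop_subset D.1 s ha⟩)
  change ComplexLRS.integral U (P.applyC M.densMod U D s) = 0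
  rw [h, map_zero]

/-- The sections tested here may have arbitrary support; compactness comes from the operator `D`
representing the functional, whose support selects the finitely many indices. -/
lemma exists_rightInverse_FormalDensity {Γ : Type x} [DecidableEq Γ] {U : Γ → Opens M.pt}
    (hP : P.IsLocal) {f : Γ → M.Fun ⊤} (hf : IsFormalPartition U f) :
    ∃ S : P.FormalDensity ⊤ →L[ℂ] (⨁ α, P.FormalDensity (U α)),
      (directSumDesc fun α => extDens P (U α)).comp S = ContinuousLinearMap.id ℂ _ ∧
      ∀ η α, S η α = mulDens hP (hf.supp_subset α) η := by
  have hzero {η : P.FormalDensity ⊤} {D : P.diffC M.densMod ⊤} (hD : η.1 = P.rho ⊤ D)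
      {K : Set M.pt} (hK : D.1 ∈ P.homSupp M.densMod ⊤ K) {α : Γ}
      (h : Disjoint (M.supp (f α)) K) : mulDens hP (hf.supp_subset α) η = 0 :=
    Subtype.ext (LinearMap.ext fun s => by
      rw [mulDens_apply, hD]
      exact rho_eq_zero_of_disjoint D hK (h.symm.mono_right (isProduct_mulExt hP _ s).2))
  refine exists_directSumDesc_rightInverse (fun α => extDens P (U α)) _ _ rfl
    (fun α => (mulDens hP (hf.supp_subset α)).toLinearMap) (fun i α => ?_) (fun i => ?_) fun η => ?_
  · let _ := P.densKrTopology ⊤ i.1 i.2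
    exact (mulDens hP (hf.supp_subset α)).continuous.comp (continuous_densKrIncl i.1 i.2)
  · obtain ⟨A, hA⟩ := hf.exists_finset i.1.2.1
    refine ⟨A, fun α hα y => ?_⟩
    obtain ⟨_, D, rfl⟩ := y
    exact hzero (D := ⟨D.1, P.diffKr_le_diffC M.densMod ⊤ i.1 i.2 D.2⟩) rfl D.2.1 (hA α hα)
  · obtain ⟨D, hD⟩ : ∃ D, P.rho ⊤ D = η.1 := η.2
    obtain ⟨K, hK⟩ := D.2.2
    obtain ⟨A, hA⟩ := hf.exists_finset K.2.1
    refine ⟨A, fun α hα => hzero hD.symm hK (hA α hα), ?_⟩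
    refine Subtype.ext ((map_sum (LinearMap.range (P.rho ⊤)).subtype _ _).trans ?_)
    refine LinearMap.ext fun s => ?_
    have h1 (α : Γ) : (extDens P (U α) (mulDens hP (hf.supp_subset α) η)).1 s = η.1 (f α • s) := by
      rw [extDens_apply, mulDens_apply, mulExt_res]
    rw [LinearMap.sum_apply]
    refine (Finset.sum_congr rfl fun α _ => h1 α).trans ?_
    rw [← map_sum, ← Finset.sum_smul, ← sub_eq_zero, ← map_sub, ← hD]
    -- Near the support of `D` the finite sum of the `f α` is one, so the difference of the two
    -- sections vanishes there.
    obtain ⟨V, hV, h⟩ := hf.exists_opens_sum_eq_one hA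
    refine rho_eq_zero_of_disjoint D hK (Set.disjoint_left.2 fun a ha => ?_)
    refine (notMem_supp_iff (Opens.mem_top a)).2 ⟨V, le_top, hV ha, ?_⟩
    rw [map_sub, P.res_smul, h, one_smul, sub_self]

end OMod

/-! ### Compactly supported formal generalized functions -/

namespace OMod

section
variable {M : ComplexLRS.{u}} {P : OMod.{u, v} M} {U : Opens M.pt}

/-- The product of a formal function and a compactly supported section. -/
def smulSec (f : M.Fun U) (s : P.CSec U) : P.CSec U :=
  ⟨f • s.1, let ⟨K, hK⟩ := s.2; ⟨K, (supp_smul_subset_right f s.1).trans hK⟩⟩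

lemma IsLocal.eq_zero_of_disjoint (hP : P.IsLocal) {s : P.CSec U} {K L : Set M.pt}
    (hK : P.supp s.1 ⊆ K) (hL : P.supp s.1 ⊆ L) (h : Disjoint K L) : s = 0 :=
  Subtype.ext (hP.eq_zero_of_supp fun _ ha => h.le_bot ⟨hK ha, hL ha⟩)

end

variable {M : ComplexLRS.{u}} [IsFormalManifold M] {P : OMod.{u, v} M} {U : Opens M.pt}

lemma Dist.notMem_supp_iff {E : Type x} [AddCommGroup E] [Module ℂ E] [TopologicalSpace E]
    {η : P.Dist U E} {a : M.pt} (ha : a ∈ U) :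
    a ∉ η.supp ↔ ∃ V : Opens M.pt, V ≤ U ∧ a ∈ V ∧ η.VanishesOn V := by
  simp only [Dist.supp, Set.mem_ofPred_eq, not_and, not_forall, not_not]
  exact ⟨fun h => let ⟨V, hV, haV, h⟩ := h ha; ⟨V, hV, haV, h⟩,
    fun ⟨V, hV, haV, h⟩ _ => ⟨V, hV, haV, h⟩⟩

section
variable (P U) (E : Type x) [AddCommGroup E] [Module ℂ E] [TopologicalSpace E]
  [IsTopologicalAddGroup E] [ContinuousSMul ℂ E]

instance : IsTopologicalAddGroup (P.CDist U E) := isTopologicalAddGroup_lcFinal _ _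

instance : ContinuousSMul ℂ (P.CDist U E) := continuousSMul_lcFinal _ _

instance : LocallyConvexSpace ℝ (P.CDist U E) := locallyConvexSpace_lcFinal _ _

end

variable {E : Type x} [AddCommGroup E] [Module ℂ E] [TopologicalSpace E]
  [IsTopologicalAddGroup E] [ContinuousSMul ℂ E]

lemma continuous_distSuppIncl (K : CompactIn U) : Continuous (P.distSuppIncl U E K) :=
  continuous_lcFinal_rng (fun K : CompactIn U => (instTopologicalSpaceSubtype :
    TopologicalSpace (P.distSupp U E K))) (fun K => P.distSuppIncl U E K) K

lemma continuous_CDist_dom {W : Type*} [AddCommGroup W] [Module ℂ W] [TopologicalSpace W]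
    [IsTopologicalAddGroup W] [ContinuousSMul ℂ W] [LocallyConvexSpace ℝ W]
    (T : P.CDist U E →ₗ[ℂ] W)
    (h : ∀ K : CompactIn U, Continuous (T ∘ₗ P.distSuppIncl U E K)) : Continuous T :=
  continuous_lcFinal_dom _ _ T h

/-- A functional vanishes on the sections supported outside its support. -/
lemma Dist.apply_eq_zero (hP : P.IsLocal) (η : P.Dist U E) {s : P.CSec U}
    (h : Disjoint (P.supp s.1) η.supp) : η s = 0 := by
  obtain ⟨t, ht⟩ := exists_isExtSec hP s
  -- The support is known to be closed in `M` only for sections over `M`, so its compactness is read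
  -- off from the extension by zero.
  have hst : P.supp s.1 = P.supp t.1 :=
    Set.Subset.antisymm (ht.1 ▸ supp_res_subset le_top t.1) ht.2
  have hcompact : IsCompact (P.supp s.1) := by
    obtain ⟨K, hK⟩ := s.2
    exact K.2.1.of_isClosed_subset (hst ▸ isClosed_supp t.1) hK
  -- Every point gets a neighbourhood that either is one on which `η` vanishes or misses the support
  -- of `s`. A partition of unity subordinate to these splits `s` into finitely many pieces, each
  -- killed by `η` or zero.
  have hV (a : M.pt) : ∃ V : Opens M.pt, a ∈ V ∧
      (η.VanishesOn V ∨ Disjoint (V : Set M.pt) (P.supp s.1)) := by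
    by_cases ha : a ∈ P.supp s.1
    · obtain ⟨V, -, haV, hV⟩ :=
        (Dist.notMem_supp_iff ha.1).1 fun h' => h.le_bot ⟨ha, h'⟩
      exact ⟨V, haV, Or.inl hV⟩
    · exact ⟨⟨_, hcompact.isClosed.isOpen_compl⟩, ha, Or.inr disjoint_compl_left⟩
  choose V haV hV using hV
  obtain ⟨f, hf⟩ := ComplexLRS.exists_isFormalPartition V
    (eq_top_iff.2 fun a _ => Opens.mem_iSup.2 ⟨a, haV a⟩)
  obtain ⟨A, hA⟩ := hf.exists_finset hcompact
  have hs : ∑ a ∈ A, smulSec (M.res le_top (f a)) s = s := by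
    refine Subtype.ext ((map_sum (P.secC U).subtype _ _).trans ?_)
    change ∑ a ∈ A, (M.res le_top (f a) : M.Fun U) • s.1 = s.1
    rw [← ht.1]
    simp only [← P.res_smul]
    rw [← map_sum, hf.sum_smul_eq hP fun a ha => hst ▸ hA a ha]
  rw [← hs, map_sum]
  refine Finset.sum_eq_zero fun a _ => ?_
  have hsupp : P.supp (smulSec (M.res le_top (f a)) s).1 ⊆ V a :=
    (supp_smul_subset_left _ _).trans
      ((supp_res_subset (P := funMod M) le_top (f a)).trans (hf.supp_subset a))
  rcases hV a with h' | h'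
  · exact h' _ hsupp
  · rw [hP.eq_zero_of_disjoint hsupp (supp_smul_subset_right _ _) h', map_zero]

lemma Dist.apply_eq_apply (hP : P.IsLocal) (η : P.Dist U E) {s t : P.CSec U} {S : Set M.pt}
    (hS : P.supp (s.1 - t.1) ⊆ S) (h : Disjoint S η.supp) : η s = η t := by
  rw [← sub_eq_zero, ← map_sub]
  exact η.apply_eq_zero hP (h.mono_left hS)

lemma Dist.apply_fmul (hP : P.IsLocal) (η : P.Dist ⊤ E) {g : M.Fun ⊤}
    (hg : Disjoint (M.supp (1 - g)) η.supp) (s : P.CSec ⊤) : η (P.fmul g s) = η s := by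
  refine (η.apply_eq_apply hP (S := M.supp (1 - g)) ?_ hg).symm
  have : s.1 - (P.fmul g s).1 = (1 - g) • s.1 := by rw [sub_smul, one_smul]; rfl
  rw [this]
  exact supp_smul_subset_left _ _

lemma Dist.apply_mulSec (hP : P.IsLocal) (η : P.Dist U E) {g : M.Fun ⊤} (hgU : M.supp g ⊆ U)
    (hg : Disjoint (M.supp (1 - g)) η.supp) {s : P.CSec U} {t : P.CSec ⊤} (h : IsExtSec s t) :
    η (mulSec hgU t) = η s := by
  refine (η.apply_eq_apply hP (S := M.supp (1 - g)) ?_ hg).symm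
  have : s.1 - (mulSec hgU t).1 = P.res le_top ((1 - g) • t.1) := by
    rw [sub_smul, one_smul, map_sub, h.1]
    rfl
  rw [this]
  exact (supp_res_subset _ _).trans (supp_smul_subset_left _ _)

/-- Inside `U` the map does not increase supports. A point outside `U` lies off the closed support
of `g`, near which the composition is zero. -/
lemma supp_comp_mulSec (hP : P.IsLocal) {η : P.Dist U E} {g : M.Fun ⊤} (hgU : M.supp g ⊆ U) :
    Dist.supp (η.comp (mulSec hgU) : P.Dist ⊤ E) ⊆ η.supp := by
  intro a ha
  by_contra haη
  by_cases haU : a ∈ U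
  · obtain ⟨V, hVU, haV, hV⟩ := (Dist.notMem_supp_iff haU).1 haη
    refine ha.2 V le_top haV fun s hs => hV _ ?_
    exact (supp_res_subset _ _).trans ((supp_smul_subset_right _ _).trans hs)
  · refine ha.2 ⟨_, (ComplexLRS.isClosed_supp g).isOpen_compl⟩ le_top (fun h => haU (hgU h))
      fun s hs => ?_
    have h0 : mulSec hgU s = 0 := Subtype.ext (by
      rw [mulSec_val, hP.smul_eq_zero (Set.disjoint_right.2 fun b hb hb' => hs hb hb'), map_zero]
      rfl)
    rw [ContinuousLinearMap.comp_apply, h0, map_zero]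

/-- An extension is determined on all sections: `g s` may replace `s` when `g` is one near the
support of `θ`, and `g s` comes from `U`. This formula yields uniqueness. -/
lemma IsExtDist.apply_eq (hP : P.IsLocal) {η : P.CDist U E} {θ : P.CDist ⊤ E}
    (h : ∀ (s : P.CSec U) (t : P.CSec ⊤), IsExtSec s t → θ.1 t = η.1 s) {g : M.Fun ⊤}
    (hgU : M.supp g ⊆ U) (hg : Disjoint (M.supp (1 - g)) (Dist.supp θ.1)) (s : P.CSec ⊤) :
    θ.1 s = η.1 (mulSec hgU s) := by
  rw [← Dist.apply_fmul hP θ.1 hg s]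
  exact h _ _ ((isExtSec_iff_extSec_eq hP).2 (extSec_mulSec hP hgU s))

/-- With `g` equal to one near the support of `η`, extension by zero is the transpose of cutting
sections off to `U`. -/
lemma isExtDist_comp_mulSec (hP : P.IsLocal) {η : P.CDist U E} {θ : P.CDist ⊤ E} {g : M.Fun ⊤}
    (hgU : M.supp g ⊆ U) (hg : Disjoint (M.supp (1 - g)) (Dist.supp η.1))
    (hθ : θ.1 = η.1.comp (mulSec hgU)) : IsExtDist η θ := by
  refine ⟨fun s t h => ?_, ?_⟩
  · rw [hθ]
    exact Dist.apply_mulSec hP η.1 hgU hg h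
  · rw [hθ]
    exact supp_comp_mulSec hP hgU

lemma exists_isExtDist (hP : P.IsLocal) (η : P.CDist U E) : ∃ θ : P.CDist ⊤ E, IsExtDist η θ := by
  obtain ⟨K, hK⟩ := η.2
  obtain ⟨g, -, hgU, hg⟩ := ComplexLRS.exists_cutoff K.2.1 K.2.2
  exact ⟨⟨η.1.comp (mulSec hgU), K.toTop, (supp_comp_mulSec hP hgU).trans hK⟩,
    isExtDist_comp_mulSec hP hgU (hg.mono_right hK) rfl⟩

/-- For `θ'` support in some compact subset of `U` is enough: one cutoff covering that set and the
support of `η` expresses both functionals by the same formula. -/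
lemma IsExtDist.eq (hP : P.IsLocal) {η : P.CDist U E} {θ θ' : P.CDist ⊤ E} (h : IsExtDist η θ)
    (h' : ∀ (s : P.CSec U) (t : P.CSec ⊤), IsExtSec s t → θ'.1 t = η.1 s) {K : CompactIn U}
    (hK : Dist.supp θ'.1 ⊆ K) : θ = θ' := by
  obtain ⟨L, hL⟩ := η.2
  obtain ⟨g, -, hgU, hg⟩ :=
    ComplexLRS.exists_cutoff (K.2.1.union L.2.1) (Set.union_subset K.2.2 L.2.2)
  rw [Set.disjoint_union_right] at hg
  refine Subtype.ext (ContinuousLinearMap.ext fun s => ?_)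
  rw [IsExtDist.apply_eq hP h.1 hgU (hg.2.mono_right (h.2.trans hL)),
    IsExtDist.apply_eq hP h' hgU (hg.1.mono_right hK)]

/-- Extension by zero, as a linear map. -/
def extDistLin (hP : P.IsLocal) (U : Opens M.pt) (E : Type x) [AddCommGroup E] [Module ℂ E]
    [TopologicalSpace E] [IsTopologicalAddGroup E] [ContinuousSMul ℂ E] :
    P.CDist U E →ₗ[ℂ] P.CDist ⊤ E :=
  have h := fun η : P.CDist U E => (exists_isExtDist hP η).choose_spec
  { toFun := fun η => (exists_isExtDist hP η).choose
    map_add' := fun η θ => by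
      obtain ⟨K, hK⟩ := η.2
      obtain ⟨L, hL⟩ := θ.2
      exact (h _).eq hP (fun s t hst => congrArg₂ _ ((h η).1 s t hst) ((h θ).1 s t hst))
        (K := ⟨K ∪ L, K.2.1.union L.2.1, Set.union_subset K.2.2 L.2.2⟩)
        (Submodule.add_mem (P.distSupp ⊤ E _)
          (((h η).2.trans hK).trans Set.subset_union_left)
          (((h θ).2.trans hL).trans Set.subset_union_right))
    map_smul' := fun z η => by
      obtain ⟨K, hK⟩ := η.2
      exact (h _).eq hP (fun s t hst => congrArg _ ((h η).1 s t hst))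
        (Submodule.smul_mem (P.distSupp ⊤ E K) z ((h η).2.trans hK)) }

lemma isExtDist_extDistLin (hP : P.IsLocal) (η : P.CDist U E) :
    IsExtDist η (extDistLin hP U E η) :=
  (exists_isExtDist hP η).choose_spec

/-- The transpose of a continuous linear map, on functionals supported in a compact set. -/
def precompSupp {V : Opens M.pt} (L : P.CSec V →L[ℂ] P.CSec U) (K K' : Set M.pt)
    (h : ∀ η : P.distSupp U E K, (η.1.comp L : P.Dist V E) ∈ P.distSupp V E K') :
    P.distSupp U E K →L[ℂ] P.distSupp V E K' :=
  ((ContinuousLinearMap.precomp E L).comp (P.distSupp U E K).subtypeL).codRestrict _ h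

/-- Extension by zero. -/
def extDist (hP : P.IsLocal) (U : Opens M.pt) (E : Type x) [AddCommGroup E] [Module ℂ E]
    [TopologicalSpace E] [IsTopologicalAddGroup E] [ContinuousSMul ℂ E] :
    P.CDist U E →L[ℂ] P.CDist ⊤ E where
  toLinearMap := extDistLin hP U E
  cont := continuous_CDist_dom _ fun K => by
    -- One cutoff works for all functionals supported in `K`. On this step extension by zero is thus
    -- precomposition with a fixed continuous linear map, which is continuous for uniform
    -- convergence on bounded sets.
    obtain ⟨g, -, hgU, hg⟩ := ComplexLRS.exists_cutoff K.2.1 K.2.2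
    refine ((continuous_distSuppIncl K.toTop).comp (precompSupp (E := E) (mulSec hgU) K K.toTop
      fun η => (supp_comp_mulSec hP hgU).trans η.2).continuous).congr fun η => ?_
    have h := isExtDist_comp_mulSec hP (η := P.distSuppIncl U E K η) (θ := P.distSuppIncl ⊤ E K.toTop
      ⟨η.1.comp (mulSec hgU), (supp_comp_mulSec hP hgU).trans η.2⟩) hgU (hg.mono_right η.2) rfl
    exact h.eq hP (isExtDist_extDistLin hP _).1 ((isExtDist_extDistLin hP _).2.trans η.2)

lemma isExtDist_iff (hP : P.IsLocal) (η : P.CDist U E) (θ : P.CDist ⊤ E) :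
    IsExtDist η θ ↔ extDist hP U E η = θ := by
  have h : IsExtDist η (extDist hP U E η) := isExtDist_extDistLin hP η
  refine ⟨fun hθ => ?_, fun hθ => hθ ▸ h⟩
  obtain ⟨K, hK⟩ := η.2
  exact h.eq hP hθ.1 (hθ.2.trans hK)

/-- Multiplication by a formal function, after extension by zero. -/
def fmulExt (hP : P.IsLocal) (f : M.Fun ⊤) (U : Opens M.pt) : P.CSec U →L[ℂ] P.CSec ⊤ :=
  (fmulCLM f).comp (extSec hP U)

lemma supp_comp_fmulExt (hP : P.IsLocal) {η : P.Dist ⊤ E} (f : M.Fun ⊤) :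
    Dist.supp (η.comp (fmulExt hP f U) : P.Dist U E) ⊆ η.supp ∩ M.supp f := by
  intro a ha
  have hsupp (s : P.CSec U) : P.supp (fmulExt hP f U s).1 ⊆ P.supp s.1 :=
    (supp_smul_subset_right _ _).trans (isExtSec_extSec hP s).2
  constructor
  · by_contra haη
    obtain ⟨V, -, haV, hV⟩ := (Dist.notMem_supp_iff (Opens.mem_top a)).1 haη
    exact ha.2 (V ⊓ U) inf_le_right ⟨haV, ha.1⟩ fun s hs =>
      hV _ fun b hb => (hs (hsupp s hb)).1
  · by_contra haf
    refine ha.2 (U ⊓ ⟨_, (ComplexLRS.isClosed_supp f).isOpen_compl⟩) inf_le_left ⟨ha.1, haf⟩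
      fun s hs => ?_
    rw [ContinuousLinearMap.comp_apply, hP.eq_zero_of_disjoint (s := fmulExt hP f U s)
      (supp_smul_subset_left _ _) (fun b hb => (hs (hsupp s hb)).2) disjoint_compl_right, map_zero]

/-- The transpose of the multiplication by a formal function supported in `U`, as a linear map. -/
def mulDistLin (hP : P.IsLocal) {f : M.Fun ⊤} (hf : M.supp f ⊆ U) (E : Type x) [AddCommGroup E]
    [Module ℂ E] [TopologicalSpace E] [IsTopologicalAddGroup E] [ContinuousSMul ℂ E] :
    P.CDist ⊤ E →ₗ[ℂ] P.CDist U E where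
  toFun η := ⟨η.1.comp (fmulExt hP f U), by
    obtain ⟨K, hK⟩ := η.2
    exact ⟨K.inter hf, (supp_comp_fmulExt hP f).trans (Set.inter_subset_inter_left _ hK)⟩⟩
  map_add' _ _ := Subtype.ext (ContinuousLinearMap.ext fun _ => rfl)
  map_smul' _ _ := Subtype.ext (ContinuousLinearMap.ext fun _ => rfl)

/-- The transpose of the multiplication by a formal function supported in `U`. -/
def mulDist (hP : P.IsLocal) {f : M.Fun ⊤} (hf : M.supp f ⊆ U) (E : Type x) [AddCommGroup E]
    [Module ℂ E] [TopologicalSpace E] [IsTopologicalAddGroup E] [ContinuousSMul ℂ E] :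
    P.CDist ⊤ E →L[ℂ] P.CDist U E where
  toLinearMap := mulDistLin hP hf E
  cont := continuous_CDist_dom _ fun K =>
    (continuous_distSuppIncl (K.inter hf)).comp (precompSupp (E := E) (fmulExt hP f U) K _
      fun η => (supp_comp_fmulExt hP f).trans (Set.inter_subset_inter_left _ η.2)).continuous

lemma mulDist_apply (hP : P.IsLocal) {f : M.Fun ⊤} (hf : M.supp f ⊆ U) (η : P.CDist ⊤ E)
    (s : P.CSec U) : (mulDist hP hf E η).1 s = η.1 (P.fmul f (extSec hP U s)) :=
  rfl

/-- The extension is computed by a cutoff `g` equal to one near `K ∩ M.supp f`. The error `(1 - g) f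
s` is supported in `M.supp f` and away from that set, hence off the support of `η`. -/
lemma extDist_mulDist (hP : P.IsLocal) {f : M.Fun ⊤} (hf : M.supp f ⊆ U) (η : P.CDist ⊤ E)
    (s : P.CSec ⊤) : (extDist hP U E (mulDist hP hf E η)).1 s = η.1 (P.fmul f s) := by
  obtain ⟨K, hK⟩ := η.2
  obtain ⟨g, -, hgU, hg⟩ := ComplexLRS.exists_cutoff (K.inter hf).2.1 (K.inter hf).2.2
  have hsupp : Dist.supp (mulDist hP hf E η).1 ⊆ K.inter hf :=
    (supp_comp_fmulExt hP f).trans (Set.inter_subset_inter_left _ hK)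
  have h := (isExtDist_iff hP (mulDist hP hf E η) _).2 rfl
  rw [IsExtDist.apply_eq hP h.1 hgU (hg.mono_right (h.2.trans hsupp)), mulDist_apply,
    extSec_mulSec]
  refine (Dist.apply_eq_apply hP η.1 (S := M.supp (1 - g) ∩ M.supp f) ?_ ?_).symm
  · have : (P.fmul f s).1 - (P.fmul f (P.fmul g s)).1 = (1 - g) • f • s.1 := by
      rw [sub_smul, one_smul, smul_comm g f]
      rfl
    rw [this]
    exact Set.subset_inter (supp_smul_subset_left _ _)
      ((supp_smul_subset_right _ _).trans (supp_smul_subset_left _ _))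
  · exact Set.disjoint_left.2 fun a ha ha' => hg.le_bot ⟨ha.1, hK ha', ha.2⟩

/-- The compact support of the functional selects the finitely many indices, and `extDist_mulDist`
reduces the sum of the pieces to evaluation on `∑ f α s`. -/
lemma exists_rightInverse_CDist {Γ : Type w} [DecidableEq Γ] {U : Γ → Opens M.pt}
    (hP : P.IsLocal) {f : Γ → M.Fun ⊤} (hf : IsFormalPartition U f) :
    ∃ S : P.CDist ⊤ E →L[ℂ] (⨁ α, P.CDist (U α) E),
      (directSumDesc fun α => extDist hP (U α) E).comp S = ContinuousLinearMap.id ℂ _ ∧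
      ∀ η α, S η α = mulDist hP (hf.supp_subset α) E η := by
  have hzero {η : P.CDist ⊤ E} {α : Γ} (h : Disjoint (M.supp (f α)) (Dist.supp η.1)) :
      mulDist hP (hf.supp_subset α) E η = 0 :=
    Subtype.ext (ContinuousLinearMap.ext fun s =>
      Dist.apply_eq_zero hP η.1 (h.mono_left (supp_smul_subset_left _ _)))
  refine exists_directSumDesc_rightInverse (fun α => extDist hP (U α) E) _ _ rfl
    (fun α => (mulDist hP (hf.supp_subset α) E).toLinearMap) (fun K α => ?_) (fun K => ?_)
    fun η => ?_
  · exact (mulDist hP (hf.supp_subset α) E).continuous.comp (continuous_distSuppIncl K)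
  · obtain ⟨A, hA⟩ := hf.exists_finset K.2.1
    exact ⟨A, fun α hα η => hzero ((hA α hα).mono_right η.2)⟩
  · obtain ⟨K, hK⟩ := η.2
    obtain ⟨A, hA⟩ := hf.exists_finset K.2.1
    refine ⟨A, fun α hα => hzero ((hA α hα).mono_right hK), ?_⟩
    refine Subtype.ext ((map_sum (P.distC ⊤ E).subtype _ _).trans ?_)
    refine ContinuousLinearMap.ext fun s => ?_
    rw [sum_apply]
    refine (Finset.sum_congr rfl fun α _ => extDist_mulDist hP (hf.supp_subset α) η s).trans ?_
    rw [← map_sum]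
    obtain ⟨V, hV, h⟩ := hf.exists_opens_sum_eq_one hA
    -- The section and its finite sum of pieces agree on `V`, a neighbourhood of the support of `η`.
    refine (Dist.apply_eq_apply hP η.1 (S := Vᶜ) ?_
      (Set.disjoint_left.2 fun a ha ha' => ha (hV (hK ha')))).symm
    have h1 : s.1 - (∑ α ∈ A, P.fmul (f α) s).1 = s.1 - (∑ α ∈ A, f α) • s.1 := by
      rw [Finset.sum_smul]
      exact congrArg (s.1 - ·) (map_sum (P.secC ⊤).subtype _ _)
    rw [h1]
    refine fun a ha haV => ha.2 V le_top haV ?_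
    rw [map_sub, P.res_smul, h, one_smul, sub_self]

end OMod

/-! ### The theorem for the three cosheaves -/

theorem mainTheorem5 (M : ComplexLRS.{u}) [IsFormalManifold M]
    (F : SheafOfModules.{v} M.ringSheaf)
    (E : Type w) [AddCommGroup E] [Module ℂ E] [UniformSpace E] [IsUniformAddGroup E]
    [ContinuousSMul ℂ E] [LocallyConvexSpace ℝ E] [T2Space E] [QuasiCompleteSpace ℂ E]
    (Γ : Type x) [DecidableEq Γ] (U : Γ → Opens M.pt) (hU : ⨆ α, U α = ⊤) :
    (∃ f, IsFormalPartition U f) ∧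
    (∃ Φ : (⨁ α, (OMod.ofSheaf F).FormalDensity (U α)) →L[ℂ] (OMod.ofSheaf F).FormalDensity ⊤,
      (∀ α η η', OMod.IsExtDensity η η' ↔ Φ (DirectSum.lof ℂ Γ _ α η) = η') ∧
      IsOpenMap Φ ∧ Function.Surjective Φ ∧
      ∀ f, IsFormalPartition U f → ∃ S : (OMod.ofSheaf F).FormalDensity ⊤ →L[ℂ]
          (⨁ α, (OMod.ofSheaf F).FormalDensity (U α)),
        Φ.comp S = ContinuousLinearMap.id ℂ _ ∧
        ∀ η α (s : (OMod.ofSheaf F).sec (U α)), ∃ t : (OMod.ofSheaf F).sec ⊤,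
          OMod.IsProduct (f α) s t ∧ (S η α).1 s = η.1 t) ∧
    (∃ Φ : (⨁ α, (OMod.ofSheaf F).CSec (U α)) →L[ℂ] (OMod.ofSheaf F).CSec ⊤,
      (∀ α s s', OMod.IsExtSec s s' ↔ Φ (DirectSum.lof ℂ Γ _ α s) = s') ∧
      IsOpenMap Φ ∧ Function.Surjective Φ ∧
      ∀ f, IsFormalPartition U f → ∃ S : (OMod.ofSheaf F).CSec ⊤ →L[ℂ]
          (⨁ α, (OMod.ofSheaf F).CSec (U α)),
        Φ.comp S = ContinuousLinearMap.id ℂ _ ∧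
        ∀ s α, (S s α).1 = (OMod.ofSheaf F).res le_top (f α • s.1)) ∧
    (∃ Φ : (⨁ α, (OMod.ofSheaf F).CDist (U α) E) →L[ℂ] (OMod.ofSheaf F).CDist ⊤ E,
      (∀ α η η', OMod.IsExtDist η η' ↔ Φ (DirectSum.lof ℂ Γ _ α η) = η') ∧
      IsOpenMap Φ ∧ Function.Surjective Φ ∧
      ∀ f, IsFormalPartition U f → ∃ S : (OMod.ofSheaf F).CDist ⊤ E →L[ℂ]
          (⨁ α, (OMod.ofSheaf F).CDist (U α) E),
        Φ.comp S = ContinuousLinearMap.id ℂ _ ∧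
        ∀ η α (s : (OMod.ofSheaf F).CSec (U α)), ∃ t : (OMod.ofSheaf F).CSec ⊤,
          OMod.IsExtSec s t ∧ (S η α).1 s = η.1 ((OMod.ofSheaf F).fmul (f α) t)) := by
  have hP := OMod.isLocal_ofSheaf F
  obtain ⟨f₀, hf₀⟩ := ComplexLRS.exists_isFormalPartition U hU
  refine ⟨⟨f₀, hf₀⟩, ?_, ?_, ?_⟩
  · obtain ⟨S, hS, -⟩ := OMod.exists_rightInverse_FormalDensity hP hf₀
    refine ⟨_, fun α η η' => ?_, isOpenMap_of_rightInverse _ S hS,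
      fun η => ⟨S η, DFunLike.congr_fun hS η⟩, fun f hf => ?_⟩
    · rw [directSumDesc_lof, OMod.isExtDensity_iff]
    · obtain ⟨S, hS, h⟩ := OMod.exists_rightInverse_FormalDensity hP hf
      exact ⟨S, hS, fun η α s => ⟨_, OMod.isProduct_mulExt hP (hf.supp_subset α) s, by
        rw [h, OMod.mulDens_apply]⟩⟩
  · obtain ⟨S, hS, -⟩ := OMod.exists_rightInverse_CSec hP hf₀
    refine ⟨_, fun α s s' => ?_, isOpenMap_of_rightInverse _ S hS,
      fun s => ⟨S s, DFunLike.congr_fun hS s⟩, fun f hf => ?_⟩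
    · rw [directSumDesc_lof, OMod.isExtSec_iff_extSec_eq hP]
    · obtain ⟨S, hS, h⟩ := OMod.exists_rightInverse_CSec hP hf
      exact ⟨S, hS, fun s α => by rw [h, OMod.mulSec_val]⟩
  · obtain ⟨S, hS, -⟩ := OMod.exists_rightInverse_CDist (E := E) hP hf₀
    refine ⟨_, fun α η η' => ?_, isOpenMap_of_rightInverse _ S hS,
      fun η => ⟨S η, DFunLike.congr_fun hS η⟩, fun f hf => ?_⟩
    · rw [directSumDesc_lof, OMod.isExtDist_iff hP]
    · obtain ⟨S, hS, h⟩ := OMod.exists_rightInverse_CDist (E := E) hP hf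
      exact ⟨S, hS, fun η α s => ⟨_, OMod.isExtSec_extSec hP s, by rw [h, OMod.mulDist_apply]⟩⟩
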